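/- A dominating set of a graph $G=(V,E)$ is a set $D\subseteq V$ such that every vertex outside $D$ has a neighbour in $D$. A tree decomposition of $G$ is a tree $T$ with a bag $X_x\subseteq V$ for each node $x$, such that the bags cover $V$, both ends of every edge of $G$ lie together in some bag, and, whenever $v\in X_x\cap X_y$, the vertex $v$ lies in all bags on the path of $T$ from $x$ to $y$; its width is the size of a largest bag minus one. Theorem. There is an algorithm that, given a graph $G$ with $n$ vertices and a tree decomposition of $G$ of width $k$ with $O(n)$ nodes, computes the size of a minimum dominating set in $G$ in $O(n\,k^2\,3^k)$ time on a random access machine with $O(k)$-bit words (for $k=0$, read $k$ as $1$ in both bounds). In detail: there are a single program and a constant $c$ such that for every $a$ there is a constant $C$ for which the following holds. For all graphs $G$ on the vertices $0,\dots,n-1$ and all tree decompositions of $G$ of width $k$ with $N\le a n$ nodes, on a machine with words of $c\max(k,1)$ bits the program halts after at most $C\,n\,\max(k,1)^2\,3^k$ steps and outputs the minimum size of a dominating set of $G$. The input consists of $n$, $N$, the number of edges of $G$, the edges of $G$, the edges of the tree, and the bags with their sizes, each listed in arbitrary order. One step is a memory access, a copy, a comparison, an addition or subtraction, or a multiplication.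 Both factors and the product of a multiplication, the second operand of an addition or subtraction, and the constants in the program must be words, that is, fit in $c\max(k,1)$ bits. Addresses (such as the names of vertices), which may be longer than a word if $n$ is not bounded by $2^{O(k)}$, can be used to access memory, copied, compared, and moved up or down by a word. -/

import Mathlib

/-! ## Dominating sets and tree decompositions -/

/-- `D` is a dominating set of `G`: every vertex outside `D` has a neighbour in `D`. -/
def IsDominatingSet {V : Type*} (G : SimpleGraph V) (D : Finset V) : Prop :=
  ∀ v, v ∉ D → ∃ d ∈ D, G.Adj v d

/-- `r` is the size of a minimum dominating set of `G`. -/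
def IsMinDominatingSetSize {V : Type*} (G : SimpleGraph V) (r : ℕ) : Prop :=
  IsLeast {m : ℕ | ∃ D : Finset V, IsDominatingSet G D ∧ D.card = m} r

/-- A tree decomposition of `G` whose tree has node set `ι`. -/
structure TreeDecomposition {V : Type*} (G : SimpleGraph V) (ι : Type*) where
  tree : SimpleGraph ι
  isTree : tree.IsTree
  bag : ι → Finset V
  exists_mem_bag : ∀ v, ∃ x, v ∈ bag x
  exists_edge_bag : ∀ u v, G.Adj u v → ∃ x, u ∈ bag x ∧ v ∈ bag x
  mem_bag_of_path : ∀ (v : V) (x y : ι), v ∈ bag x → v ∈ bag y →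
    ∀ p : tree.Walk x y, p.IsPath → ∀ z ∈ p.support, v ∈ bag z

/-- The size of the largest bag minus one (only used for graphs with at least one vertex, where
some bag is nonempty). -/
def TreeDecomposition.width {V ι : Type*} [Fintype ι] {G : SimpleGraph V}
    (T : TreeDecomposition G ι) : ℕ :=
  (Finset.univ.sup fun x => (T.bag x).card) - 1

/-! ## The random access machine with `w`-bit words

The machine has registers and a random access memory that is divided into arrays; a program is a
finite text and so uses a fixed finite number of registers and arrays.  Every array is infinite and
indexed by natural numbers.

A *word* is a number less than `2 ^ w`.  A cell holds either a word or an address (an index into an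
array, such as the name of a vertex), and addresses may have more than `w` bits when the memory in
use has more than `2 ^ w` cells.  Proper arithmetic is available on words only.  With an address one
can access the memory, copy it, compare it, and move it up or down by a word.  As one step
increases the largest number present by less than `2 ^ w`, or creates a word, no number ever
exceeds (largest input number) + (number of steps + 1) * `2 ^ w`.

An instruction that violates these rules has no successor state: the machine is stuck, and the
computation does not count as terminating. -/

namespace RAM

/-- A machine state: the registers, and the cells `arr a i` (cell `i` of array `a`). -/
structure State where
  reg : ℕ → ℕ
  arr : ℕ → ℕ → ℕ

/-- Elementary instructions; `r`, `s`, `t` are register names and `a` is an array name. -/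
inductive Instr where
  /-- `r := c` -/
  | const (r c : ℕ)
  /-- `r := s` -/
  | copy (r s : ℕ)
  /-- `r := s + t`, where `t` holds a word -/
  | add (r s t : ℕ)
  /-- `r := s - t` (truncated at `0`), where `t` holds a word -/
  | sub (r s t : ℕ)
  /-- `r := s * t`, where `s`, `t` and the product are words -/
  | mul (r s t : ℕ)
  /-- `r := a[s]` -/
  | load (r a s : ℕ)
  /-- `a[s] := r` -/
  | store (a s r : ℕ)

/-- Write the number `x` into register `r`. -/
def State.setReg (σ : State) (r x : ℕ) : State :=
  { σ with reg := Function.update σ.reg r x }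

/-- Write the number `x` into cell `i` of array `a`. -/
def State.setArr (σ : State) (a i x : ℕ) : State :=
  { σ with arr := Function.update σ.arr a (Function.update (σ.arr a) i x) }

/-- The effect of an instruction on a machine with `w`-bit words; `none` if it is not allowed. -/
def Instr.step (w : ℕ) : Instr → State → Option State
  | const r c, σ => if c < 2 ^ w then some (σ.setReg r c) else none
  | copy r s, σ => some (σ.setReg r (σ.reg s))
  | add r s t, σ =>
      if σ.reg t < 2 ^ w then some (σ.setReg r (σ.reg s + σ.reg t)) else none
  | sub r s t, σ =>
      if σ.reg t < 2 ^ w then some (σ.setReg r (σ.reg s - σ.reg t)) else none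
  | mul r s t, σ =>
      if σ.reg s < 2 ^ w ∧ σ.reg t < 2 ^ w ∧ σ.reg s * σ.reg t < 2 ^ w then
        some (σ.setReg r (σ.reg s * σ.reg t))
      else none
  | load r a s, σ => some (σ.setReg r (σ.arr a (σ.reg s)))
  | store a s r, σ => some (σ.setArr a (σ.reg s) (σ.reg r))

/-- Tests: comparisons of two registers. -/
inductive Test where
  | lt (s t : ℕ)
  | eq (s t : ℕ)

/-- The test succeeds in the given state. -/
def Test.Holds : Test → State → Prop
  | lt s t, σ => σ.reg s < σ.reg t
  | eq s t, σ => σ.reg s = σ.reg t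

/-- Programs. -/
inductive Program where
  | skip
  | instr (i : Instr)
  | seq (P Q : Program)
  | ite (b : Test) (P Q : Program)
  | while (b : Test) (P : Program)

/-- `Exec w P σ t τ`: on a machine with `w`-bit words, the program `P` started in state `σ` halts in
state `τ` after exactly `t` steps, where every elementary instruction and every evaluation of a test
is one step. -/
inductive Exec (w : ℕ) : Program → State → ℕ → State → Prop where
  | skip (σ : State) : Exec w .skip σ 0 σ
  | instr {i : Instr} {σ τ : State} (h : i.step w σ = some τ) : Exec w (.instr i) σ 1 τ
  | seq {P Q : Program} {σ τ υ : State} {t u : ℕ}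
      (hP : Exec w P σ t τ) (hQ : Exec w Q τ u υ) : Exec w (.seq P Q) σ (t + u) υ
  | ite_true {b : Test} {P Q : Program} {σ τ : State} {t : ℕ}
      (hb : b.Holds σ) (hP : Exec w P σ t τ) : Exec w (.ite b P Q) σ (t + 1) τ
  | ite_false {b : Test} {P Q : Program} {σ τ : State} {t : ℕ}
      (hb : ¬ b.Holds σ) (hQ : Exec w Q σ t τ) : Exec w (.ite b P Q) σ (t + 1) τ
  | while_true {b : Test} {P : Program} {σ τ υ : State} {t u : ℕ}
      (hb : b.Holds σ) (hP : Exec w P σ t τ) (hW : Exec w (.while b P) τ u υ) :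
      Exec w (.while b P) σ (t + u + 1) υ
  | while_false {b : Test} {P : Program} {σ : State}
      (hb : ¬ b.Holds σ) : Exec w (.while b P) σ 1 σ

/-- The initial state on input `l`: the input is stored in array `0`, from index `0` on, and all
other cells and all registers hold `0`. -/
def initState (l : List ℕ) : State where
  reg := fun _ => 0
  arr := fun a i => if a = 0 then l.getD i 0 else 0

/-- On a machine with `w`-bit words, the program `P` halts on input `l` after `t` steps, with the
number `r` in register `0`. -/
def Computes (w : ℕ) (P : Program) (l : List ℕ) (t r : ℕ) : Prop :=
  ∃ τ : State, Exec w P (initState l) t τ ∧ τ.reg 0 = r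

end RAM

/-! ## The input -/

/-- `es` lists every edge of `G` exactly once; the order of the edges, and the order of the two ends
of an edge, are arbitrary. -/
def IsEdgeList {V : Type*} (G : SimpleGraph V) (es : List (V × V)) : Prop :=
  (es.map fun e => s(e.1, e.2)).Nodup ∧
    ∀ u v, s(u, v) ∈ es.map (fun e => s(e.1, e.2)) ↔ G.Adj u v

/-- A way to write down a graph on the vertices `0, …, n - 1` together with a tree decomposition with
nodes `0, …, N - 1`: lists of the edges of the graph and of the tree, and for each node a list of the
vertices in its bag, all in arbitrary order. -/
structure InputListing {n N : ℕ} {G : SimpleGraph (Fin n)}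
    (T : TreeDecomposition G (Fin N)) where
  edges : List (Fin n × Fin n)
  isEdgeList_edges : IsEdgeList G edges
  treeEdges : List (Fin N × Fin N)
  isEdgeList_treeEdges : IsEdgeList T.tree treeEdges
  bagList : Fin N → List (Fin n)
  nodup_bagList : ∀ x, (bagList x).Nodup
  mem_bagList : ∀ x v, v ∈ bagList x ↔ v ∈ T.bag x

/-- The input as a list of numbers: `n`, `N`, the number of edges of the graph, the ends of these
edges, the ends of the `N - 1` edges of the tree, and for each node `0, …, N - 1` the size of its
bag followed by the vertices in the bag. -/
def InputListing.code {n N : ℕ} {G : SimpleGraph (Fin n)} {T : TreeDecomposition G (Fin N)}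
    (I : InputListing T) : List ℕ :=
  [n, N, I.edges.length]
    ++ I.edges.flatMap (fun e => [(e.1 : ℕ), (e.2 : ℕ)])
    ++ I.treeEdges.flatMap (fun e => [(e.1 : ℕ), (e.2 : ℕ)])
    ++ (List.finRange N).flatMap
        (fun x => (I.bagList x).length :: (I.bagList x).map (fun v => (v : ℕ)))

namespace RAM

/-! ## A program logic with step counts -/

/-! The algorithm is dynamic programming over the rooted decomposition with three states per bag
vertex. It is arranged so that one node costs `O(K ^ 2 * 3 ^ K)` steps, where `K` is the size of a
largest bag.

Every vertex gets a slot below `K`, different for vertices in a common bag. The top of a vertex is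
the first node, in an order with parents before children, whose bag contains it. A vertex is
finished when its top is processed, and an edge is added at the later of the tops of its ends; by
`Rooted.adj_max` both ends lie in that bag. For a partial graph, a table gives for every base-three
code over the slots the least number of vertices to be paid for (`Val`). A slot with digit 0 counts
as chosen and is paid for elsewhere, digit 1 asks for nothing, digit 2 asks for domination. In
addition any slot may be paid for at price one. Under this convention code 0 is the cheapest
(`Val.to_zero`), and no code costs more than `K` above it, because paying for all slots settles
everything (`Val.of_zero`). So a table splits into an offset, collected in the output register, and
entries between 0 and `K` that vanish at code 0 (`Tab.le`). This bound on the entries is what makes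
the join fast.

Tables change by four operations. An edge between a free slot and a demanding one settles the demand
(`val_edge`), which is one pass over the table. Once the edges of a node are in, closing decides
which slots to pay for (`val_close`), digit by digit (`closeF_le`). Forgetting a vertex turns its
own need to be dominated into a demand (`val_forget`). Joining minimises over payments and over
pairs of codes that together cover a code (`val_join`). Introducing a vertex is no operation at all:
a slot without a vertex just has to be paid for if it carries a demand (`val_init`).

Enumerating the covering pairs of a join would take `5 ^ K` steps. Instead, for every total cost up
to `2 * K`, the pairs of that cost covering a code are counted. The indicator functions of the costs
are summed over the order with 1 below 2 and 0 isolated, multiplied pointwise as polynomials in the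
cost (`covC_zero`), and transformed back (`covC_succ_of_eq`). The least cost with a nonzero count is
the minimum (`covC_ne_zero`). There are `2 * K + 1` cost layers, so both the transforms and the
products take `O(K ^ 2 * 3 ^ K)` steps, and all counts are at most `9 ^ K`, hence words.

A breadth first search roots the tree, and slots are handed out greedily along it. The nodes are
processed backwards and each is merged into its parent (`Rooted.Merged`). At the root every vertex
is finished, and the collected offsets are the answer (`run_mainLoop`). Correctness and step counts
are proved together, by a Hoare logic whose triples `Run` carry a step bound. -/

@[simp] theorem State.setReg_reg (σ : State) (r x s : ℕ) :
    (σ.setReg r x).reg s = if s = r then x else σ.reg s := by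
  simp [State.setReg, Function.update_apply]

@[simp] theorem State.setReg_arr (σ : State) (r x : ℕ) : (σ.setReg r x).arr = σ.arr := rfl

@[simp] theorem State.setArr_reg (σ : State) (a i x : ℕ) : (σ.setArr a i x).reg = σ.reg := rfl

@[simp] theorem State.setArr_arr (σ : State) (a i x b : ℕ) :
    (σ.setArr a i x).arr b = if b = a then Function.update (σ.arr a) i x else σ.arr b := by
  simp [State.setArr, Function.update_apply]

/-- Does the instruction write register `x`? -/
def Instr.wr : Instr → ℕ → Bool
  | const r _, x => x == r
  | copy r _, x => x == r
  | add r _ _, x => x == r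
  | sub r _ _, x => x == r
  | mul r _ _, x => x == r
  | load r _ _, x => x == r
  | store _ _ _, _ => false

/-- Does the instruction write array `x`? -/
def Instr.wa : Instr → ℕ → Bool
  | store a _ _, x => x == a
  | _, _ => false

/-- Does the program contain an instruction that writes register `x`? -/
def Program.wr : Program → ℕ → Bool
  | skip, _ => false
  | instr i, x => i.wr x
  | seq P Q, x => P.wr x || Q.wr x
  | ite _ P Q, x => P.wr x || Q.wr x
  | .while _ P, x => P.wr x

/-- Does the program contain an instruction that writes array `x`? -/
def Program.wa : Program → ℕ → Bool
  | skip, _ => false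
  | instr i, x => i.wa x
  | seq P Q, x => P.wa x || Q.wa x
  | ite _ P Q, x => P.wa x || Q.wa x
  | .while _ P, x => P.wa x

/-- The states agree on everything that the program does not write. -/
structure Fr (P : Program) (σ τ : State) : Prop where
  reg : ∀ r, P.wr r = false → τ.reg r = σ.reg r
  arr : ∀ a, P.wa a = false → τ.arr a = σ.arr a

theorem Fr.refl (P : Program) (σ : State) : Fr P σ σ := ⟨fun _ _ => rfl, fun _ _ => rfl⟩

theorem Fr.trans {P : Program} {σ τ υ : State} (h : Fr P σ τ) (h' : Fr P τ υ) : Fr P σ υ :=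
  ⟨fun r hr => (h'.reg r hr).trans (h.reg r hr), fun a ha => (h'.arr a ha).trans (h.arr a ha)⟩

theorem Fr.mono {P Q : Program} {σ τ : State} (h : Fr P σ τ)
    (hr : ∀ r, Q.wr r = false → P.wr r = false) (ha : ∀ a, Q.wa a = false → P.wa a = false) :
    Fr Q σ τ :=
  ⟨fun r h' => h.reg r (hr r h'), fun a h' => h.arr a (ha a h')⟩

/-- The frame depends on the text of the program only, so later proofs establish that a register or
array has survived a run by `rfl` or `decide`. -/
theorem Exec.fr {w : ℕ} {P : Program} {σ τ : State} {t : ℕ} (h : Exec w P σ t τ) : Fr P σ τ := by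
  induction h with
  | skip σ => exact Fr.refl _ _
  | @instr i σ τ h =>
    constructor
    · intro r hr
      cases i <;> simp only [Instr.step, Program.wr, Instr.wr, beq_eq_false_iff_ne] at h hr <;>
        first
        | (split_ifs at h; simp only [Option.some.injEq] at h; subst h; simp [hr])
        | (simp only [Option.some.injEq] at h; subst h; simp [hr])
    · intro a ha
      cases i <;> simp only [Instr.step, Program.wa, Instr.wa, beq_eq_false_iff_ne] at h ha <;>
        first
        | (split_ifs at h; simp only [Option.some.injEq] at h; subst h; simp)
        | (simp only [Option.some.injEq] at h; subst h; simp [ha])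
  | seq hP hQ ih1 ih2 =>
    refine Fr.trans (ih1.mono ?_ ?_) (ih2.mono ?_ ?_) <;> intro r hr <;>
      simp [Program.wr, Program.wa] at hr <;> simp [hr]
  | ite_true hb hP ih =>
    refine ih.mono ?_ ?_ <;> intro r hr <;> simp [Program.wr, Program.wa] at hr <;> simp [hr]
  | ite_false hb hP ih =>
    refine ih.mono ?_ ?_ <;> intro r hr <;> simp [Program.wr, Program.wa] at hr <;> simp [hr]
  | while_true hb hP hW ih1 ih2 => exact Fr.trans (ih1.mono (fun _ h => h) (fun _ h => h)) ih2
  | while_false hb => exact Fr.refl _ _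

/-- The program halts within `B` steps in a state that satisfies `Q`. -/
def Run (w : ℕ) (P : Program) (σ : State) (B : ℕ) (Q : State → Prop) : Prop :=
  ∃ t τ, Exec w P σ t τ ∧ t ≤ B ∧ Q τ

theorem Run.mono {w : ℕ} {P : Program} {σ : State} {B B' : ℕ} {Q Q' : State → Prop}
    (h : Run w P σ B Q) (hB : B ≤ B') (hQ : ∀ τ, Q τ → Fr P σ τ → Q' τ) : Run w P σ B' Q' := by
  obtain ⟨t, τ, h1, h2, h3⟩ := h
  exact ⟨t, τ, h1, h2.trans hB, hQ τ h3 h1.fr⟩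

theorem Run.seq {w : ℕ} {P P' : Program} {σ : State} {B₁ B₂ B : ℕ} {R Q : State → Prop}
    (h : Run w P σ B₁ R) (h' : ∀ τ, R τ → Fr P σ τ → Run w P' τ B₂ Q) (hB : B₁ + B₂ ≤ B) :
    Run w (.seq P P') σ B Q := by
  obtain ⟨t, τ, h1, h2, h3⟩ := h
  obtain ⟨t', τ', h1', h2', h3'⟩ := h' τ h3 h1.fr
  exact ⟨t + t', τ', .seq h1 h1', by omega, h3'⟩

theorem Run.ite {w : ℕ} {b : Test} {P P' : Program} {σ : State} {B : ℕ} {Q : State → Prop}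
    (h : b.Holds σ → Run w P σ B Q) (h' : ¬ b.Holds σ → Run w P' σ B Q) :
    Run w (.ite b P P') σ (B + 1) Q := by
  by_cases hb : b.Holds σ
  · obtain ⟨t, τ, h1, h2, h3⟩ := h hb
    exact ⟨t + 1, τ, .ite_true hb h1, by omega, h3⟩
  · obtain ⟨t, τ, h1, h2, h3⟩ := h' hb
    exact ⟨t + 1, τ, .ite_false hb h1, by omega, h3⟩

/-- The while rule with a ghost state `g` and a potential `Φ g` that pays for the steps. -/
theorem Run.while {w : ℕ} {b : Test} {P : Program} {σ : State} {ι : Type*}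
    (Inv : ι → State → Prop) (Φ : ι → ℕ) (g₀ : ι) (h₀ : Inv g₀ σ)
    (hstep : ∀ g τ, Inv g τ → b.Holds τ → Fr (.while b P) σ τ →
      ∃ B, Run w P τ B (fun τ' => ∃ g', Inv g' τ' ∧ B + 1 + Φ g' ≤ Φ g)) :
    Run w (.while b P) σ (Φ g₀ + 1) (fun τ => ∃ g, Inv g τ ∧ ¬ b.Holds τ) := by
  -- The potential drops in every round by at least the one step of the test, so induction on a
  -- bound for it suffices.
  have key : ∀ m g τ, Φ g ≤ m → Inv g τ → Fr (.while b P) σ τ →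
      Run w (.while b P) τ (Φ g + 1) (fun τ => ∃ g, Inv g τ ∧ ¬ b.Holds τ) := by
    intro m
    induction m with
    | zero =>
      intro g τ hm hI hF
      by_cases hb : b.Holds τ
      · obtain ⟨B, t, τ', h1, h2, g', h3, h4⟩ := hstep g τ hI hb hF
        omega
      · exact ⟨1, τ, .while_false hb, by omega, g, hI, hb⟩
    | succ m ih =>
      intro g τ hm hI hF
      by_cases hb : b.Holds τ
      · obtain ⟨B, t, τ', h1, h2, g', h3, h4⟩ := hstep g τ hI hb hF
        obtain ⟨t', υ, e1, e2, e3⟩ := ih g' τ' (by omega) h3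
          (hF.trans (h1.fr.mono (fun _ h => h) (fun _ h => h)))
        exact ⟨t + t' + 1, υ, .while_true hb h1 e1, by omega, e3⟩
      · exact ⟨1, τ, .while_false hb, by omega, g, hI, hb⟩
  exact key _ g₀ σ le_rfl h₀ (Fr.refl _ _)

/-- The weakest precondition of an instruction. -/
def Instr.wp (w : ℕ) : Instr → State → (State → Prop) → Prop
  | const r c, σ, Q => c < 2 ^ w ∧ Q (σ.setReg r c)
  | copy r s, σ, Q => Q (σ.setReg r (σ.reg s))
  | add r s t, σ, Q => σ.reg t < 2 ^ w ∧ Q (σ.setReg r (σ.reg s + σ.reg t))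
  | sub r s t, σ, Q => σ.reg t < 2 ^ w ∧ Q (σ.setReg r (σ.reg s - σ.reg t))
  | mul r s t, σ, Q =>
      (σ.reg s < 2 ^ w ∧ σ.reg t < 2 ^ w ∧ σ.reg s * σ.reg t < 2 ^ w) ∧
        Q (σ.setReg r (σ.reg s * σ.reg t))
  | load r a s, σ, Q => Q (σ.setReg r (σ.arr a (σ.reg s)))
  | store a s r, σ, Q => Q (σ.setArr a (σ.reg s) (σ.reg r))

/-- The weakest precondition of a program without loops. -/
def Program.wp (w : ℕ) : Program → State → (State → Prop) → Prop
  | skip, σ, Q => Q σ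
  | instr i, σ, Q => i.wp w σ Q
  | seq P P', σ, Q => P.wp w σ fun τ => P'.wp w τ Q
  | ite b P P', σ, Q => (b.Holds σ → P.wp w σ Q) ∧ (¬ b.Holds σ → P'.wp w σ Q)
  | .while _ _, _, _ => False

/-- The largest number of steps of a program without loops. -/
def Program.cost : Program → ℕ
  | skip => 0
  | instr _ => 1
  | seq P P' => P.cost + P'.cost
  | ite _ P P' => max P.cost P'.cost + 1
  -- A value that is never used: the precondition of a loop is `False`.
  | .while _ _ => 0

theorem Run.instr {w : ℕ} {i : Instr} {σ : State} {Q : State → Prop} (h : i.wp w σ Q) :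
    Run w (.instr i) σ 1 Q := by
  cases i with
  | const r c => exact ⟨1, _, .instr (by simp only [Instr.step]; rw [if_pos h.1]), le_rfl, h.2⟩
  | copy r s => exact ⟨1, _, .instr rfl, le_rfl, h⟩
  | add r s t => exact ⟨1, _, .instr (by simp only [Instr.step]; rw [if_pos h.1]), le_rfl, h.2⟩
  | sub r s t => exact ⟨1, _, .instr (by simp only [Instr.step]; rw [if_pos h.1]), le_rfl, h.2⟩
  | mul r s t => exact ⟨1, _, .instr (by simp only [Instr.step]; rw [if_pos h.1]), le_rfl, h.2⟩
  | load r a s => exact ⟨1, _, .instr rfl, le_rfl, h⟩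
  | store a s r => exact ⟨1, _, .instr rfl, le_rfl, h⟩

theorem Run.of_wp {w : ℕ} {P : Program} {σ : State} {B : ℕ} {Q : State → Prop}
    (hB : P.cost ≤ B) (h : P.wp w σ Q) : Run w P σ B Q := by
  suffices Run w P σ P.cost Q from this.mono hB (fun _ h _ => h)
  clear hB
  induction P generalizing σ Q with
  | skip => exact ⟨0, σ, .skip σ, le_rfl, h⟩
  | instr i => exact Run.instr h
  | seq P P' ih ih' => exact (ih h).seq (fun τ hτ _ => ih' hτ) le_rfl
  | ite b P P' ih ih' =>
    exact Run.ite (fun hb => (ih (h.1 hb)).mono (le_max_left _ _) (fun _ h _ => h))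
      (fun hb => (ih' (h.2 hb)).mono (le_max_right _ _) (fun _ h _ => h))
  | _ => exact h.elim

/-- Count register `i` up to register `lim`; register `1` holds the number one. -/
def forUp (i lim : ℕ) (body : Program) : Program :=
  .while (.lt i lim) (.seq body (.instr (.add i i 1)))

/-- A round costs the body, the test and the increment, hence `B + 2`; the failing test at the end
is the last step. The invariant is required after the counter has been raised, so it may speak about
the counter. -/
theorem Run.forUp {w i lim : ℕ} {body : Program} {σ : State} (Inv : ℕ → State → Prop)
    {a b : ℕ} (B : ℕ) (hi : σ.reg i = a) (hl : σ.reg lim = b) (h1 : σ.reg 1 = 1) (hab : a ≤ b)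
    (hw : 1 < 2 ^ w) (hbi : body.wr i = false) (hbl : (RAM.forUp i lim body).wr lim = false)
    (hb1 : (RAM.forUp i lim body).wr 1 = false) (h0 : Inv a σ)
    (hstep : ∀ j τ, a ≤ j → j < b → τ.reg i = j → Fr (RAM.forUp i lim body) σ τ → Inv j τ →
      Run w body τ B (fun τ' => Inv (j + 1) (τ'.setReg i (j + 1)))) :
    Run w (RAM.forUp i lim body) σ ((b - a) * (B + 2) + 1) (fun τ => τ.reg i = b ∧ Inv b τ) := by
  refine Run.mono (Run.while (ι := ℕ)
    (fun j τ => τ.reg i = j ∧ a ≤ j ∧ j ≤ b ∧ Inv j τ) (fun j => (b - j) * (B + 2)) a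
    ⟨hi, le_rfl, hab, h0⟩ ?_) le_rfl ?_
  · rintro j τ ⟨hj, haj, hjb, hI⟩ hb hF
    have hlt : j < b := by
      simp only [Test.Holds] at hb
      rwa [hj, hF.reg lim hbl, hl] at hb
    refine ⟨B + 1, (hstep j τ haj hlt hj hF hI).seq (B₂ := 1) (fun τ' hI' hF' => Run.instr ?_) le_rfl⟩
    have e1 : τ'.reg i = j := (hF'.reg i hbi).trans hj
    have hb1' : body.wr 1 = false := by
      simp only [RAM.forUp, Program.wr, Bool.or_eq_false_iff] at hb1; exact hb1.1
    have e2 : τ'.reg 1 = 1 := (hF'.reg 1 hb1').trans ((hF.reg 1 hb1).trans h1)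
    simp only [Instr.wp, e1, e2]
    refine ⟨hw, j + 1, ⟨by simp, by omega, by omega, hI'⟩, ?_⟩
    obtain ⟨d, rfl⟩ : ∃ d, b = j + 1 + d := ⟨b - (j + 1), by omega⟩
    have : j + 1 + d - j = d + 1 := by omega
    rw [this, show j + 1 + d - (j + 1) = d by omega, Nat.succ_mul]
    omega
  · rintro τ ⟨j, ⟨hj, haj, hjb, hI⟩, hb⟩ hF
    simp only [Test.Holds] at hb
    rw [hj, hF.reg lim hbl, hl] at hb
    obtain rfl : j = b := by omega
    exact ⟨hj, hI⟩

/-- The linked list with first element `h` and successor function `nx` is `l`; `0` is the end. -/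
def Chn (nx : ℕ → ℕ) : ℕ → List ℕ → Prop
  | h, [] => h = 0
  | h, e :: l => h = e ∧ e ≠ 0 ∧ Chn nx (nx e) l

theorem Chn.congr {nx nx' : ℕ → ℕ} {h : ℕ} {l : List ℕ} (H : Chn nx h l)
    (hl : ∀ e ∈ l, nx' e = nx e) : Chn nx' h l := by
  induction l generalizing h with
  | nil => exact H
  | cons e l ih =>
    obtain ⟨h1, h2, h3⟩ := H
    refine ⟨h1, h2, ?_⟩
    rw [hl e (by simp)]
    exact ih h3 (fun e' he' => hl e' (by simp [he']))

end RAM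

set_option linter.unusedSimpArgs false

namespace DomSet

open RAM

/-! ### Codes of demands, and how the costs of partial solutions change -/

section

/-! ## Digits in base three -/

/-- Digit `s` of `c` in base three. -/
def dg (s c : ℕ) : ℕ := c / 3 ^ s % 3

theorem dg_lt (s c : ℕ) : dg s c < 3 := Nat.mod_lt _ (by norm_num)

@[simp] theorem dg_zero (s : ℕ) : dg s 0 = 0 := by simp [dg]

theorem dg_decomp {s lo : ℕ} (hi d t : ℕ) (hlo : lo < 3 ^ s) (hd : d < 3) :
    dg t (hi * 3 ^ (s + 1) + d * 3 ^ s + lo) =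
      if t = s then d else if t < s then dg t lo else dg (t - s - 1) hi := by
  have h3 : 0 < 3 ^ s := by positivity
  have e : (hi * 3 ^ (s + 1) + d * 3 ^ s + lo) / 3 ^ s = hi * 3 + d := by
    rw [show hi * 3 ^ (s + 1) + d * 3 ^ s + lo = lo + 3 ^ s * (hi * 3 + d) by ring,
      Nat.add_mul_div_left _ _ h3, Nat.div_eq_of_lt hlo, zero_add]
  unfold dg
  split_ifs with h1 h2
  · subst h1; rw [e]; omega
  · obtain ⟨u, rfl⟩ : ∃ u, s = t + 1 + u := ⟨s - (t + 1), by omega⟩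
    rw [show hi * 3 ^ (t + 1 + u + 1) + d * 3 ^ (t + 1 + u) + lo =
      lo + 3 ^ t * (3 * (hi * 3 ^ (u + 1) + d * 3 ^ u)) by ring,
      Nat.add_mul_div_left _ _ (by positivity)]
    omega
  · obtain ⟨u, rfl⟩ : ∃ u, t = s + 1 + u := ⟨t - (s + 1), by omega⟩
    rw [show 3 ^ (s + 1 + u) = 3 ^ s * (3 * 3 ^ u) by ring, ← Nat.div_div_eq_div_mul, e,
      ← Nat.div_div_eq_div_mul, show (hi * 3 + d) / 3 = hi by omega,
      show s + 1 + u - s - 1 = u by omega]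

theorem eq_decomp (s c : ℕ) :
    c = c / 3 ^ (s + 1) * 3 ^ (s + 1) + dg s c * 3 ^ s + c % 3 ^ s := by
  have h1 := Nat.div_add_mod c (3 ^ s)
  have h2 := Nat.div_add_mod (c / 3 ^ s) 3
  rw [Nat.div_div_eq_div_mul, ← pow_succ] at h2
  unfold dg
  calc c = 3 ^ s * (c / 3 ^ s) + c % 3 ^ s := h1.symm
    _ = 3 ^ s * (3 * (c / 3 ^ (s + 1)) + c / 3 ^ s % 3) + c % 3 ^ s := by rw [h2]
    _ = _ := by ring

theorem dg_mul_le (s c : ℕ) : dg s c * 3 ^ s ≤ c := by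
  have := eq_decomp s c
  omega

/-- Changing digit `s` from `dg s c` to `d`. -/
theorem dg_set {s c c' d : ℕ} (hd : d < 3) (h : c' + dg s c * 3 ^ s = c + d * 3 ^ s) (t : ℕ) :
    dg t c' = if t = s then d else dg t c := by
  have e := eq_decomp s c
  have hlo : c % 3 ^ s < 3 ^ s := Nat.mod_lt _ (by positivity)
  have e' : c' = c / 3 ^ (s + 1) * 3 ^ (s + 1) + d * 3 ^ s + c % 3 ^ s := by omega
  rw [e', dg_decomp _ _ _ hlo hd]
  conv_rhs => rw [e, dg_decomp _ _ _ hlo (dg_lt s c)]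
  split_ifs <;> rfl

theorem dg_clear (s c t : ℕ) : dg t (c - dg s c * 3 ^ s) = if t = s then 0 else dg t c :=
  dg_set (by norm_num) (by have := dg_mul_le s c; omega) t

theorem dg_dec {s c : ℕ} (h : dg s c = 2) (t : ℕ) :
    dg t (c - 3 ^ s) = if t = s then 1 else dg t c :=
  dg_set (by norm_num) (by have := dg_mul_le s c; rw [h] at *; omega) t

theorem dg_raise (s c t : ℕ) : dg t (c + (2 - dg s c) * 3 ^ s) = if t = s then 2 else dg t c :=
  dg_set (by norm_num) (by
    rw [add_assoc, ← add_mul, Nat.sub_add_cancel (by have := dg_lt s c; omega)]) t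

theorem dg_of_le {K s c : ℕ} (hc : c < 3 ^ K) (hs : K ≤ s) : dg s c = 0 := by
  rw [dg, Nat.div_eq_of_lt (hc.trans_le (Nat.pow_le_pow_right (by norm_num) hs))]

theorem dg_succ (s c : ℕ) : dg (s + 1) c = dg s (c / 3) := by
  rw [dg, dg, Nat.div_div_eq_div_mul, pow_succ']

theorem dg_flat {K s : ℕ} (hs : s < K) (i c : ℕ) : dg s (i * 3 ^ K + c) = dg s c := by
  obtain ⟨u, rfl⟩ : ∃ u, K = s + 1 + u := ⟨K - (s + 1), by omega⟩
  rw [dg, dg, show i * 3 ^ (s + 1 + u) + c = c + 3 ^ s * (3 * (i * 3 ^ u)) by ring,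
    Nat.add_mul_div_left _ _ (by positivity)]
  omega

theorem dg_ext {K : ℕ} : ∀ {c c' : ℕ}, c < 3 ^ K → c' < 3 ^ K →
    (∀ s < K, dg s c = dg s c') → c = c' := by
  induction K with
  | zero => intro c c' h h' _; simp at h h'; omega
  | succ K ih =>
    intro c c' h h' H
    have h0 := H 0 (by omega)
    simp only [dg, pow_zero, Nat.div_one] at h0
    have := ih (c := c / 3) (c' := c' / 3) (by rw [pow_succ] at h; omega)
      (by rw [pow_succ] at h'; omega)
      (fun s hs => by rw [← dg_succ, ← dg_succ]; exact H _ (by omega))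
    omega

theorem exists_dg (K : ℕ) : ∀ f : ℕ → ℕ, (∀ s, f s < 3) →
    ∃ c < 3 ^ K, ∀ s, dg s c = if s < K then f s else 0 := by
  induction K with
  | zero => intro f _; exact ⟨0, by simp, by simp⟩
  | succ K ih =>
    intro f hf
    obtain ⟨c, hc, h⟩ := ih (fun s => f (s + 1)) (fun s => hf _)
    have h0 := hf 0
    refine ⟨3 * c + f 0, by rw [pow_succ]; omega, fun s => ?_⟩
    cases s with
    | zero => simp only [dg, pow_zero, Nat.div_one]; simp; omega
    | succ s =>
      rw [dg_succ, show (3 * c + f 0) / 3 = c by omega, h]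
      simp

theorem lt_of_dg {K c : ℕ} (h : ∀ s, K ≤ s → dg s c = 0) : c < 3 ^ K := by
  obtain ⟨L, hL⟩ : ∃ L, c < 3 ^ L := ⟨c, Nat.lt_pow_self (by norm_num)⟩
  obtain ⟨c', hc', h'⟩ := exists_dg K (fun s => dg s c) (fun s => dg_lt s c)
  have hle : 3 ^ K ≤ 3 ^ (K + L) := Nat.pow_le_pow_right (by norm_num) (by omega)
  have hle' : 3 ^ L ≤ 3 ^ (K + L) := Nat.pow_le_pow_right (by norm_num) (by omega)
  rw [dg_ext (K := K + L) (c := c) (c' := c') (by omega) (by omega) (fun s _ => ?_)]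
  · exact hc'
  · rw [h']
    split_ifs with hs
    · rfl
    · exact h s (by omega)

theorem raise_lt {K s c : ℕ} (hs : s < K) (hc : c < 3 ^ K) : c + (2 - dg s c) * 3 ^ s < 3 ^ K := by
  apply lt_of_dg
  intro t ht
  rw [dg_raise, if_neg (by omega), dg_of_le hc ht]

/-! ## Partial solutions

A partial graph has the vertices `W`, and unfinished vertices that are named by slots below `K`.
A code `c` tells what is known about a slot: it is chosen for free (digit `0`), it has no demand
(digit `1`), or it has to be dominated (digit `2`). -/

/-- `u` belongs to the dominating set given by `D`, the paid slots `P` and the free slots. -/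
def On (slot : ℕ → ℕ) (W : Set ℕ) (D P : Finset ℕ) (c u : ℕ) : Prop :=
  (u ∈ W ∧ u ∈ D) ∨ (u ∉ W ∧ (dg (slot u) c = 0 ∨ slot u ∈ P))

/-- Cost `m` suffices for demand `c`; the edges `E'` are only used by free slots. -/
def Val (K : ℕ) (slot : ℕ → ℕ) (W : Set ℕ) (E E' : ℕ → ℕ → Prop) (c m : ℕ) : Prop :=
  ∃ D P : Finset ℕ, (∀ v ∈ D, v ∈ W) ∧ P ⊆ Finset.range K ∧ D.card + P.card ≤ m ∧
    (∀ v ∈ W, v ∈ D ∨ ∃ u, E v u ∧ On slot W D P c u) ∧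
    ∀ s < K, dg s c = 2 → s ∈ P ∨ (∃ v u, v ∉ W ∧ slot v = s ∧ E v u ∧ On slot W D P c u) ∨
      ∃ v u, slot v = s ∧ E' v u ∧ dg (slot u) c = 0

def noEdge : ℕ → ℕ → Prop := fun _ _ => False

/-- The number of demands in `c`. -/
def cnt (K c : ℕ) : ℕ := ((Finset.range K).filter fun s => dg s c = 2).card

variable {K : ℕ} {slot : ℕ → ℕ} {W W₁ W₂ : Set ℕ} {E E' E₁ E₂ : ℕ → ℕ → Prop} {c m : ℕ}

/-- Without edges a demand can only be met by paying for its slot. -/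
theorem val_init : Val K slot ∅ noEdge noEdge c m ↔ cnt K c ≤ m := by
  constructor
  · rintro ⟨D, P, h1, h2, h3, h4, h5⟩
    refine le_trans (Finset.card_le_card ?_) ((Nat.le_add_left _ _).trans h3)
    intro s hs
    simp only [Finset.mem_filter, Finset.mem_range] at hs
    simpa [noEdge] using h5 s hs.1 hs.2
  · intro h
    refine ⟨∅, (Finset.range K).filter fun s => dg s c = 2, by simp, Finset.filter_subset _ _,
      by simpa [cnt] using h, by simp, fun s hs h2 => Or.inl (by simp [hs, h2])⟩

/-- Paying for all slots settles every demand and replaces every free slot that the solution for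
code 0 relies on. -/
theorem Val.of_zero (hs : ∀ v u, E v u → u ∉ W → slot u < K)
    (h : Val K slot W E noEdge 0 m) : Val K slot W E noEdge c (m + K) := by
  obtain ⟨D, P, h1, h2, h3, h4, h5⟩ := h
  refine ⟨D, Finset.range K, h1, subset_rfl, by simp; omega, fun v hv => ?_, fun s hs _ =>
    Or.inl (by simpa using hs)⟩
  rcases h4 v hv with h | ⟨u, hu, h | h⟩
  · exact Or.inl h
  · exact Or.inr ⟨u, hu, Or.inl h⟩
  · exact Or.inr ⟨u, hu, Or.inr ⟨h.1, Or.inr (by simpa using hs v u hu h.1)⟩⟩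

/-- Code 0 has all slots free and no demands, so any solution for another code serves it as well. -/
theorem Val.to_zero (h : Val K slot W E noEdge c m) : Val K slot W E noEdge 0 m := by
  obtain ⟨D, P, h1, h2, h3, h4, h5⟩ := h
  refine ⟨D, P, h1, h2, h3, fun v hv => ?_, by simp⟩
  rcases h4 v hv with h | ⟨u, hu, h⟩
  · exact Or.inl h
  · refine Or.inr ⟨u, hu, ?_⟩
    rcases h with h | h
    · exact Or.inl h
    · exact Or.inr ⟨h.1, Or.inl (by simp)⟩

/-- Edges of `E'` help only from a free slot. If one end is free and the other has a demand, the new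
edge settles that demand, which therefore drops to 1; in all other cases the edge is useless until
the table is closed. -/
theorem val_edge {i j u v c' : ℕ} (hi : slot u = i) (hj : slot v = j)
    (hE : ∀ x y, E₂ x y ↔ E' x y ∨ (x = u ∧ y = v) ∨ (x = v ∧ y = u))
    (hc : ∀ t, dg t c' = if (t = j ∧ dg j c = 2 ∧ dg i c = 0) ∨ (t = i ∧ dg i c = 2 ∧ dg j c = 0)
      then 1 else dg t c) :
    Val K slot W E E₂ c m ↔ Val K slot W E E' c' m := by
  -- Only a 2 is lowered to 1, so the free slots stay the same and with them everything except the
  -- demands.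
  have h0 : ∀ t, dg t c' = 0 ↔ dg t c = 0 := by
    intro t
    rw [hc]
    split_ifs with h
    · rcases h with h | h <;> simp [h.1, h.2.1]
    · rfl
  have hOn : ∀ D P x, On slot W D P c' x ↔ On slot W D P c x := by
    intro D P x
    simp only [On, h0]
  simp only [Val, hOn, h0]
  refine exists_congr fun D => exists_congr fun P => and_congr_right fun _ => and_congr_right fun _ =>
    and_congr_right fun _ => and_congr_right fun _ => ?_
  refine forall_congr' fun s => forall_congr' fun _ => ?_
  rw [hc]
  split_ifs with h
  · simp only [OfNat.one_ne_ofNat, IsEmpty.forall_iff, iff_true]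
    intro _
    right; right
    rcases h with h | h
    · exact ⟨v, u, by rw [hj, h.1], (hE _ _).2 (Or.inr (Or.inr ⟨rfl, rfl⟩)), by rw [hi, h.2.2]⟩
    · exact ⟨u, v, by rw [hi, h.1], (hE _ _).2 (Or.inr (Or.inl ⟨rfl, rfl⟩)), by rw [hj, h.2.2]⟩
  · refine forall_congr' fun h2 => or_congr_right (or_congr_right ?_)
    constructor
    · rintro ⟨x, y, hx, hxy, hy⟩
      rcases (hE _ _).1 hxy with h' | ⟨rfl, rfl⟩ | ⟨rfl, rfl⟩
      · exact ⟨x, y, hx, h', hy⟩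
      · exact absurd (Or.inr ⟨by rw [← hx, hi], by rw [← hi, hx]; exact h2, by rw [← hj]; exact hy⟩) h
      · exact absurd (Or.inl ⟨by rw [← hx, hj], by rw [← hj, hx]; exact h2, by rw [← hi]; exact hy⟩) h
    · rintro ⟨x, y, hx, hxy, hy⟩
      exact ⟨x, y, hx, (hE _ _).2 (Or.inl hxy), hy⟩

theorem exists_clear (hc : c < 3 ^ K) (P : Finset ℕ) :
    ∃ c' < 3 ^ K, ∀ t, dg t c' = if t ∈ P then 0 else dg t c := by
  obtain ⟨c', h, h'⟩ := exists_dg K (fun t => if t ∈ P then 0 else dg t c)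
    (fun t => by split_ifs <;> simp [dg_lt])
  refine ⟨c', h, fun t => ?_⟩
  rw [h']
  by_cases ht : t < K
  · simp [ht]
  · simp [ht, dg_of_le hc (not_lt.1 ht)]

/-- Paying for a slot has the same effect as making it free in the code. -/
theorem on_clear {c' : ℕ} {P P' D : Finset ℕ} {u : ℕ}
    (h : ∀ t, dg t c' = if t ∈ P then 0 else dg t c) :
    On slot W D P' c' u ↔ On slot W D (P ∪ P') c u := by
  unfold On
  rw [h, Finset.mem_union]
  split_ifs with hu <;> simp [hu]

theorem on_empty {P D : Finset ℕ} {u : ℕ} : On slot W D (P ∪ ∅) c u ↔ On slot W D P c u := by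
  simp

/-- Guess the set `P` of paid slots, charge for it, and make its slots free. Then the edges of `E'`
can do all that ordinary edges can, since every unfinished vertex that dominates is now a free slot.
-/
theorem val_close (hc : c < 3 ^ K) (hE' : ∀ u v, E' u v → u ∉ W ∧ v ∉ W)
    (hE : ∀ u v, E₂ u v ↔ E u v ∨ E' u v) :
    Val K slot W E₂ noEdge c m ↔ ∃ c' < 3 ^ K, ∃ P ⊆ Finset.range K,
      (∀ t, dg t c' = if t ∈ P then 0 else dg t c) ∧
        ∃ m', Val K slot W E E' c' m' ∧ m' + P.card ≤ m := by
  constructor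
  · rintro ⟨D, P, h1, h2, h3, h4, h5⟩
    obtain ⟨c', hc', h⟩ := exists_clear hc P
    -- All payments have been moved into `P`; the solution that remains pays for no slot.
    refine ⟨c', hc', P, h2, h, D.card, ⟨D, ∅, h1, by simp, by simp, ?_, ?_⟩, h3⟩
    · intro v hv
      rcases h4 v hv with h' | ⟨u, hu, h'⟩
      · exact Or.inl h'
      · rcases (hE _ _).1 hu with hu | hu
        · exact Or.inr ⟨u, hu, (on_clear h).2 (on_empty.2 h')⟩
        · exact absurd hv (hE' _ _ hu).1
    · intro s hs h2'
      rw [h] at h2'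
      split_ifs at h2' with hsP
      rcases h5 s hs h2' with h' | ⟨v, u, hv, hvs, hu, h'⟩ | ⟨v, u, -, h', -⟩
      · exact absurd h' hsP
      · right
        rcases (hE _ _).1 hu with hu | hu
        · exact Or.inl ⟨v, u, hv, hvs, hu, (on_clear h).2 (on_empty.2 h')⟩
        · refine Or.inr ⟨v, u, hvs, hu, ?_⟩
          rcases h' with h' | h'
          · exact absurd h'.1 (hE' _ _ hu).2
          · rw [h]
            rcases h'.2 with h' | h' <;> simp [h']
      · exact h'.elim
  · rintro ⟨c', hc', P, hP, h, m', ⟨D, P', h1, h2, h3, h4, h5⟩, hm⟩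
    refine ⟨D, P ∪ P', h1, Finset.union_subset hP h2, ?_, ?_, ?_⟩
    · have := Finset.card_union_le P P'
      omega
    · intro v hv
      rcases h4 v hv with h' | ⟨u, hu, h'⟩
      · exact Or.inl h'
      · exact Or.inr ⟨u, (hE _ _).2 (Or.inl hu), (on_clear h).1 h'⟩
    · intro s hs h2'
      by_cases hsP : s ∈ P
      · exact Or.inl (by simp [hsP])
      rcases h5 s hs (by rw [h, if_neg hsP, h2']) with h' | ⟨v, u, hv, hvs, hu, h'⟩ | ⟨v, u, hvs, hu, h'⟩
      · exact Or.inl (by simp [h'])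
      · exact Or.inr (Or.inl ⟨v, u, hv, hvs, (hE _ _).2 (Or.inl hu), (on_clear h).1 h'⟩)
      · refine Or.inr (Or.inl ⟨v, u, (hE' _ _ hu).1, hvs, (hE _ _).2 (Or.inr hu),
          Or.inr ⟨(hE' _ _ hu).2, ?_⟩⟩)
        rw [h] at h'
        split_ifs at h' with hu
        · exact Or.inr (by simp [hu])
        · exact Or.inl h'

/-- A demand is met by the left part, by the right part, or by both. -/
def cov (x y z : ℕ) : Prop := (x = z ∧ y = z) ∨ (z = 2 ∧ ((x = 2 ∧ y = 1) ∨ (x = 1 ∧ y = 2)))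

/-- After the payments are moved into `P`, both parts see the same free slots. Each demand is met by
an edge of one part or of both, and a part that does not meet it is relieved of it. The two parts
share no edge and no finished vertex, so the chosen finished vertices split between them. -/
theorem val_join (hc : c < 3 ^ K) (h₁ : ∀ u v, E₁ u v → u ∉ W₂ ∧ v ∉ W₂)
    (h₂ : ∀ u v, E₂ u v → u ∉ W₁ ∧ v ∉ W₁)
    (hW : ∀ v ∈ W₁, v ∉ W₂) (hE : ∀ u v, E u v ↔ E₁ u v ∨ E₂ u v) :
    Val K slot (W₁ ∪ W₂) E noEdge c m ↔ ∃ c' < 3 ^ K, ∃ P ⊆ Finset.range K,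
      (∀ t, dg t c' = if t ∈ P then 0 else dg t c) ∧
        ∃ a < 3 ^ K, ∃ b < 3 ^ K, (∀ t < K, cov (dg t a) (dg t b) (dg t c')) ∧
          ∃ m₁ m₂, Val K slot W₁ E₁ noEdge a m₁ ∧ Val K slot W₂ E₂ noEdge b m₂ ∧
            m₁ + m₂ + P.card ≤ m := by
  classical
  constructor
  · rintro ⟨D, P, h1, h2, h3, h4, h5⟩
    obtain ⟨c', hc', h⟩ := exists_clear hc P
    -- The slots that are dominated along an edge of the first part; `S₂` is the same for the second
    -- part.
    let S₁ : ℕ → Prop := fun s => ∃ v u, v ∉ W₁ ∪ W₂ ∧ slot v = s ∧ E₁ v u ∧ On slot (W₁ ∪ W₂) D P c u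
    let S₂ : ℕ → Prop := fun s => ∃ v u, v ∉ W₁ ∪ W₂ ∧ slot v = s ∧ E₂ v u ∧ On slot (W₁ ∪ W₂) D P c u
    obtain ⟨a, ha, ha'⟩ := exists_dg K (fun t => if dg t c' = 2 ∧ ¬ S₁ t then 1 else dg t c')
      (fun t => by split_ifs <;> simp [dg_lt])
    obtain ⟨b, hb, hb'⟩ := exists_dg K (fun t => if dg t c' = 2 ∧ ¬ S₂ t then 1 else dg t c')
      (fun t => by split_ifs <;> simp [dg_lt])
    have ha0 : ∀ t, dg t a = 0 ↔ dg t c' = 0 := by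
      intro t
      rw [ha']
      by_cases ht : t < K
      · rw [if_pos ht]; split_ifs with h'
        · simp [h'.1]
        · rfl
      · simp [ht, dg_of_le hc' (not_lt.1 ht)]
    have hb0 : ∀ t, dg t b = 0 ↔ dg t c' = 0 := by
      intro t
      rw [hb']
      by_cases ht : t < K
      · rw [if_pos ht]; split_ifs with h'
        · simp [h'.1]
        · rfl
      · simp [ht, dg_of_le hc' (not_lt.1 ht)]
    have key : ∀ t < K, dg t c' = 2 → S₁ t ∨ S₂ t := by
      intro t ht h2'
      rw [h] at h2'
      split_ifs at h2' with htP
      rcases h5 t ht h2' with h' | ⟨v, u, hv, hvs, hu, h'⟩ | ⟨v, u, -, h', -⟩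
      · exact absurd h' htP
      · rcases (hE _ _).1 hu with hu | hu
        · exact Or.inl ⟨v, u, hv, hvs, hu, h'⟩
        · exact Or.inr ⟨v, u, hv, hvs, hu, h'⟩
      · exact h'.elim
    have on1 : ∀ v u, E₁ v u → On slot (W₁ ∪ W₂) D P c u →
        On slot W₁ (D.filter (· ∈ W₁)) ∅ a u := by
      intro v u hu h'
      have hu2 := (h₁ _ _ hu).2
      rcases h' with ⟨h', h''⟩ | ⟨h', h''⟩
      · rcases h' with h' | h'
        · exact Or.inl ⟨h', by simp [h', h'']⟩
        · exact absurd h' hu2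
      · refine Or.inr ⟨fun h => h' (Or.inl h), Or.inl ?_⟩
        rw [ha0, h]
        rcases h'' with h'' | h'' <;> simp [h'']
    have on2 : ∀ v u, E₂ v u → On slot (W₁ ∪ W₂) D P c u →
        On slot W₂ (D.filter (· ∈ W₂)) ∅ b u := by
      intro v u hu h'
      have hu2 := (h₂ _ _ hu).2
      rcases h' with ⟨h', h''⟩ | ⟨h', h''⟩
      · rcases h' with h' | h'
        · exact absurd h' hu2
        · exact Or.inl ⟨h', by simp [h', h'']⟩
      · refine Or.inr ⟨fun h => h' (Or.inr h), Or.inl ?_⟩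
        rw [hb0, h]
        rcases h'' with h'' | h'' <;> simp [h'']
    refine ⟨c', hc', P, h2, h, a, ha, b, hb, ?_, (D.filter (· ∈ W₁)).card,
      (D.filter (· ∈ W₂)).card, ⟨_, ∅, ?_, by simp, le_rfl, ?_, ?_⟩,
        ⟨_, ∅, ?_, by simp, le_rfl, ?_, ?_⟩, ?_⟩
    · intro t ht
      rw [ha', hb', if_pos ht, if_pos ht]
      have := key t ht
      unfold cov
      by_cases e1 : dg t c' = 2 <;> by_cases e2 : S₁ t <;> by_cases e3 : S₂ t <;> simp_all
    · intro v hv; exact (Finset.mem_filter.1 hv).2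
    · intro v hv
      rcases h4 v (Or.inl hv) with h' | ⟨u, hu, h'⟩
      · exact Or.inl (by simp [h', hv])
      · rcases (hE _ _).1 hu with hu | hu
        · exact Or.inr ⟨u, hu, on1 _ _ hu h'⟩
        · exact absurd hv (h₂ _ _ hu).1
    · intro s hs h2'
      rw [ha', if_pos hs] at h2'
      split_ifs at h2' with hh
      · omega
      have : S₁ s := by by_contra h''; exact hh ⟨h2', h''⟩
      obtain ⟨v, u, hv, hvs, hu, h'⟩ := this
      exact Or.inr (Or.inl ⟨v, u, fun h => hv (Or.inl h), hvs, hu, on1 _ _ hu h'⟩)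
    · intro v hv; exact (Finset.mem_filter.1 hv).2
    · intro v hv
      rcases h4 v (Or.inr hv) with h' | ⟨u, hu, h'⟩
      · exact Or.inl (by simp [h', hv])
      · rcases (hE _ _).1 hu with hu | hu
        · exact absurd hv (h₁ _ _ hu).1
        · exact Or.inr ⟨u, hu, on2 _ _ hu h'⟩
    · intro s hs h2'
      rw [hb', if_pos hs] at h2'
      split_ifs at h2' with hh
      · omega
      have : S₂ s := by by_contra h''; exact hh ⟨h2', h''⟩
      obtain ⟨v, u, hv, hvs, hu, h'⟩ := this
      exact Or.inr (Or.inl ⟨v, u, fun h => hv (Or.inr h), hvs, hu, on2 _ _ hu h'⟩)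
    · refine le_trans ?_ h3
      rw [← Finset.card_union_of_disjoint]
      · exact Nat.add_le_add_right (Finset.card_le_card (Finset.union_subset
          (Finset.filter_subset _ _) (Finset.filter_subset _ _))) _
      · rw [Finset.disjoint_left]
        intro v hv hv'
        simp only [Finset.mem_filter] at hv hv'
        exact hW v hv.2 hv'.2
  · rintro ⟨c', hc', P, hP, h, a, ha, b, hb, hcov, m₁, m₂, ⟨D₁, P₁, a1, a2, a3, a4, a5⟩,
      ⟨D₂, P₂, b1, b2, b3, b4, b5⟩, hm⟩
    -- `cov` neither creates nor removes a digit 0 on slots below `K`; from `K` on all digits of `c`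
    -- are 0.
    have h0 : ∀ t, dg t a = 0 ∨ dg t b = 0 → dg t c = 0 ∨ t ∈ P := by
      intro t ht
      by_cases htK : t < K
      · have h1 := hcov t htK
        have h2 := h t
        unfold cov at h1
        split_ifs at h2 with h3
        · exact Or.inr h3
        · left; omega
      · exact Or.inl (dg_of_le hc (not_lt.1 htK))
    have on1 : ∀ v u, E₁ v u → On slot W₁ D₁ P₁ a u →
        On slot (W₁ ∪ W₂) (D₁ ∪ D₂) (P ∪ (P₁ ∪ P₂)) c u := by
      intro v u hu h'
      rcases h' with ⟨h', h''⟩ | ⟨h', h''⟩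
      · exact Or.inl ⟨Or.inl h', by simp [h'']⟩
      · refine Or.inr ⟨fun h => h.elim h' (h₁ _ _ hu).2, ?_⟩
        rcases h'' with h'' | h''
        · exact (h0 _ (Or.inl h'')).imp_right (fun h => by simp [h])
        · right; simp [h'']
    have on2 : ∀ v u, E₂ v u → On slot W₂ D₂ P₂ b u →
        On slot (W₁ ∪ W₂) (D₁ ∪ D₂) (P ∪ (P₁ ∪ P₂)) c u := by
      intro v u hu h'
      rcases h' with ⟨h', h''⟩ | ⟨h', h''⟩
      · exact Or.inl ⟨Or.inr h', by simp [h'']⟩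
      · refine Or.inr ⟨fun h => h.elim (h₂ _ _ hu).2 h', ?_⟩
        rcases h'' with h'' | h''
        · exact (h0 _ (Or.inr h'')).imp_right (fun h => by simp [h])
        · right; simp [h'']
    refine ⟨D₁ ∪ D₂, P ∪ (P₁ ∪ P₂), ?_, ?_, ?_, ?_, ?_⟩
    · intro v hv
      rcases Finset.mem_union.1 hv with hv | hv
      · exact Or.inl (a1 v hv)
      · exact Or.inr (b1 v hv)
    · exact Finset.union_subset hP (Finset.union_subset a2 b2)
    · have := Finset.card_union_le D₁ D₂
      have := Finset.card_union_le P (P₁ ∪ P₂)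
      have := Finset.card_union_le P₁ P₂
      omega
    · rintro v (hv | hv)
      · rcases a4 v hv with h' | ⟨u, hu, h'⟩
        · exact Or.inl (by simp [h'])
        · exact Or.inr ⟨u, (hE _ _).2 (Or.inl hu), on1 _ _ hu h'⟩
      · rcases b4 v hv with h' | ⟨u, hu, h'⟩
        · exact Or.inl (by simp [h'])
        · exact Or.inr ⟨u, (hE _ _).2 (Or.inr hu), on2 _ _ hu h'⟩
    · intro s hs h2
      by_cases hsP : s ∈ P
      · exact Or.inl (by simp [hsP])
      have h1 := hcov s hs
      have h3 := h s
      rw [if_neg hsP] at h3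
      have h4 : dg s a = 2 ∨ dg s b = 2 := by unfold cov at h1; omega
      rcases h4 with h4 | h4
      · rcases a5 s hs h4 with h' | ⟨v, u, hv, hvs, hu, h'⟩ | ⟨v, u, -, h', -⟩
        · exact Or.inl (by simp [h'])
        · exact Or.inr (Or.inl ⟨v, u, fun h => h.elim hv (h₁ _ _ hu).1, hvs,
            (hE _ _).2 (Or.inl hu), on1 _ _ hu h'⟩)
        · exact h'.elim
      · rcases b5 s hs h4 with h' | ⟨v, u, hv, hvs, hu, h'⟩ | ⟨v, u, -, h', -⟩
        · exact Or.inl (by simp [h'])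
        · exact Or.inr (Or.inl ⟨v, u, fun h => h.elim (h₂ _ _ hu).1 hv, hvs,
            (hE _ _).2 (Or.inr hu), on2 _ _ hu h'⟩)
        · exact h'.elim

/-- A vertex about to be finished must itself be dominated, which is a demand at its slot `s`, and
choosing it is paying for `s`. Once it is finished, `s` names no vertex at an edge, so a demand of
`c` at `s` costs one extra payment. -/
theorem val_forget {v s c' : ℕ} (hv : v ∉ W) (hs : slot v = s) (hsK : s < K)
    (huniq : ∀ x y, E x y → y ∉ W → slot y = s → y = v) (hsym : ∀ x y, E x y → E y x)
    (hc' : ∀ t, dg t c' = if t = s then 2 else dg t c) :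
    Val K slot (insert v W) E noEdge c m ↔
      ∃ m', Val K slot W E noEdge c' m' ∧ m' + (if dg s c = 2 then 1 else 0) ≤ m := by
  classical
  constructor
  · rintro ⟨D, P, h1, h2, h3, h4, h5⟩
    have hsP : dg s c = 2 → s ∈ P := by
      intro h
      rcases h5 s hsK h with h' | ⟨x, y, hx, hxs, hxy, h'⟩ | ⟨x, y, -, h', -⟩
      · exact h'
      · exact absurd (huniq _ _ (hsym _ _ hxy) (fun h => hx (Or.inr h)) hxs)
          (fun h => hx (Or.inl h))
      · exact h'.elim
    have on : ∀ x u, E x u → On slot (insert v W) D P c u →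
        On slot W (D.erase v) (if v ∈ D then insert s P else P.erase s) c' u := by
      intro x u hu h'
      rcases h' with ⟨h', h''⟩ | ⟨h', h''⟩
      · rcases h' with h' | h'
        · subst h'
          exact Or.inr ⟨hv, Or.inr (by simp [h'', hs])⟩
        · exact Or.inl ⟨h', by
            simp only [Finset.mem_erase, h'', and_true]; rintro rfl; exact hv h'⟩
      · have hus : slot u ≠ s := fun h =>
          h' (Or.inl (huniq _ _ hu (fun h => h' (Or.inr h)) h))
        refine Or.inr ⟨fun h => h' (Or.inr h), ?_⟩
        rw [hc', if_neg hus]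
        refine h''.imp_right fun h => ?_
        split_ifs <;> simp [h, hus]
    -- Choosing `v` becomes a payment for `s`; a payment for `s` in the larger graph only served the
    -- demand at `s` and is given up.
    refine ⟨_, ⟨D.erase v, if v ∈ D then insert s P else P.erase s, ?_, ?_, le_rfl, ?_, ?_⟩, ?_⟩
    · intro x hx
      rw [Finset.mem_erase] at hx
      exact (h1 x hx.2).resolve_left hx.1
    · split_ifs
      · exact Finset.insert_subset (by simpa using hsK) h2
      · exact (Finset.erase_subset _ _).trans h2
    · intro x hx
      rcases h4 x (Or.inr hx) with h' | ⟨u, hu, h'⟩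
      · exact Or.inl (by simp only [Finset.mem_erase, h', and_true]; rintro rfl; exact hv hx)
      · exact Or.inr ⟨u, hu, on _ _ hu h'⟩
    · intro t ht h2'
      rw [hc'] at h2'
      split_ifs at h2' with hts
      · subst hts
        rcases h4 v (Or.inl rfl) with h' | ⟨u, hu, h'⟩
        · exact Or.inl (by simp [h'])
        · exact Or.inr (Or.inl ⟨v, u, hv, hs, hu, on _ _ hu h'⟩)
      · rcases h5 t ht h2' with h' | ⟨x, y, hx, hxs, hxy, h'⟩ | ⟨x, y, -, h', -⟩
        · exact Or.inl (by split_ifs <;> simp [h', hts])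
        · exact Or.inr (Or.inl ⟨x, y, fun h => hx (Or.inr h), hxs, hxy, on _ _ hxy h'⟩)
        · exact h'.elim
    · by_cases hD : v ∈ D
      · have e1 := Finset.card_erase_add_one hD
        simp only [hD, if_true]
        by_cases h2' : dg s c = 2
        · rw [Finset.insert_eq_of_mem (hsP h2'), if_pos h2']; omega
        · have := Finset.card_insert_le s P
          rw [if_neg h2']; omega
      · simp only [hD, if_false, Finset.erase_eq_of_notMem hD]
        by_cases h2' : dg s c = 2
        · have e1 := Finset.card_erase_add_one (hsP h2')
          rw [if_pos h2']; omega
        · have := Finset.card_le_card (Finset.erase_subset s P)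
          rw [if_neg h2']; omega
  · rintro ⟨m', ⟨D, P, h1, h2, h3, h4, h5⟩, hm⟩
    have hvD : v ∉ D := fun h => hv (h1 v h)
    have on : ∀ x u, E x u → On slot W D P c' u →
        On slot (insert v W) (if s ∈ P then insert v D else D)
          (if dg s c = 2 then insert s P else P.erase s) c u := by
      intro x u hu h'
      rcases h' with ⟨h', h''⟩ | ⟨h', h''⟩
      · exact Or.inl ⟨Or.inr h', by split_ifs <;> simp [h'']⟩
      · by_cases huv : u = v
        · subst huv
          rw [hs, hc', if_pos rfl] at h''
          simp only [OfNat.ofNat_ne_zero, false_or] at h''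
          exact Or.inl ⟨Or.inl rfl, by simp [h'']⟩
        · have hus : slot u ≠ s := fun h => huv (huniq _ _ hu h' h)
          rw [hc', if_neg hus] at h''
          refine Or.inr ⟨fun h => h.elim huv h', h''.imp_right fun h => ?_⟩
          split_ifs <;> simp [h, hus]
    -- The same exchange backwards: a payment for `s` becomes the choice of `v`, and `s` is paid for
    -- anew exactly if `c` has a demand there.
    refine ⟨if s ∈ P then insert v D else D, if dg s c = 2 then insert s P else P.erase s,
      ?_, ?_, ?_, ?_, ?_⟩
    · intro x hx
      split_ifs at hx with h
      · rcases Finset.mem_insert.1 hx with h | h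
        · exact Or.inl h
        · exact Or.inr (h1 x h)
      · exact Or.inr (h1 x hx)
    · split_ifs
      · exact Finset.insert_subset (by simpa using hsK) h2
      · exact (Finset.erase_subset _ _).trans h2
    · by_cases hP : s ∈ P
      · have e1 := Finset.card_erase_add_one hP
        have e2 := Finset.card_insert_of_notMem hvD
        by_cases h2' : dg s c = 2 <;> simp only [hP, h2', if_true, if_false, Finset.insert_eq_of_mem] at hm ⊢ <;>
          omega
      · have e2 := Finset.card_insert_of_notMem hP
        by_cases h2' : dg s c = 2 <;>
          simp only [hP, h2', if_true, if_false, Finset.erase_eq_of_notMem, not_false_eq_true] at hm ⊢ <;> omega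
    · rintro x (rfl | hx)
      · rcases h5 s hsK (by rw [hc', if_pos rfl]) with h' | ⟨y, u, hy, hys, hu, h'⟩ | ⟨x, y, -, h', -⟩
        · exact Or.inl (by simp [h'])
        · obtain rfl := huniq _ _ (hsym _ _ hu) hy hys
          exact Or.inr ⟨u, hu, on _ _ hu h'⟩
        · exact h'.elim
      · rcases h4 x hx with h' | ⟨u, hu, h'⟩
        · exact Or.inl (by split_ifs <;> simp [h'])
        · exact Or.inr ⟨u, hu, on _ _ hu h'⟩
    · intro t ht h2'
      by_cases hts : t = s
      · subst hts
        exact Or.inl (by simp [h2'])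
      · rcases h5 t ht (by rw [hc', if_neg hts, h2']) with h' | ⟨x, y, hx, hxs, hxy, h'⟩ | ⟨x, y, -, h', -⟩
        · exact Or.inl (by split_ifs <;> simp [h', hts])
        · refine Or.inr (Or.inl ⟨x, y, ?_, hxs, hxy, on _ _ hxy h'⟩)
          rintro (rfl | h)
          · exact hts (hxs.symm.trans hs)
          · exact hx h
        · exact h'.elim

theorem val_full (hE : ∀ u v, E u v → u ∈ W ∧ v ∈ W) :
    Val K slot W E noEdge 0 m ↔ ∃ D : Finset ℕ, (∀ v ∈ D, v ∈ W) ∧ D.card ≤ m ∧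
      ∀ v ∈ W, v ∈ D ∨ ∃ u, E v u ∧ u ∈ D := by
  constructor
  · rintro ⟨D, P, h1, h2, h3, h4, h5⟩
    refine ⟨D, h1, by omega, fun v hv => (h4 v hv).imp_right ?_⟩
    rintro ⟨u, hu, h | h⟩
    · exact ⟨u, hu, h.2⟩
    · exact absurd (hE _ _ hu).2 h.1
  · rintro ⟨D, h1, h2, h3⟩
    refine ⟨D, ∅, h1, by simp, by simpa using h2, fun v hv => (h3 v hv).imp_right ?_, by simp⟩
    rintro ⟨u, hu, h⟩
    exact ⟨u, hu, Or.inl ⟨h1 u h, h⟩⟩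

end

section

/-! ## Closing a table: paying for slots -/

/-- The cheapest way to pay for some of the slots below `s`, with cost `J` for the rest. -/
def closeF (J : ℕ → ℕ) : ℕ → ℕ → ℕ
  | 0, c => J c
  | s + 1, c => min (closeF J s c) (closeF J s (c - dg s c * 3 ^ s) + 1)

/-- Payments for different slots are independent, so the minimum over all sets of paid slots is
found by one decision per slot. -/
theorem closeF_le {K : ℕ} (J : ℕ → ℕ) (s : ℕ) : ∀ {c m : ℕ}, c < 3 ^ K →
    (closeF J s c ≤ m ↔ ∃ c' < 3 ^ K, ∃ P ⊆ Finset.range s,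
      (∀ t, dg t c' = if t ∈ P then 0 else dg t c) ∧ J c' + P.card ≤ m) := by
  induction s with
  | zero =>
    intro c m hc
    constructor
    · intro h
      exact ⟨c, hc, ∅, by simp, by simp, h⟩
    · rintro ⟨c', hc', P, hP, h, h'⟩
      obtain rfl : P = ∅ := by simpa using hP
      obtain rfl : c' = c := dg_ext hc' hc (fun s _ => by simp [h])
      exact h'
  | succ s ih =>
    intro c m hc
    have hle : c - dg s c * 3 ^ s < 3 ^ K := lt_of_le_of_lt (Nat.sub_le _ _) hc
    simp only [closeF, min_le_iff]
    constructor
    · rintro (h | h)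
      · obtain ⟨c', hc', P, hP, h1, h2⟩ := (ih hc).1 h
        exact ⟨c', hc', P, hP.trans (Finset.range_subset_range.2 (by omega)), h1, h2⟩
      · obtain ⟨c', hc', P, hP, h1, h2⟩ := (ih (m := m - 1) hle).1 (by omega)
        refine ⟨c', hc', insert s P, ?_, fun t => ?_, ?_⟩
        · exact Finset.insert_subset (by simp)
            (hP.trans (Finset.range_subset_range.2 (by omega)))
        · rw [h1, dg_clear]
          by_cases h : t = s <;> simp [h]
        · have := Finset.card_insert_le s P
          omega
    · rintro ⟨c', hc', P, hP, h1, h2⟩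
      by_cases hs : s ∈ P
      · right
        have e := Finset.card_erase_add_one hs
        have := (ih (m := m - 1) hle).2 ⟨c', hc', P.erase s, ?_, fun t => ?_, by omega⟩
        · omega
        · intro t ht
          rw [Finset.mem_erase] at ht
          have := Finset.mem_range.1 (hP ht.2)
          rw [Finset.mem_range]; omega
        · rw [h1, dg_clear]
          by_cases h : t = s <;> simp [h, hs]
      · left
        refine (ih hc).2 ⟨c', hc', P, fun t ht => ?_, h1, h2⟩
        have := Finset.mem_range.1 (hP ht)
        rw [Finset.mem_range]
        have : t ≠ s := fun h => hs (h ▸ ht)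
        omega

/-! ## The covering product by counting -/

/-- Demand `x` asks for at most as much as demand `z`. -/
def blw (x z : ℕ) : Prop := x = z ∨ (z = 2 ∧ x = 1)

instance (x z : ℕ) : Decidable (blw x z) := by unfold blw; infer_instance

instance (x y z : ℕ) : Decidable (cov x y z) := by unfold cov; infer_instance

/-- The zeta transform, on the digits below `s`, of the indicator function of `L = i`. -/
def zetaC (K : ℕ) (L : ℕ → ℕ) (i s c : ℕ) : ℕ :=
  ((Finset.range (3 ^ K)).filter fun a => L a = i ∧
    ∀ t < K, if t < s then blw (dg t a) (dg t c) else dg t a = dg t c).card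

/-- The number of pairs of total cost `k` that cover `c` on the digits below `s` and are below `c`
on the other digits. -/
def covC (K : ℕ) (L R : ℕ → ℕ) (k s c : ℕ) : ℕ :=
  ((Finset.range (3 ^ K) ×ˢ Finset.range (3 ^ K)).filter fun p => L p.1 + R p.2 = k ∧
    ∀ t < K, if t < s then cov (dg t p.1) (dg t p.2) (dg t c)
      else blw (dg t p.1) (dg t c) ∧ blw (dg t p.2) (dg t c)).card

variable {K : ℕ} {L R : ℕ → ℕ} {i k s c : ℕ}

theorem zetaC_le : zetaC K L i s c ≤ 3 ^ K := by
  refine (Finset.card_le_card (Finset.filter_subset _ _)).trans ?_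
  simp

theorem covC_le : covC K L R k s c ≤ 3 ^ K * 3 ^ K := by
  refine (Finset.card_le_card (Finset.filter_subset _ _)).trans ?_
  simp

theorem zetaC_zero (hc : c < 3 ^ K) : zetaC K L i 0 c = if L c = i then 1 else 0 := by
  unfold zetaC
  split_ifs with h
  · rw [Finset.card_eq_one]
    refine ⟨c, ?_⟩
    ext a
    simp only [Finset.mem_filter, Finset.mem_range, Finset.mem_singleton, Nat.not_lt_zero, if_false]
    constructor
    · rintro ⟨ha, -, h'⟩
      exact dg_ext ha hc h'
    · rintro rfl
      exact ⟨hc, h, fun _ _ => rfl⟩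
  · rw [Finset.card_eq_zero, Finset.filter_eq_empty_iff]
    rintro a ha ⟨h1, h2⟩
    simp only [Nat.not_lt_zero, if_false] at h2
    exact h (dg_ext (Finset.mem_range.1 ha) hc h2 ▸ h1)

theorem forall_split (p q : ℕ → Prop) (hs : s < K) (hpq : ∀ t, t ≠ s → (p t ↔ q t)) :
    (∀ t < K, p t) ↔ (p s ∧ ∀ t < K, t ≠ s → q t) := by
  constructor
  · intro h
    exact ⟨h s hs, fun t ht hts => (hpq t hts).1 (h t ht)⟩
  · rintro ⟨h1, h2⟩ t ht
    by_cases hts : t = s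
    · rw [hts]; exact h1
    · exact (hpq t hts).2 (h2 t ht hts)

theorem zetaC_succ_of_ne (h : dg s c ≠ 2) : zetaC K L i (s + 1) c = zetaC K L i s c := by
  unfold zetaC
  congr 1
  refine Finset.filter_congr fun a _ => and_congr_right fun _ => forall_congr' fun t =>
    forall_congr' fun _ => ?_
  by_cases h1 : t < s
  · simp [h1, Nat.lt_succ_of_lt h1]
  · by_cases h2 : t = s
    · subst h2; simp [blw, h]
    · have : ¬ t < s + 1 := by omega
      simp [h1, this]

/-- Below the digit 2 lie 2 and 1; the codes with digit 1 are counted at the index whose digit is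
lowered to 1. -/
theorem zetaC_succ_of_eq (hs : s < K) (h : dg s c = 2) :
    zetaC K L i (s + 1) c = zetaC K L i s c + zetaC K L i s (c - 3 ^ s) := by
  unfold zetaC
  rw [← Finset.card_union_of_disjoint]
  · congr 1
    rw [← Finset.filter_or]
    refine Finset.filter_congr fun a _ => ?_
    rw [← and_or_left]
    refine and_congr_right fun _ => ?_
    let q : ℕ → Prop := fun t => if t < s then blw (dg t a) (dg t c) else dg t a = dg t c
    rw [forall_split _ q hs, forall_split (K := K) (fun t => if t < s then blw (dg t a) (dg t c) else dg t a = dg t c) q hs,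
      forall_split (K := K) (fun t => if t < s then blw (dg t a) (dg t (c - 3 ^ s)) else dg t a = dg t (c - 3 ^ s)) q hs,
      ← or_and_right]
    · refine and_congr_left fun _ => ?_
      simp [blw, h, dg_dec h]
    · intro t ht; simp only [q, dg_dec h, if_neg ht]
    · intro t ht; rfl
    · intro t ht
      have : t < s + 1 ↔ t < s := by omega
      simp only [q, this]
  · rw [Finset.disjoint_left]
    intro a ha ha'
    have h1 := (Finset.mem_filter.1 ha).2.2 s hs
    have h2 := (Finset.mem_filter.1 ha').2.2 s hs
    simp only [lt_irrefl, if_false, dg_dec h, if_true] at h1 h2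
    omega

theorem covC_succ_of_ne (h : dg s c ≠ 2) : covC K L R k (s + 1) c = covC K L R k s c := by
  unfold covC
  congr 1
  refine Finset.filter_congr fun a _ => and_congr_right fun _ => forall_congr' fun t =>
    forall_congr' fun _ => ?_
  by_cases h1 : t < s
  · simp [h1, Nat.lt_succ_of_lt h1]
  · by_cases h2 : t = s
    · subst h2; simp [blw, cov, h]
    · have : ¬ t < s + 1 := by omega
      simp [h1, this]

/-- Of the four pairs of digits 1 and 2 below 2, only the pair of two ones fails to cover, and these
pairs are counted at the lowered index. They are among the pairs counted at `c`, so the subtraction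
is not truncated. -/
theorem covC_succ_of_eq (hs : s < K) (h : dg s c = 2) :
    covC K L R k (s + 1) c = covC K L R k s c - covC K L R k s (c - 3 ^ s) := by
  suffices covC K L R k s c = covC K L R k (s + 1) c + covC K L R k s (c - 3 ^ s) by omega
  unfold covC
  rw [← Finset.card_union_of_disjoint]
  · congr 1
    rw [← Finset.filter_or]
    refine Finset.filter_congr fun p _ => ?_
    rw [← and_or_left]
    refine and_congr_right fun _ => ?_
    let q : ℕ → Prop := fun t => if t < s then cov (dg t p.1) (dg t p.2) (dg t c)
      else blw (dg t p.1) (dg t c) ∧ blw (dg t p.2) (dg t c)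
    rw [forall_split _ q hs,
      forall_split (K := K) (fun t => if t < s + 1 then cov (dg t p.1) (dg t p.2) (dg t c)
        else blw (dg t p.1) (dg t c) ∧ blw (dg t p.2) (dg t c)) q hs,
      forall_split (K := K) (fun t => if t < s then cov (dg t p.1) (dg t p.2) (dg t (c - 3 ^ s))
        else blw (dg t p.1) (dg t (c - 3 ^ s)) ∧ blw (dg t p.2) (dg t (c - 3 ^ s))) q hs,
      ← or_and_right]
    · refine and_congr_left fun _ => ?_
      simp only [lt_irrefl, if_false, lt_add_one, if_true, blw, cov, h, dg_dec h]
      simp only [true_and]; omega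
    · intro t ht; simp only [q, dg_dec h, if_neg ht]
    · intro t ht
      have : t < s + 1 ↔ t < s := by omega
      simp only [q, this]
    · intro t ht; rfl
  · rw [Finset.disjoint_left]
    intro a ha ha'
    have h1 := (Finset.mem_filter.1 ha).2.2 s hs
    have h2 := (Finset.mem_filter.1 ha').2.2 s hs
    simp only [lt_irrefl, if_false, lt_add_one, if_true, blw, cov, h, dg_dec h] at h1 h2
    omega

/-- Lying below `c` is a condition on each member of the pair separately, so counting by total cost
is a convolution. -/
theorem covC_zero : covC K L R k 0 c =
    ∑ i ∈ Finset.range (k + 1), zetaC K L i K c * zetaC K R (k - i) K c := by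
  have e : ∀ i ∈ Finset.range (k + 1), zetaC K L i K c * zetaC K R (k - i) K c =
      (((Finset.range (3 ^ K) ×ˢ Finset.range (3 ^ K)).filter fun p =>
        (L p.1 + R p.2 = k ∧ ∀ t < K, blw (dg t p.1) (dg t c) ∧ blw (dg t p.2) (dg t c)) ∧
          L p.1 = i).card) := by
    intro i hi
    rw [Finset.mem_range] at hi
    unfold zetaC
    rw [← Finset.card_product, ← Finset.filter_product]
    congr 1
    refine Finset.filter_congr fun p _ => ?_
    constructor
    · rintro ⟨⟨h1, h2⟩, h3, h4⟩
      refine ⟨⟨by omega, fun t ht => ?_⟩, h1⟩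
      have := h2 t ht
      have := h4 t ht
      simp_all
    · rintro ⟨⟨h1, h2⟩, h3⟩
      refine ⟨⟨h3, fun t ht => ?_⟩, by omega, fun t ht => ?_⟩ <;> rw [if_pos ht]
      · exact (h2 t ht).1
      · exact (h2 t ht).2
  rw [Finset.sum_congr rfl e]
  unfold covC
  simp only [Nat.not_lt_zero, if_false]
  rw [Finset.card_eq_sum_card_fiberwise (f := fun p => L p.1) (t := Finset.range (k + 1))]
  · refine Finset.sum_congr rfl fun i _ => ?_
    rw [Finset.filter_filter]
  · intro p hp
    have := (Finset.mem_filter.1 hp).2.1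
    simp only [Finset.coe_range, Set.mem_Iio]
    omega

/-- This turns counting into minimising: the cheapest covering pair has the least cost with a
nonzero count. -/
theorem covC_ne_zero : covC K L R k K c ≠ 0 ↔
    ∃ a < 3 ^ K, ∃ b < 3 ^ K, (∀ t < K, cov (dg t a) (dg t b) (dg t c)) ∧ L a + R b = k := by
  unfold covC
  rw [Finset.card_ne_zero]
  constructor
  · rintro ⟨p, hp⟩
    simp only [Finset.mem_filter, Finset.mem_product, Finset.mem_range] at hp
    refine ⟨p.1, hp.1.1, p.2, hp.1.2, fun t ht => ?_, hp.2.1⟩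
    simpa [ht] using hp.2.2 t ht
  · rintro ⟨a, ha, b, hb, h, h'⟩
    refine ⟨(a, b), ?_⟩
    simp only [Finset.mem_filter, Finset.mem_product, Finset.mem_range]
    refine ⟨⟨ha, hb⟩, h', fun t ht => ?_⟩
    rw [if_pos ht]; exact h t ht

end

section

infixr:67 " ;; " => Program.seq

/-! ## Passes over a table, slot by slot -/

/-- The words of the machine are large enough for tables with `K` slots. -/
structure WordSize (K w : ℕ) : Prop where
  pos : 1 ≤ K
  three : 3 < 2 ^ w
  -- Offsets into the table of digits are formed by multiplication and must be words; `count` does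
  -- the same for the numbers of pairs in a join.
  size : (2 * K + 1) * ((2 * K + 1) * 3 ^ K) < 2 ^ w
  count : 3 ^ K * 3 ^ K < 2 ^ w

theorem WordSize.Q_lt {K w : ℕ} (h : WordSize K w) : (2 * K + 1) * 3 ^ K < 2 ^ w :=
  lt_of_le_of_lt (Nat.le_mul_of_pos_left _ (by omega)) h.size

theorem WordSize.M_lt {K w : ℕ} (h : WordSize K w) : 3 ^ K < 2 ^ w :=
  lt_of_le_of_lt (Nat.le_mul_of_pos_left _ (by positivity)) h.count

theorem WordSize.K_lt {K w : ℕ} (h : WordSize K w) : 2 * K + 1 < 2 ^ w :=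
  lt_of_le_of_lt (Nat.le_mul_of_pos_right _ (by positivity)) h.size

theorem WordSize.pow_lt {K w s : ℕ} (h : WordSize K w) (hs : s ≤ K) : 3 ^ s < 2 ^ w :=
  lt_of_le_of_lt (Nat.pow_le_pow_right (by norm_num) hs) h.M_lt

theorem WordSize.off_lt {K w s : ℕ} (h : WordSize K w) (hs : s ≤ 2 * K + 1) :
    s * ((2 * K + 1) * 3 ^ K) < 2 ^ w :=
  lt_of_le_of_lt (Nat.mul_le_mul_right _ hs) h.size

/-- The registers and arrays that describe tables with `K` slots. -/
structure TEnv (K : ℕ) (σ : State) : Prop where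
  one : σ.reg 1 = 1
  two : σ.reg 2 = 2
  zero : σ.reg 4 = 0
  slots : σ.reg 8 = K
  M : σ.reg 9 = 3 ^ K
  Q : σ.reg 10 = (2 * K + 1) * 3 ^ K
  L : σ.reg 11 = 2 * K + 1
  pw : ∀ s < K, σ.arr 9 s = 3 ^ s
  dig : ∀ s < K, ∀ c < (2 * K + 1) * 3 ^ K, σ.arr 8 (s * ((2 * K + 1) * 3 ^ K) + c) = dg s c

/-- Register 0 is exempt because it collects the answer. -/
theorem TEnv.fr {K : ℕ} {σ τ : State} {P : Program} (h : TEnv K σ) (hF : Fr P σ τ)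
    (hr : ∀ r < 12, r ≠ 0 → P.wr r = false) (ha : ∀ a < 16, P.wa a = false) : TEnv K τ where
  one := (hF.reg 1 (hr _ (by norm_num) (by norm_num))).trans h.one
  two := (hF.reg 2 (hr _ (by norm_num) (by norm_num))).trans h.two
  zero := (hF.reg 4 (hr _ (by norm_num) (by norm_num))).trans h.zero
  slots := (hF.reg 8 (hr _ (by norm_num) (by norm_num))).trans h.slots
  M := (hF.reg 9 (hr _ (by norm_num) (by norm_num))).trans h.M
  Q := (hF.reg 10 (hr _ (by norm_num) (by norm_num))).trans h.Q
  L := (hF.reg 11 (hr _ (by norm_num) (by norm_num))).trans h.L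
  pw := by rw [hF.arr 9 (ha _ (by norm_num))]; exact h.pw
  dig := by rw [hF.arr 8 (ha _ (by norm_num))]; exact h.dig

theorem TEnv.setReg {K r : ℕ} {σ : State} (h : TEnv K σ) (hr : 12 ≤ r) (x : ℕ) :
    TEnv K (σ.setReg r x) := by
  refine h.fr (P := .instr (.const r x)) ⟨fun s hs => ?_, fun _ _ => rfl⟩ (fun s hs _ => ?_)
    (fun _ _ => rfl)
  · simp [Program.wr, Instr.wr] at hs; simp [hs]
  · simp [Program.wr, Instr.wr]; omega

/-- Run `body` for every slot (register `12`) and every index below register `lim` (register `15`),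
with the digit in register `16` and the power of three in register `14`. -/
def slotPasses (lim : ℕ) (body : Program) : Program :=
  .instr (.const 12 0) ;; .instr (.const 13 0) ;;
    forUp 12 8 (.instr (.load 14 9 12) ;; .instr (.const 15 0) ;;
      forUp 15 lim (.instr (.add 18 13 15) ;; .instr (.load 16 8 18) ;; body) ;;
      .instr (.add 13 13 10))

/-- The common form of closing, of both transforms and of counting demands: `Ψ s` is the table after
`s` slots. The table is updated in place with increasing index, so at index `c` the smaller cells
already belong to `Ψ (s + 1)` and all others still to `Ψ s`. -/
theorem run_slotPasses {K w lim Λ a B : ℕ} {body : Program} {σ : State} (hW : WordSize K w)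
    (hE : TEnv K σ) (hlim : lim = 9 ∨ lim = 10) (hΛ : σ.reg lim = Λ)
    (hΛQ : Λ ≤ (2 * K + 1) * 3 ^ K) (hbr : ∀ r < 20, body.wr r = false)
    (hba : ∀ b < 18, body.wa b = false) (Ψ : ℕ → ℕ → ℕ) (h0 : ∀ c < Λ, σ.arr a c = Ψ 0 c)
    (hbody : ∀ s < K, ∀ c < Λ, ∀ τ, TEnv K τ → τ.reg 14 = 3 ^ s → τ.reg 15 = c →
      τ.reg 16 = dg s c → (∀ c' < Λ, τ.arr a c' = if c' < c then Ψ (s + 1) c' else Ψ s c') →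
      Run w body τ B (fun τ' => τ'.arr a c = Ψ (s + 1) c ∧ ∀ c', c' ≠ c → τ'.arr a c' = τ.arr a c')) :
    Run w (slotPasses lim body) σ (K * (Λ * (B + 4) + 6) + 3)
      (fun τ => ∀ c < Λ, τ.arr a c = Ψ K c) := by
  have hw1 : 1 < 2 ^ w := lt_trans (by norm_num) hW.three
  have hl12 : lim ≠ 12 ∧ lim ≠ 13 ∧ lim ≠ 14 ∧ lim ≠ 15 ∧ lim ≠ 16 ∧ lim ≠ 18 ∧ lim < 12 ∧ lim ≠ 0 := by omega
  refine Run.seq (B₁ := 1) (B₂ := K * (Λ * (B + 4) + 6) + 2) (R := fun τ => τ = σ.setReg 12 0)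
    (Run.instr ⟨by omega, rfl⟩) ?_ (by omega)
  rintro τ rfl -
  refine Run.seq (B₁ := 1) (B₂ := K * (Λ * (B + 4) + 6) + 1)
    (R := fun τ => τ = (σ.setReg 12 0).setReg 13 0)
    (Run.instr ⟨by omega, rfl⟩) ?_ (by omega)
  rintro τ rfl -
  refine Run.mono (Run.forUp (a := 0) (b := K) (B := Λ * (B + 4) + 4)
    (fun s τ => TEnv K τ ∧ τ.reg lim = Λ ∧ τ.reg 13 = s * ((2 * K + 1) * 3 ^ K) ∧
      ∀ c < Λ, τ.arr a c = Ψ s c) (by simp) (by simp [hE.slots]) (by simp [hE.one])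
    (Nat.zero_le _) hw1 ?_ ?_ ?_ ?_ ?_) (by simp) ?_
  · simp [RAM.forUp, Program.wr, Instr.wr, hbr]
  · simp [RAM.forUp, Program.wr, Instr.wr, hbr]
  · simp [RAM.forUp, Program.wr, Instr.wr, hbr]
  · exact ⟨(hE.setReg (by norm_num) _).setReg (by norm_num) _, by simp [hl12, hΛ], by simp,
      by simpa using h0⟩
  · rintro s τ - hs hτs hF ⟨hT, hTl, hT13, hTa⟩
    refine Run.seq (B₁ := 1) (B₂ := Λ * (B + 4) + 3) (R := fun υ => υ = τ.setReg 14 (3 ^ s))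
      (Run.instr (by simp [Instr.wp, hτs, hT.pw s hs])) ?_ (by omega)
    rintro υ rfl -
    refine Run.seq (B₁ := 1) (B₂ := Λ * (B + 4) + 2)
      (R := fun υ => υ = (τ.setReg 14 (3 ^ s)).setReg 15 0) (Run.instr ⟨by omega, rfl⟩) ?_ (by omega)
    rintro υ rfl -
    have hT' : TEnv K ((τ.setReg 14 (3 ^ s)).setReg 15 0) :=
      (hT.setReg (by norm_num) _).setReg (by norm_num) _
    have hwr' : ∀ r < 15, (RAM.forUp 15 lim (.instr (.add 18 13 15) ;; .instr (.load 16 8 18) ;; body)).wr r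
        = false := by
      intro r hr
      have := hbr r (by omega)
      simp [RAM.forUp, Program.wr, Instr.wr, this]
      omega
    have hwa' : ∀ b < 18, (RAM.forUp 15 lim (.instr (.add 18 13 15) ;; .instr (.load 16 8 18) ;; body)).wa b
        = false := by
      intro r hr
      have := hba r (by omega)
      simp [RAM.forUp, Program.wa, Instr.wa, this]
    refine Run.seq (B₁ := Λ * (B + 4) + 1) (B₂ := 1)
      (R := fun υ => TEnv K υ ∧ υ.reg lim = Λ ∧ υ.reg 13 = s * ((2 * K + 1) * 3 ^ K) ∧
      ∀ c < Λ, υ.arr a c = Ψ (s + 1) c) ?_ ?_ (by omega)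
    · refine Run.mono (Run.forUp (a := 0) (b := Λ) (B := B + 2)
        (fun c υ => ∀ c' < Λ, υ.arr a c' = if c' < c then Ψ (s + 1) c' else Ψ s c')
        (by simp) (by simp [hl12, hTl]) (by simp [hT.one])
        (Nat.zero_le _) hw1 ?_ (hwr' _ (by omega)) (hwr' _ (by omega)) ?_ ?_) (by simp) ?_
      · simp [Program.wr, Instr.wr, hbr]
      · simpa using hTa
      · rintro c υ - hc hυc hFυ hI
        have hTυ := hT'.fr hFυ (fun r hr _ => hwr' r (by omega)) (fun b hb => hwa' b (by omega))
        have h13 : υ.reg 13 = s * ((2 * K + 1) * 3 ^ K) := by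
          rw [hFυ.reg 13 (hwr' _ (by omega))]; simpa using hT13
        have h14 : υ.reg 14 = 3 ^ s := by
          rw [hFυ.reg 14 (hwr' _ (by omega))]; simp
        have hcQ : c < (2 * K + 1) * 3 ^ K := by omega
        have hQ := hW.Q_lt
        refine Run.seq (B₁ := 1) (B₂ := B + 1)
          (R := fun υ' => υ' = υ.setReg 18 (s * ((2 * K + 1) * 3 ^ K) + c))
          (Run.instr (by simp only [Instr.wp, hυc, h13]; exact ⟨by omega, trivial⟩)) ?_ (by omega)
        rintro υ' rfl -
        refine Run.seq (B₁ := 1) (B₂ := B)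
          (R := fun υ' => υ' = (υ.setReg 18 (s * ((2 * K + 1) * 3 ^ K) + c)).setReg 16 (dg s c))
          (Run.instr (by simp [Instr.wp, hTυ.dig s hs c hcQ])) ?_ (by omega)
        rintro υ' rfl -
        refine Run.mono (hbody s hs c hc _
          ((hTυ.setReg (by norm_num) _).setReg (by norm_num) _) (by simp [h14]) (by simp [hυc]) (by simp) (by simpa using hI))
          le_rfl ?_
        · rintro υ' ⟨h1, h2⟩ - c' hc'
          simp only [State.setReg_arr] at h2 ⊢
          by_cases hcc : c' = c
          · subst hcc; simp [h1]
          · rw [h2 c' hcc, hI c' hc']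
            have : c' < c + 1 ↔ c' < c := by omega
            simp [this]
      · rintro υ ⟨-, hI⟩ hFυ
        refine ⟨hT'.fr hFυ (fun r hr _ => hwr' r (by omega)) (fun b hb => hwa' b (by omega)), ?_, ?_, ?_⟩
        · rw [hFυ.reg lim (hwr' _ (by omega))]; simp [hl12, hTl]
        · rw [hFυ.reg 13 (hwr' _ (by omega))]; simpa using hT13
        · intro c hc; rw [hI c hc, if_pos hc]
    · rintro υ ⟨k1, k2, k3, k4⟩ -
      refine Run.instr ?_
      simp only [Instr.wp, k1.Q, k3]
      exact ⟨hW.Q_lt, (k1.setReg (by norm_num) _).setReg (by norm_num) _, by simp [hl12, k2],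
        by simp; ring, by simpa using k4⟩
  · rintro τ ⟨-, -, -, -, h⟩ -
    exact h

end

/-! ### Table operations as programs -/

section

theorem Run.wp_seq {w : ℕ} {P P' : Program} {σ : State} {B₂ B : ℕ} {Q : State → Prop}
    (h : P.wp w σ fun τ => Run w P' τ B₂ Q) (hB : P.cost + B₂ ≤ B) : Run w (P ;; P') σ B Q :=
  Run.seq (R := fun τ => Run w P' τ B₂ Q) (Run.of_wp le_rfl h) (fun _ h _ => h) hB

theorem WordSize.ne_zero {K w : ℕ} (h : WordSize K w) : w ≠ 0 := by
  rintro rfl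
  have := h.three
  norm_num at this

/-! ## The closure of a table -/

def closeBody : Program :=
  .instr (.mul 20 16 14) ;; .instr (.sub 20 15 20) ;; .instr (.load 21 18 20) ;;
    .instr (.add 21 21 1) ;; .instr (.load 22 18 15) ;;
    .ite (.lt 21 22) (.instr (.store 18 15 21)) .skip

def closeAll : Program := slotPasses 9 closeBody

variable {K w : ℕ} {σ : State}

theorem run_closeAll (hW : WordSize K w) (hE : TEnv K σ) :
    Run w closeAll σ (K * (3 ^ K * 11 + 6) + 3)
      (fun τ => ∀ c < 3 ^ K, τ.arr 18 c = closeF (σ.arr 18) K c) := by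
  refine run_slotPasses hW hE (Or.inl rfl) hE.M (Nat.le_mul_of_pos_left _ (by omega))
    (by decide) (by decide) (closeF (σ.arr 18)) (fun _ _ => rfl) ?_
  intro s hs c hc τ hT h14 h15 h16 hI
  have hM := hW.M_lt
  have h3 := hW.three
  have h1 := dg_mul_le s c
  have hd := dg_lt s c
  have hp := hW.pow_lt hs.le
  -- The cell read may have been treated in this pass already, but its digit is 0, and for such an
  -- index the pass changes nothing.
  have e1 : τ.arr 18 (c - dg s c * 3 ^ s) = closeF (σ.arr 18) s (c - dg s c * 3 ^ s) := by
    rw [hI _ (by omega)]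
    split_ifs with h
    · have : dg s (c - dg s c * 3 ^ s) = 0 := by rw [dg_clear, if_pos rfl]
      simp [closeF, this]
    · rfl
  have e2 : τ.arr 18 c = closeF (σ.arr 18) s c := by rw [hI c hc, if_neg (lt_irrefl c)]
  refine Run.of_wp (by decide) ?_
  simp [closeBody, Program.wp, Instr.wp, h14, h15, h16, e1, e2, hT.one, Test.Holds, closeF,
    hW.ne_zero]
  refine ⟨⟨by omega, by omega, by omega⟩, by omega, fun h => ⟨by omega, fun c' hc' => ?_⟩⟩
  rw [Function.update_of_ne hc']

/-! ## Zeta and Möbius transforms -/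

def zetaBody (a : ℕ) : Program :=
  .ite (.eq 16 2)
    (.instr (.sub 20 15 14) ;; .instr (.load 21 a 20) ;; .instr (.load 22 a 15) ;;
      .instr (.add 22 22 21) ;; .instr (.store a 15 22))
    .skip

def moebiusBody : Program :=
  .ite (.eq 16 2)
    (.instr (.sub 20 15 14) ;; .instr (.load 21 21 20) ;; .instr (.load 22 21 15) ;;
      .instr (.sub 22 22 21) ;; .instr (.store 21 15 22))
    .skip

/-- The layers of a family of tables follow each other at distance `3 ^ K`. Lowering a digit below
`K` stays within the layer, so one pass transforms all layers at once. -/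
theorem flat_sub {s x : ℕ} (hs : s < K) (h : dg s x = 2) :
    dg s (x % 3 ^ K) = 2 ∧ (x - 3 ^ s) / 3 ^ K = x / 3 ^ K ∧
      (x - 3 ^ s) % 3 ^ K = x % 3 ^ K - 3 ^ s ∧ 3 ^ s ≤ x := by
  have e := Nat.div_add_mod' x (3 ^ K)
  have hlt : x % 3 ^ K < 3 ^ K := Nat.mod_lt _ (by positivity)
  have h1 : dg s (x % 3 ^ K) = 2 := by
    rw [← dg_flat hs (x / 3 ^ K), e, h]
  have h2 := dg_mul_le s (x % 3 ^ K)
  rw [h1] at h2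
  have h3 : x - 3 ^ s = (x % 3 ^ K - 3 ^ s) + 3 ^ K * (x / 3 ^ K) := by
    rw [mul_comm]; omega
  refine ⟨h1, ?_, ?_, by omega⟩
  · rw [h3, Nat.add_mul_div_left _ _ (by positivity), Nat.div_eq_of_lt (by omega), zero_add]
  · rw [h3, Nat.add_mul_mod_self_left, Nat.mod_eq_of_lt (by omega)]

theorem dg_mod {s : ℕ} (hs : s < K) (x : ℕ) : dg s (x % 3 ^ K) = dg s x := by
  conv_rhs => rw [← Nat.div_add_mod' x (3 ^ K), dg_flat hs]

theorem run_zeta {a : ℕ} (ha : a = 19 ∨ a = 20) (hW : WordSize K w) (hE : TEnv K σ) (L : ℕ → ℕ)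
    (h0 : ∀ x < (2 * K + 1) * 3 ^ K, σ.arr a x = zetaC K L (x / 3 ^ K) 0 (x % 3 ^ K)) :
    Run w (slotPasses 10 (zetaBody a)) σ (K * ((2 * K + 1) * 3 ^ K * 10 + 6) + 3)
      (fun τ => ∀ x < (2 * K + 1) * 3 ^ K, τ.arr a x = zetaC K L (x / 3 ^ K) K (x % 3 ^ K)) := by
  have ha' : ∀ b < 18, (zetaBody a).wa b = false := by
    rcases ha with rfl | rfl <;> decide
  refine run_slotPasses (B := 6) hW hE (Or.inr rfl) hE.Q le_rfl
    (by simp [zetaBody, Program.wr, Instr.wr]; omega) ha'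
    (fun s x => zetaC K L (x / 3 ^ K) s (x % 3 ^ K)) h0 ?_
  intro s hs c hc τ hT h14 h15 h16 hI
  have hM := hW.M_lt
  have hp := hW.pow_lt hs.le
  refine Run.of_wp (by simp [zetaBody, Program.cost]) ?_
  have e2 : τ.arr a c = zetaC K L (c / 3 ^ K) s (c % 3 ^ K) := by rw [hI c hc, if_neg (lt_irrefl c)]
  simp only [zetaBody, Program.wp, Instr.wp, Test.Holds, h16, hT.two]
  constructor
  · intro hd
    obtain ⟨k1, k2, k3, k4⟩ := flat_sub hs hd
    -- The lowered index has digit 1, so the current pass leaves its cell as it was.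
    have e1 : τ.arr a (c - 3 ^ s) = zetaC K L (c / 3 ^ K) s (c % 3 ^ K - 3 ^ s) := by
      rw [hI _ (by omega), k2, k3]
      split_ifs with h
      · rw [zetaC_succ_of_ne]; rw [dg_dec k1]; simp
      · rfl
    have := zetaC_le (K := K) (L := L) (i := c / 3 ^ K) (s := s) (c := c % 3 ^ K - 3 ^ s)
    simp [h14, h15, e1, e2, zetaC_succ_of_eq hs k1]
    refine ⟨by omega, by omega, fun c' hc' => Function.update_of_ne hc' _ _⟩
  · intro hd
    refine ⟨?_, fun _ _ => trivial⟩
    rw [e2, zetaC_succ_of_ne]; rwa [dg_mod hs]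

theorem run_moebius (hW : WordSize K w) (hE : TEnv K σ) (L R : ℕ → ℕ)
    (h0 : ∀ x < (2 * K + 1) * 3 ^ K, σ.arr 21 x = covC K L R (x / 3 ^ K) 0 (x % 3 ^ K)) :
    Run w (slotPasses 10 moebiusBody) σ (K * ((2 * K + 1) * 3 ^ K * 10 + 6) + 3)
      (fun τ => ∀ x < (2 * K + 1) * 3 ^ K, τ.arr 21 x = covC K L R (x / 3 ^ K) K (x % 3 ^ K)) := by
  refine run_slotPasses (B := 6) hW hE (Or.inr rfl) hE.Q le_rfl (by decide) (by decide)
    (fun s x => covC K L R (x / 3 ^ K) s (x % 3 ^ K)) h0 ?_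
  intro s hs c hc τ hT h14 h15 h16 hI
  have hM := hW.count
  have hp := hW.pow_lt hs.le
  refine Run.of_wp (by simp [moebiusBody, Program.cost]) ?_
  have e2 : τ.arr 21 c = covC K L R (c / 3 ^ K) s (c % 3 ^ K) := by
    rw [hI c hc, if_neg (lt_irrefl c)]
  simp only [moebiusBody, Program.wp, Instr.wp, Test.Holds, h16, hT.two]
  constructor
  · intro hd
    obtain ⟨k1, k2, k3, k4⟩ := flat_sub hs hd
    -- As for the zeta transform: at digit 1 the pass does nothing, so updating in place is
    -- harmless.
    have e1 : τ.arr 21 (c - 3 ^ s) = covC K L R (c / 3 ^ K) s (c % 3 ^ K - 3 ^ s) := by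
      rw [hI _ (by omega), k2, k3]
      split_ifs with h
      · rw [covC_succ_of_ne]; rw [dg_dec k1]; simp
      · rfl
    have := covC_le (K := K) (L := L) (R := R) (k := c / 3 ^ K) (s := s) (c := c % 3 ^ K - 3 ^ s)
    simp [h14, h15, e1, e2, covC_succ_of_eq hs k1]
    refine ⟨by omega, by omega, fun c' hc' => Function.update_of_ne hc' _ _⟩
  · intro hd
    refine ⟨?_, fun _ _ => trivial⟩
    rw [e2, covC_succ_of_ne]; rwa [dg_mod hs]

/-! ## The number of demands -/

def cntBody : Program :=
  .ite (.eq 16 2) (.instr (.load 20 22 15) ;; .instr (.add 20 20 1) ;; .instr (.store 22 15 20)) .skip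

theorem run_cnt (hW : WordSize K w) (hE : TEnv K σ) (h0 : ∀ c, σ.arr 22 c = 0) :
    Run w (slotPasses 9 cntBody) σ (K * (3 ^ K * 8 + 6) + 3)
      (fun τ => ∀ c < 3 ^ K, τ.arr 22 c = cnt K c) := by
  refine run_slotPasses (B := 4) hW hE (Or.inl rfl) hE.M (Nat.le_mul_of_pos_left _ (by omega))
    (by decide) (by decide) cnt (fun c _ => by simp [h0, cnt]) ?_
  intro s hs c hc τ hT h14 h15 h16 hI
  have h3 := hW.three
  refine Run.of_wp (by decide) ?_
  have e2 : τ.arr 22 c = cnt s c := by rw [hI c hc, if_neg (lt_irrefl c)]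
  have e3 : cnt (s + 1) c = cnt s c + if dg s c = 2 then 1 else 0 := by
    rw [cnt, cnt, Finset.range_add_one, Finset.filter_insert]
    split_ifs with h
    · rw [Finset.card_insert_of_notMem (by simp)]
    · rfl
  simp [cntBody, Program.wp, Instr.wp, Test.Holds, h15, h16, hT.two, hT.one, e2, e3]
  exact fun hd => ⟨hW.ne_zero, hd, fun c' hc' => Function.update_of_ne hc' _ _⟩

end

section

variable {K w : ℕ} {σ : State}

/-! ## The covering product of two tables -/

theorem Run.forUp_seq {w i lim : ℕ} {body P : Program} {σ : State} (Inv : ℕ → State → Prop)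
    {a b : ℕ} (B : ℕ) {B₂ B₃ : ℕ} {Q : State → Prop}
    (hi : σ.reg i = a) (hl : σ.reg lim = b) (h1 : σ.reg 1 = 1) (hab : a ≤ b)
    (hw : 1 < 2 ^ w) (hbi : body.wr i = false) (hbl : (RAM.forUp i lim body).wr lim = false)
    (hb1 : (RAM.forUp i lim body).wr 1 = false) (h0 : Inv a σ)
    (hstep : ∀ j τ, a ≤ j → j < b → τ.reg i = j → Fr (RAM.forUp i lim body) σ τ → Inv j τ →
      Run w body τ B (fun τ' => Inv (j + 1) (τ'.setReg i (j + 1))))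
    (hP : ∀ τ, τ.reg i = b → Inv b τ → Fr (RAM.forUp i lim body) σ τ → Run w P τ B₂ Q)
    (hB : (b - a) * (B + 2) + 1 + B₂ ≤ B₃) :
    Run w (RAM.forUp i lim body ;; P) σ B₃ Q :=
  Run.seq (Run.forUp Inv B hi hl h1 hab hw hbi hbl hb1 h0 hstep) (fun τ h hF => hP τ h.1 h.2 hF) hB

theorem WordSize.one_lt (h : WordSize K w) : 1 < 2 ^ w := by have := h.three; omega

/-- Bounds for the steps of the table operations. Only `passCost` and `productCost` contain a term
of order `K ^ 2 * 3 ^ K`; the others listed here are of order `K * 3 ^ K`. -/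
def passCost (K : ℕ) : ℕ := K * ((2 * K + 1) * 3 ^ K * 10 + 6) + 3
def fillCost (K : ℕ) : ℕ := (2 * K + 1) * (3 ^ K * 6 + 4) + 3
def productCost (K : ℕ) : ℕ := (2 * K + 1) * (3 ^ K * ((2 * K + 1) * 8 + 10) + 4) + 3
def minCost (K : ℕ) : ℕ := 3 ^ K * ((2 * K + 1) * 4 + 7) + 2
def closeCost (K : ℕ) : ℕ := K * (3 ^ K * 11 + 6) + 3

def fillRow (src dst : ℕ) : Program :=
  .instr (.load 33 src 31) ;; .ite (.eq 33 30) (.instr (.store dst 32 1)) (.instr (.store dst 32 4)) ;;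
    .instr (.add 32 32 1)

/-- Write the indicator functions of the values of table `src` to array `dst`. -/
def fill (src dst : ℕ) : Program :=
  .instr (.const 30 0) ;; .instr (.const 32 0) ;;
    forUp 30 11 (.instr (.const 31 0) ;; forUp 31 9 (fillRow src dst))

theorem run_fill {src dst : ℕ} (hsd : src ≠ dst) (hd : 16 ≤ dst) (hW : WordSize K w) (hE : TEnv K σ) :
    Run w (fill src dst) σ (fillCost K) (fun τ =>
      ∀ x < (2 * K + 1) * 3 ^ K, τ.arr dst x = zetaC K (σ.arr src) (x / 3 ^ K) 0 (x % 3 ^ K)) := by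
  have hw1 := hW.one_lt
  unfold fillCost
  have hr : ∀ r < 12, r ≠ 0 → (fillRow src dst).wr r = false := by
    intro r hr _
    simp [fillRow, Program.wr, Instr.wr]; omega
  have ha : ∀ r < 16, (fillRow src dst).wa r = false := by
    intro r hr
    simp [fillRow, Program.wa, Instr.wa]; omega
  have hsrc : (fillRow src dst).wa src = false := by
    simp [fillRow, Program.wa, Instr.wa]; omega
  have hr1 : ∀ r < 12, r ≠ 0 → (RAM.forUp 31 9 (fillRow src dst)).wr r = false := by
    intro r h h'
    simp [RAM.forUp, Program.wr, Instr.wr, hr r h h']; omega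
  have ha1 : ∀ r < 16, (RAM.forUp 31 9 (fillRow src dst)).wa r = false := by
    intro r h
    simp [RAM.forUp, Program.wa, Instr.wa, ha r h]
  refine Run.wp_seq (B₂ := (2 * K + 1) * (3 ^ K * 6 + 4) + 2) ⟨by omega, ?_⟩ (by simp [Program.cost]; omega)
  refine Run.wp_seq (B₂ := (2 * K + 1) * (3 ^ K * 6 + 4) + 1) ⟨by omega, ?_⟩ (by simp [Program.cost]; omega)
  have hE' : TEnv K ((σ.setReg 30 0).setReg 32 0) :=
    (hE.setReg (by norm_num) _).setReg (by norm_num) _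
  refine Run.mono (Run.forUp (a := 0) (B := 3 ^ K * 6 + 2) (fun i τ => τ.reg 32 = i * 3 ^ K ∧
    ∀ x < i * 3 ^ K, τ.arr dst x = zetaC K (σ.arr src) (x / 3 ^ K) 0 (x % 3 ^ K))
    (by simp) hE'.L hE'.one (Nat.zero_le _) hw1 rfl rfl rfl ?_ ?_) (by simp) (fun τ h _ => h.2.2)
  · simp
  rintro i τ - hi hτ hF ⟨h32, hI⟩
  have hT := hE'.fr hF (fun r h h' => by
      have := hr1 r h h'
      simp [RAM.forUp, Program.wr, Instr.wr] at this ⊢; simp [this]; omega)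
    (fun r h => by
      have := ha1 r h
      simp [RAM.forUp, Program.wa, Instr.wa] at this ⊢; simp [this])
  refine Run.wp_seq (B₂ := 3 ^ K * 6 + 1) ⟨by omega, ?_⟩ (by simp [Program.cost]; omega)
  have hT' := hT.setReg (r := 31) (by norm_num) 0
  refine Run.mono (Run.forUp (a := 0) (B := 4) (fun c τ => τ.reg 32 = i * 3 ^ K + c ∧
    ∀ x < i * 3 ^ K + c, τ.arr dst x = zetaC K (σ.arr src) (x / 3 ^ K) 0 (x % 3 ^ K))
    (by simp) hT'.M hT'.one (Nat.zero_le _) hw1 rfl rfl rfl ?_ ?_) (by simp) ?_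
  · exact ⟨by simpa using h32, by simpa using hI⟩
  · rintro c υ - hc hυ hFυ ⟨k32, kI⟩
    have hTυ := hT'.fr hFυ hr1 ha1
    have e30 : υ.reg 30 = i := (hFυ.reg 30 rfl).trans (by simpa using hτ)
    have esrc : υ.arr src = σ.arr src := by
      rw [hFυ.arr src (by simp [RAM.forUp, Program.wa, Instr.wa, hsrc])]
      simp only [State.setReg_arr]
      rw [hF.arr src (by simp [RAM.forUp, Program.wa, Instr.wa, hsrc])]; rfl
    have hx1 : (i * 3 ^ K + c) / 3 ^ K = i := by
      rw [mul_comm, Nat.mul_add_div (by positivity), Nat.div_eq_of_lt hc, add_zero]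
    have hx2 : (i * 3 ^ K + c) % 3 ^ K = c := by
      rw [mul_comm, Nat.mul_add_mod, Nat.mod_eq_of_lt hc]
    have key : ∀ v, v = zetaC K (σ.arr src) i 0 c → ∀ x < i * 3 ^ K + (c + 1),
        Function.update (υ.arr dst) (i * 3 ^ K + c) v x =
          zetaC K (σ.arr src) (x / 3 ^ K) 0 (x % 3 ^ K) := by
      rintro v rfl x hx
      by_cases hxc : x = i * 3 ^ K + c
      · subst hxc; rw [Function.update_self, hx1, hx2]
      · rw [Function.update_of_ne hxc]; exact kI x (by omega)
    refine Run.of_wp (by simp [fillRow, Program.cost]) ?_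
    simp only [fillRow, Program.wp, Instr.wp, Test.Holds]
    simp [k32, e30, esrc, hυ, hTυ.one, hTυ.zero, hW.ne_zero]
    rw [zetaC_zero hc] at key
    refine ⟨fun h => ⟨by omega, key _ (by simp [h])⟩, fun h => ⟨by omega, key _ (by simp [h])⟩⟩
  · rintro υ ⟨-, k32, kI⟩ -
    have : (i + 1) * 3 ^ K = i * 3 ^ K + 3 ^ K := by ring
    exact ⟨by simp [k32, this], by simpa [this] using kI⟩

/-- One pointer climbs through the layers of the left factor while the other descends through those
of the right one. After the last term the descending pointer would fall below 0 and is truncated,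
but it is not read again. -/
def productTerm : Program :=
  .instr (.load 39 19 34) ;; .instr (.load 40 20 35) ;; .instr (.mul 39 39 40) ;;
    .instr (.add 36 36 39) ;; .instr (.add 34 34 9) ;; .instr (.sub 35 35 9)

def productCell : Program :=
  .instr (.const 36 0) ;; .instr (.copy 34 31) ;; .instr (.copy 35 33) ;; .instr (.const 32 0) ;;
    .instr (.add 38 30 1) ;; forUp 32 38 productTerm ;; .instr (.store 21 33 36) ;;
    .instr (.add 33 33 1)

/-- The products of the polynomials in arrays `19` and `20`. -/
def product : Program :=
  .instr (.const 30 0) ;; .instr (.const 33 0) ;;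
    forUp 30 11 (.instr (.const 31 0) ;; forUp 31 9 productCell)

theorem flat_div {i c : ℕ} (hc : c < 3 ^ K) : (i * 3 ^ K + c) / 3 ^ K = i := by
  rw [mul_comm, Nat.mul_add_div (by positivity), Nat.div_eq_of_lt hc, add_zero]

theorem flat_mod {i c : ℕ} (hc : c < 3 ^ K) : (i * 3 ^ K + c) % 3 ^ K = c := by
  rw [mul_comm, Nat.mul_add_mod, Nat.mod_eq_of_lt hc]

theorem flat_lt {i c : ℕ} (hi : i < 2 * K + 1) (hc : c < 3 ^ K) :
    i * 3 ^ K + c < (2 * K + 1) * 3 ^ K := by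
  calc i * 3 ^ K + c < i * 3 ^ K + 3 ^ K := by omega
    _ = (i + 1) * 3 ^ K := by ring
    _ ≤ _ := Nat.mul_le_mul_right _ hi

theorem run_productCell (hW : WordSize K w) (hE : TEnv K σ) (L R : ℕ → ℕ) {k c : ℕ}
    (hk : k < 2 * K + 1) (hc : c < 3 ^ K)
    (hf : ∀ x < (2 * K + 1) * 3 ^ K, σ.arr 19 x = zetaC K L (x / 3 ^ K) K (x % 3 ^ K))
    (hg : ∀ x < (2 * K + 1) * 3 ^ K, σ.arr 20 x = zetaC K R (x / 3 ^ K) K (x % 3 ^ K))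
    (h30 : σ.reg 30 = k) (h31 : σ.reg 31 = c) (h33 : σ.reg 33 = k * 3 ^ K + c) :
    Run w productCell σ ((2 * K + 1) * 8 + 8) (fun τ =>
      τ.arr 21 = Function.update (σ.arr 21) (k * 3 ^ K + c) (covC K L R k 0 c) ∧
        τ.reg 33 = k * 3 ^ K + c + 1) := by
  have hw1 := hW.one_lt
  have hM := hW.M_lt
  have hMM := hW.count
  have hB : (k + 1) * 8 ≤ (2 * K + 1) * 8 := Nat.mul_le_mul_right _ hk
  refine Run.wp_seq (B₂ := (2 * K + 1) * 8 + 7) ⟨by omega, ?_⟩ (by simp [Program.cost]; omega)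
  refine Run.wp_seq (P := .instr (.copy 34 31)) (B₂ := (2 * K + 1) * 8 + 6) ?_ (by simp [Program.cost]; omega)
  refine Run.wp_seq (P := .instr (.copy 35 33)) (B₂ := (2 * K + 1) * 8 + 5) ?_ (by simp [Program.cost]; omega)
  refine Run.wp_seq (B₂ := (2 * K + 1) * 8 + 4) ⟨by omega, ?_⟩ (by simp [Program.cost]; omega)
  refine Run.wp_seq (B₂ := (2 * K + 1) * 8 + 3) ⟨by simpa [hE.one] using hW.ne_zero, ?_⟩ (by simp [Program.cost]; omega)
  refine Run.forUp_seq (a := 0) (b := k + 1) (B := 6) (B₂ := 2) (fun i τ =>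
    τ.reg 36 = ∑ i ∈ Finset.range i, zetaC K L i K c * zetaC K R (k - i) K c ∧
      τ.reg 34 = i * 3 ^ K + c ∧ τ.reg 35 = k * 3 ^ K + c - i * 3 ^ K)
    (by simp) (by simp [h30, hE.one]) (by simp [hE.one]) (Nat.zero_le _) hw1 rfl rfl rfl
    (by simp [h31, h33]) ?_ ?_ (by omega)
  · rintro i τ - hi hτ hF ⟨h36, h34, h35⟩
    have e9 : τ.reg 9 = 3 ^ K := (hF.reg 9 rfl).trans (by simp [hE.M])
    have e19 : τ.arr 19 (i * 3 ^ K + c) = zetaC K L i K c := by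
      rw [hF.arr 19 rfl]
      simp only [State.setReg_arr]
      rw [hf _ (flat_lt (by omega) hc), flat_div hc, flat_mod hc]
    have ek : k * 3 ^ K + c - i * 3 ^ K = (k - i) * 3 ^ K + c := by
      have : k * 3 ^ K = (k - i) * 3 ^ K + i * 3 ^ K := by
        rw [← add_mul]; congr 1; omega
      omega
    have e20 : τ.arr 20 (k * 3 ^ K + c - i * 3 ^ K) = zetaC K R (k - i) K c := by
      rw [ek, hF.arr 20 rfl]
      simp only [State.setReg_arr]
      rw [hg _ (flat_lt (by omega) hc), flat_div hc, flat_mod hc]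
    have z1 := zetaC_le (K := K) (L := L) (i := i) (s := K) (c := c)
    have z2 := zetaC_le (K := K) (L := R) (i := k - i) (s := K) (c := c)
    have z3 := Nat.mul_le_mul z1 z2
    refine Run.of_wp (by decide) ?_
    simp [productTerm, Program.wp, Instr.wp, h34, h35, h36, e9, e19, e20, Finset.sum_range_succ]
    refine ⟨⟨by omega, by omega, by omega⟩, by omega, by omega, by ring, ?_⟩
    rw [add_mul, one_mul]; omega
  · rintro τ hτ ⟨h36, h34, h35⟩ hF
    have e33 : τ.reg 33 = k * 3 ^ K + c := (hF.reg 33 rfl).trans (by simp [h33])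
    have e1 : τ.reg 1 = 1 := (hF.reg 1 rfl).trans (by simp [hE.one])
    have e21 : τ.arr 21 = σ.arr 21 := hF.arr 21 rfl
    refine Run.of_wp (by decide) ?_
    simp [Program.wp, Instr.wp, h36, e33, e1, e21, covC_zero, hW.ne_zero]

theorem run_product (hW : WordSize K w) (hE : TEnv K σ) (L R : ℕ → ℕ)
    (hf : ∀ x < (2 * K + 1) * 3 ^ K, σ.arr 19 x = zetaC K L (x / 3 ^ K) K (x % 3 ^ K))
    (hg : ∀ x < (2 * K + 1) * 3 ^ K, σ.arr 20 x = zetaC K R (x / 3 ^ K) K (x % 3 ^ K)) :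
    Run w product σ (productCost K) (fun τ =>
      ∀ x < (2 * K + 1) * 3 ^ K, τ.arr 21 x = covC K L R (x / 3 ^ K) 0 (x % 3 ^ K)) := by
  have hw1 := hW.one_lt
  unfold productCost
  generalize hB : (2 * K + 1) * 8 = B
  refine Run.wp_seq (B₂ := (2 * K + 1) * (3 ^ K * (B + 10) + 4) + 2) ⟨by omega, ?_⟩ (by simp [Program.cost]; omega)
  refine Run.wp_seq (B₂ := (2 * K + 1) * (3 ^ K * (B + 10) + 4) + 1) ⟨by omega, ?_⟩ (by simp [Program.cost]; omega)
  have hE' : TEnv K ((σ.setReg 30 0).setReg 33 0) :=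
    (hE.setReg (by norm_num) _).setReg (by norm_num) _
  refine Run.mono (Run.forUp (a := 0) (B := 3 ^ K * (B + 10) + 2) (fun i τ => τ.reg 33 = i * 3 ^ K ∧
    ∀ x < i * 3 ^ K, τ.arr 21 x = covC K L R (x / 3 ^ K) 0 (x % 3 ^ K))
    (by simp) hE'.L hE'.one (Nat.zero_le _) hw1 rfl rfl rfl ?_ ?_) (by simp) (fun τ h _ => h.2.2)
  · simp
  rintro i τ - hi hτ hF ⟨h32, hI⟩
  have hT := hE'.fr hF (by decide) (by decide)
  refine Run.wp_seq (B₂ := 3 ^ K * (B + 10) + 1) ⟨by omega, ?_⟩ (by simp [Program.cost]; omega)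
  have hT' := hT.setReg (r := 31) (by norm_num) 0
  refine Run.mono (Run.forUp (a := 0) (B := B + 8) (fun c τ => τ.reg 33 = i * 3 ^ K + c ∧
    ∀ x < i * 3 ^ K + c, τ.arr 21 x = covC K L R (x / 3 ^ K) 0 (x % 3 ^ K))
    (by simp) hT'.M hT'.one (Nat.zero_le _) hw1 rfl rfl rfl ?_ ?_) (by simp) ?_
  · exact ⟨by simpa using h32, by simpa using hI⟩
  · rintro c υ - hc hυ hFυ ⟨k32, kI⟩
    have hTυ := hT'.fr hFυ (by decide) (by decide)
    have e30 : υ.reg 30 = i := (hFυ.reg 30 rfl).trans (by simpa using hτ)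
    have e19 : υ.arr 19 = σ.arr 19 := by
      rw [hFυ.arr 19 rfl]; simp only [State.setReg_arr]; rw [hF.arr 19 rfl]; rfl
    have e20 : υ.arr 20 = σ.arr 20 := by
      rw [hFυ.arr 20 rfl]; simp only [State.setReg_arr]; rw [hF.arr 20 rfl]; rfl
    refine Run.mono (run_productCell hW hTυ L R hi hc (by rwa [e19]) (by rwa [e20]) e30 hυ k32)
      (by omega) ?_
    rintro υ' ⟨h21, h33⟩ -
    refine ⟨by simpa [add_assoc] using h33, fun x hx => ?_⟩
    simp only [State.setReg_arr, h21]
    by_cases hxc : x = i * 3 ^ K + c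
    · subst hxc; rw [Function.update_self, flat_div hc, flat_mod hc]
    · rw [Function.update_of_ne hxc]; exact kI x (by omega)
  · rintro υ ⟨-, k32, kI⟩ -
    have : (i + 1) * 3 ^ K = i * 3 ^ K + 3 ^ K := by ring
    exact ⟨by simp [k32, this], by simpa [this] using kI⟩

def minCell : Program :=
  .instr (.const 31 0) ;; .instr (.copy 32 30) ;; .instr (.load 33 21 32) ;;
    .while (.eq 33 4) (.instr (.add 31 31 1) ;; .instr (.add 32 32 9) ;; .instr (.load 33 21 32)) ;;
    .instr (.store 18 30 31)

/-- The least cost with a nonzero count, for every index. -/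
def minSearch : Program := .instr (.const 30 0) ;; forUp 30 9 minCell

/-- Every code is covered by the pair consisting of itself twice, so a nonzero count occurs at `L c
+ R c`, which is at most `2 * K`. Hence the search ends within the `2 * K + 1` layers. -/
theorem run_minSearch (hW : WordSize K w) (hE : TEnv K σ) (L R : ℕ → ℕ)
    (hh : ∀ x < (2 * K + 1) * 3 ^ K, σ.arr 21 x = covC K L R (x / 3 ^ K) K (x % 3 ^ K))
    (hL : ∀ c < 3 ^ K, L c ≤ K) (hR : ∀ c < 3 ^ K, R c ≤ K) :
    Run w minSearch σ (minCost K) (fun τ =>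
      ∀ c < 3 ^ K, covC K L R (τ.arr 18 c) K c ≠ 0 ∧ ∀ k < τ.arr 18 c, covC K L R k K c = 0) := by
  have hw1 := hW.one_lt
  have hM := hW.M_lt
  unfold minCost
  generalize hB : (2 * K + 1) * 4 = B
  refine Run.wp_seq (B₂ := 3 ^ K * (B + 7) + 1) ⟨by omega, ?_⟩ (by simp [Program.cost]; omega)
  have hE' : TEnv K (σ.setReg 30 0) := hE.setReg (by norm_num) _
  refine Run.mono (Run.forUp (a := 0) (B := B + 5) (fun c' τ => ∀ c < c',
    covC K L R (τ.arr 18 c) K c ≠ 0 ∧ ∀ k < τ.arr 18 c, covC K L R k K c = 0)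
    (by simp) hE'.M hE'.one (Nat.zero_le _) hw1 rfl rfl rfl ?_ ?_) (by simp) (fun τ h _ => h.2)
  · simp
  rintro c τ - hc hτ hF hI
  have hT := hE'.fr hF (by decide) (by decide)
  have e21 : τ.arr 21 = σ.arr 21 := hF.arr 21 rfl
  have hL' := hL c hc
  have hR' := hR c hc
  have hk : covC K L R (L c + R c) K c ≠ 0 :=
    covC_ne_zero.2 ⟨c, hc, c, hc, fun t _ => Or.inl ⟨rfl, rfl⟩, rfl⟩
  have hv : ∀ k < 2 * K + 1, τ.arr 21 (k * 3 ^ K + c) = covC K L R k K c := by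
    intro k hk
    rw [e21, hh _ (flat_lt hk hc), flat_div hc, flat_mod hc]
  refine Run.wp_seq (B₂ := B + 4) ⟨by omega, ?_⟩ (by simp [Program.cost]; omega)
  refine Run.wp_seq (P := .instr (.copy 32 30)) (B₂ := B + 3) ?_ (by simp [Program.cost]; omega)
  refine Run.wp_seq (P := .instr (.load 33 21 32)) (B₂ := B + 2) ?_ (by simp [Program.cost]; omega)
  refine Run.seq (B₂ := 1) (Run.while (ι := ℕ) (fun k υ => k < 2 * K + 1 ∧ υ.reg 31 = k ∧
      υ.reg 32 = k * 3 ^ K + c ∧ υ.reg 33 = covC K L R k K c ∧ ∀ k' < k, covC K L R k' K c = 0)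
      (fun k => (2 * K + 1 - k) * 4) 0 ?_ ?_) ?_ (by omega)
  · have := hv 0 (by omega)
    simp only [zero_mul, zero_add] at this
    simp [Instr.wp, hτ, this]
  · rintro k υ ⟨hk1, h31, h32, h33, hk2⟩ hb hFυ
    have e4 : υ.reg 4 = 0 := (hFυ.reg 4 rfl).trans (by simp [hT.zero])
    have e1 : υ.reg 1 = 1 := (hFυ.reg 1 rfl).trans (by simp [hT.one])
    have e9 : υ.reg 9 = 3 ^ K := (hFυ.reg 9 rfl).trans (by simp [hT.M])
    have ea : υ.arr 21 = τ.arr 21 := hFυ.arr 21 rfl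
    simp only [Test.Holds, h33, e4] at hb
    have hk0 : k ≠ L c + R c := by rintro rfl; exact hk hb
    have hk3 : k < L c + R c := by
      by_contra h
      exact hk (hk2 _ (by omega))
    have hv' := hv (k + 1) (by omega)
    rw [add_mul, one_mul, add_right_comm] at hv'
    refine ⟨3, Run.of_wp (by decide) ?_⟩
    simp only [Program.wp, Instr.wp]
    simp only [State.setReg_reg, State.setReg_arr, Nat.reduceEqDiff, if_true, if_false, h31, h32, e1, e9, ea, hv']
    refine ⟨hw1, hM, k + 1, ⟨by omega, rfl, by ring, rfl, fun k' hk' => ?_⟩, by omega⟩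
    rcases Nat.lt_succ_iff_lt_or_eq.1 hk' with h | rfl
    · exact hk2 k' h
    · exact hb
  · rintro υ ⟨k, ⟨hk1, h31, h32, h33, hk2⟩, hb⟩ hFυ
    have e4 : υ.reg 4 = 0 := (hFυ.reg 4 rfl).trans (by simp [hT.zero])
    have e30 : υ.reg 30 = c := (hFυ.reg 30 rfl).trans (by simp [hτ])
    have ea : υ.arr 18 = τ.arr 18 := hFυ.arr 18 rfl
    simp only [Test.Holds, h33, e4] at hb
    refine Run.instr ?_
    simp only [Instr.wp, State.setReg_arr, State.setArr_arr, if_true, h31, e30, ea]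
    intro c' hc'
    by_cases h : c' = c
    · subst h; simp only [Function.update_self]; exact ⟨hb, hk2⟩
    · rw [Function.update_of_ne h]; exact hI c' (by omega)

/-- Join the tables in arrays `18` and `23`; the result is in array `18`. -/
def join : Program :=
  fill 18 19 ;; fill 23 20 ;; slotPasses 10 (zetaBody 19) ;; slotPasses 10 (zetaBody 20) ;;
    product ;; slotPasses 10 moebiusBody ;; minSearch ;; closeAll

def joinCost (K : ℕ) : ℕ :=
  2 * fillCost K + 3 * passCost K + productCost K + minCost K + closeCost K

theorem run_join (hW : WordSize K w) (hE : TEnv K σ)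
    (hL : ∀ c < 3 ^ K, σ.arr 18 c ≤ K) (hR : ∀ c < 3 ^ K, σ.arr 23 c ≤ K) :
    Run w join σ (joinCost K) (fun τ => ∀ c < 3 ^ K, ∀ m, τ.arr 18 c ≤ m ↔
      ∃ c' < 3 ^ K, ∃ P ⊆ Finset.range K, (∀ t, dg t c' = if t ∈ P then 0 else dg t c) ∧
        ∃ a < 3 ^ K, ∃ b < 3 ^ K, (∀ t < K, cov (dg t a) (dg t b) (dg t c')) ∧
          σ.arr 18 a + σ.arr 23 b + P.card ≤ m) := by
  have hw1 := hW.one_lt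
  unfold joinCost
  refine Run.seq (B₂ := fillCost K + 3 * passCost K + productCost K + minCost K + closeCost K)
    (run_fill (by norm_num) (by norm_num) hW hE) (fun τ₁ h₁ F₁ => ?_) (by omega)
  have E₁ := hE.fr F₁ (by decide) (by decide)
  refine Run.seq (B₂ := 3 * passCost K + productCost K + minCost K + closeCost K)
    (run_fill (by norm_num) (by norm_num) hW E₁) (fun τ₂ h₂ F₂ => ?_) (by omega)
  have E₂ := E₁.fr F₂ (by decide) (by decide)
  rw [F₁.arr 23 rfl] at h₂
  rw [← F₂.arr 19 rfl] at h₁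
  refine Run.seq (B₂ := 2 * passCost K + productCost K + minCost K + closeCost K)
    (run_zeta (Or.inl rfl) hW E₂ _ h₁) (fun τ₃ h₃ F₃ => ?_) (by unfold passCost; omega)
  have E₃ := E₂.fr F₃ (by decide) (by decide)
  rw [← F₃.arr 20 rfl] at h₂
  refine Run.seq (B₂ := passCost K + productCost K + minCost K + closeCost K)
    (run_zeta (Or.inr rfl) hW E₃ _ h₂) (fun τ₄ h₄ F₄ => ?_) (by unfold passCost; omega)
  have E₄ := E₃.fr F₄ (by decide) (by decide)
  rw [← F₄.arr 19 rfl] at h₃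
  refine Run.seq (B₂ := passCost K + minCost K + closeCost K)
    (run_product hW E₄ _ _ h₃ h₄) (fun τ₅ h₅ F₅ => ?_) (by omega)
  have E₅ := E₄.fr F₅ (by decide) (by decide)
  refine Run.seq (B₂ := minCost K + closeCost K)
    (run_moebius hW E₅ _ _ h₅) (fun τ₆ h₆ F₆ => ?_) (by unfold passCost; omega)
  have E₆ := E₅.fr F₆ (by decide) (by decide)
  refine Run.seq (B₂ := closeCost K)
    (run_minSearch hW E₆ _ _ h₆ hL hR) (fun τ₇ h₇ F₇ => ?_) le_rfl
  have E₇ := E₆.fr F₇ (by decide) (by decide)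
  refine Run.mono (run_closeAll hW E₇) le_rfl (fun τ h _ c hc m => ?_)
  rw [h c hc, closeF_le _ _ hc]
  refine exists_congr fun c' => and_congr_right fun hc' => exists_congr fun P =>
    and_congr_right fun _ => and_congr_right fun _ => ?_
  -- By `k1` the entry is the cost of some covering pair, and by `k2` no covering pair is cheaper.
  obtain ⟨k1, k2⟩ := h₇ c' hc'
  constructor
  · intro hm
    obtain ⟨a, ha, b, hb, h1, h2⟩ := covC_ne_zero.1 k1
    exact ⟨a, ha, b, hb, h1, by omega⟩
  · rintro ⟨a, ha, b, hb, h1, h2⟩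
    by_contra hlt
    exact covC_ne_zero.2 ⟨a, ha, b, hb, h1, rfl⟩ (k2 _ (by omega))

end

section

variable {K w : ℕ} {σ : State}

/-! ## Adding an edge -/

/-- The demand that is left after the edge between the slots `i` and `j` is added. -/
def edgeIdx (i j c : ℕ) : ℕ :=
  if dg i c = 0 ∧ dg j c = 2 then c - 3 ^ j else if dg j c = 0 ∧ dg i c = 2 then c - 3 ^ i else c

theorem dg_edgeIdx {i j c : ℕ} (t : ℕ) : dg t (edgeIdx i j c) =
    if (t = j ∧ dg j c = 2 ∧ dg i c = 0) ∨ (t = i ∧ dg i c = 2 ∧ dg j c = 0) then 1 else dg t c := by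
  unfold edgeIdx
  split_ifs with h1 h2 h3 h4 h5
  · rw [dg_dec h1.2]; split_ifs <;> omega
  · rw [dg_dec h1.2]; split_ifs <;> omega
  · rw [dg_dec h3.2]; split_ifs <;> omega
  · rw [dg_dec h3.2]; split_ifs <;> omega
  · omega
  · rfl

theorem edgeIdx_le (i j c : ℕ) : edgeIdx i j c ≤ c := by
  unfold edgeIdx; split_ifs <;> simp

/-- After the step one end is free and the other asks for nothing, or the code was unchanged.
Consequently the cell that an update reads is a fixed point, and the table can be rewritten in
place. -/
theorem edgeIdx_edgeIdx (i j c : ℕ) : edgeIdx i j (edgeIdx i j c) = edgeIdx i j c := by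
  have hi := dg_edgeIdx (i := i) (j := j) (c := c) i
  have hj := dg_edgeIdx (i := i) (j := j) (c := c) j
  conv_lhs => rw [edgeIdx]
  split_ifs at hi hj ⊢ <;> omega

def edgeCell : Program :=
  .instr (.add 58 55 57) ;; .instr (.load 58 8 58) ;; .instr (.add 59 56 57) ;;
    .instr (.load 59 8 59) ;;
    .ite (.eq 58 4)
      (.ite (.eq 59 2)
        (.instr (.sub 60 57 54) ;; .instr (.load 61 18 60) ;; .instr (.store 18 57 61)) .skip)
      (.ite (.eq 59 4)
        (.ite (.eq 58 2)
          (.instr (.sub 60 57 53) ;; .instr (.load 61 18 60) ;; .instr (.store 18 57 61)) .skip)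
        .skip)

/-- Add the edge whose ends are at addresses `p` and `p + 1` of the input, for `p` in
register `50`. -/
def edgeOp : Program :=
  (.instr (.add 52 50 1) ;; .instr (.load 51 0 50) ;; .instr (.load 52 0 52) ;;
    .instr (.load 51 11 51) ;; .instr (.load 52 11 52) ;; .instr (.sub 51 51 1) ;;
    .instr (.sub 52 52 1) ;; .instr (.load 53 9 51) ;; .instr (.load 54 9 52) ;;
    .instr (.mul 55 51 10) ;; .instr (.mul 56 52 10) ;; .instr (.const 57 0)) ;;
    forUp 57 9 edgeCell

theorem run_edgeOp {i j : ℕ} (hW : WordSize K w) (hE : TEnv K σ) (hi : i < K) (hj : j < K)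
    (hu : σ.arr 11 (σ.arr 0 (σ.reg 50)) = i + 1) (hv : σ.arr 11 (σ.arr 0 (σ.reg 50 + 1)) = j + 1) :
    Run w edgeOp σ (3 ^ K * 12 + 13) (fun τ =>
      ∀ c < 3 ^ K, τ.arr 18 c = σ.arr 18 (edgeIdx i j c)) := by
  have hw1 := hW.one_lt
  have hM := hW.M_lt
  have hQ := hW.Q_lt
  have hK := hW.K_lt
  have o1 := hW.off_lt (s := i) (by omega)
  have o2 := hW.off_lt (s := j) (by omega)
  have p1 := hW.pow_lt hi.le
  have p2 := hW.pow_lt hj.le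
  have hMQ : 3 ^ K ≤ (2 * K + 1) * 3 ^ K := Nat.le_mul_of_pos_left _ (by omega)
  refine Run.wp_seq (B₂ := 3 ^ K * 12 + 1)
    (Q := fun τ => ∀ c < 3 ^ K, τ.arr 18 c = σ.arr 18 (edgeIdx i j c)) ?_
    (by simp [Program.cost]; omega)
  simp only [Program.wp, Instr.wp]
  simp only [State.setReg_reg, State.setReg_arr, Nat.reduceEqDiff, OfNat.one_ne_ofNat, if_true, if_false, hE.one, hE.Q, hu, hv,
    Nat.add_sub_cancel, hE.pw i hi, hE.pw j hj]
  refine ⟨hw1, hw1, hw1, ⟨by omega, hQ, o1⟩, ⟨by omega, hQ, o2⟩, by omega, ?_⟩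
  refine Run.mono (Run.forUp (a := 0) (b := 3 ^ K) (B := 10) (fun c τ => ∀ c' < 3 ^ K,
    τ.arr 18 c' = if c' < c then σ.arr 18 (edgeIdx i j c') else σ.arr 18 c')
    (by simp) (by simp [hE.M]) (by simp [hE.one]) (Nat.zero_le _) hw1 rfl rfl rfl ?_ ?_) (by simp)
    (fun τ h _ c hc => by rw [h.2 c hc, if_pos hc])
  · simp
  · rintro c τ - hc hτ hF hI
    have e1 : τ.reg 53 = 3 ^ i := (hF.reg 53 rfl).trans (by simp)
    have e2 : τ.reg 54 = 3 ^ j := (hF.reg 54 rfl).trans (by simp)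
    have e3 : τ.reg 55 = i * ((2 * K + 1) * 3 ^ K) := (hF.reg 55 rfl).trans (by simp)
    have e4 : τ.reg 56 = j * ((2 * K + 1) * 3 ^ K) := (hF.reg 56 rfl).trans (by simp)
    have e5 : τ.reg 4 = 0 := (hF.reg 4 rfl).trans (by simp [hE.zero])
    have e6 : τ.reg 2 = 2 := (hF.reg 2 rfl).trans (by simp [hE.two])
    have e7 : τ.arr 8 (i * ((2 * K + 1) * 3 ^ K) + c) = dg i c := by
      rw [hF.arr 8 rfl]; exact hE.dig i hi c (by omega)
    have e8 : τ.arr 8 (j * ((2 * K + 1) * 3 ^ K) + c) = dg j c := by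
      rw [hF.arr 8 rfl]; exact hE.dig j hj c (by omega)
    have hle := edgeIdx_le i j c
    -- Updated or not, the cell read holds its old value, since its index is fixed by `edgeIdx`.
    have e9 : τ.arr 18 (edgeIdx i j c) = σ.arr 18 (edgeIdx i j c) := by
      rw [hI _ (by omega), edgeIdx_edgeIdx]; simp
    have key : ∀ v, v = σ.arr 18 (edgeIdx i j c) → ∀ c' < 3 ^ K,
        Function.update (τ.arr 18) c v c' =
          if c' < c + 1 then σ.arr 18 (edgeIdx i j c') else σ.arr 18 c' := by
      rintro v rfl c' hc'
      by_cases h : c' = c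
      · subst h; rw [Function.update_self, if_pos (Nat.lt_succ_self _)]
      · rw [Function.update_of_ne h, hI c' hc']
        have : c' < c + 1 ↔ c' < c := by omega
        simp [this]
    have key' : edgeIdx i j c = c → ∀ c' < 3 ^ K,
        τ.arr 18 c' = if c' < c + 1 then σ.arr 18 (edgeIdx i j c') else σ.arr 18 c' := by
      intro h c' hc'
      rw [← key (τ.arr 18 c) (by rw [← e9, h]) c' hc', Function.update_eq_self]
    refine Run.of_wp (by decide) ?_
    simp only [edgeCell, Program.wp, Instr.wp, Test.Holds]
    simp only [State.setReg_reg, State.setReg_arr, State.setArr_arr, State.setArr_reg,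
      Nat.reduceEqDiff, if_true, if_false, hτ, e1, e2, e3, e4, e5, e6, e7, e8]
    refine ⟨by omega, by omega, fun h1 => ⟨fun h2 => ⟨p2, ?_⟩, fun h2 => ?_⟩,
      fun h1 => ⟨fun h2 => ⟨fun h3 => ⟨p1, ?_⟩, fun h3 => ?_⟩, fun h2 => ?_⟩⟩
    · have he : edgeIdx i j c = c - 3 ^ j := by simp [edgeIdx, h1, h2]
      exact key _ (by rw [← e9, he])
    · exact key' (by simp [edgeIdx, h1, h2])
    · have he : edgeIdx i j c = c - 3 ^ i := by simp [edgeIdx, h2, h3]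
      exact key _ (by rw [← e9, he])
    · exact key' (by simp [edgeIdx, h1, h3])
    · exact key' (by simp [edgeIdx, h1, h2])

/-! ## Forgetting a vertex -/

def forgetCell : Program :=
  .instr (.add 58 55 57) ;; .instr (.load 58 8 58) ;; .instr (.sub 59 2 58) ;;
    .instr (.mul 59 59 53) ;; .instr (.add 59 57 59) ;; .instr (.load 60 18 59) ;;
    .ite (.eq 58 2) (.instr (.add 60 60 1)) .skip ;; .instr (.sub 60 60 54) ;;
    .instr (.store 18 57 60)

/-- Forget the vertex whose slot plus one is in register `51`. -/
def forgetOp : Program :=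
  (.instr (.sub 51 51 1) ;; .instr (.load 53 9 51) ;; .instr (.mul 55 51 10) ;;
    .instr (.add 54 53 53) ;; .instr (.load 54 18 54) ;; .instr (.add 0 0 54) ;;
    .instr (.const 57 0)) ;;
    forUp 57 9 forgetCell

/-- The index `3 ^ s + 3 ^ s` is code 0 with its digit at `s` raised to 2. Its entry is the new
value at code 0, which is subtracted from the whole table and added to the answer, so that code 0
keeps the entry 0. -/
theorem run_forgetOp {s : ℕ} (hW : WordSize K w) (hE : TEnv K σ) (hs : s < K)
    (h51 : σ.reg 51 = s + 1) (hA : ∀ c < 3 ^ K, σ.arr 18 c < 2 ^ w) :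
    Run w forgetOp σ (3 ^ K * 12 + 8) (fun τ =>
      (∀ c < 3 ^ K, τ.arr 18 c = σ.arr 18 (c + (2 - dg s c) * 3 ^ s) +
        (if dg s c = 2 then 1 else 0) - σ.arr 18 (3 ^ s + 3 ^ s)) ∧
      τ.reg 0 = σ.reg 0 + σ.arr 18 (3 ^ s + 3 ^ s)) := by
  have hw1 := hW.one_lt
  have hM := hW.M_lt
  have hQ := hW.Q_lt
  have hK := hW.K_lt
  have o1 := hW.off_lt (s := s) (by omega)
  have p1 := hW.pow_lt hs.le
  have hMQ : 3 ^ K ≤ (2 * K + 1) * 3 ^ K := Nat.le_mul_of_pos_left _ (by omega)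
  have h2s : 3 ^ s + 3 ^ s < 3 ^ K := by
    have := raise_lt hs (c := 0) (by positivity)
    simp at this; omega
  have hδ := hA _ h2s
  refine Run.wp_seq (B₂ := 3 ^ K * 12 + 1) ?_ (by simp [Program.cost]; omega)
  simp only [Program.wp, Instr.wp]
  simp only [State.setReg_reg, State.setReg_arr, Nat.reduceEqDiff, OfNat.one_ne_ofNat,
    OfNat.zero_ne_ofNat, OfNat.ofNat_ne_zero, if_true, if_false, hE.one, hE.Q, h51,
    Nat.add_sub_cancel, hE.pw s hs]
  refine ⟨hw1, ⟨by omega, hQ, o1⟩, p1, hδ, by omega, ?_⟩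
  refine Run.mono (Run.forUp (a := 0) (b := 3 ^ K) (B := 10) (fun c τ => ∀ c' < 3 ^ K,
    τ.arr 18 c' = if c' < c then σ.arr 18 (c' + (2 - dg s c') * 3 ^ s) +
        (if dg s c' = 2 then 1 else 0) - σ.arr 18 (3 ^ s + 3 ^ s) else σ.arr 18 c')
    (by simp) (by simp [hE.M]) (by simp [hE.one]) (Nat.zero_le _) hw1 rfl rfl rfl ?_ ?_) (by simp)
    (fun τ h hF => ⟨fun c hc => by rw [h.2 c hc, if_pos hc], (hF.reg 0 rfl).trans (by simp)⟩)
  · simp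
  · rintro c τ - hc hτ hF hI
    have e1 : τ.reg 53 = 3 ^ s := (hF.reg 53 rfl).trans (by simp)
    have e2 : τ.reg 54 = σ.arr 18 (3 ^ s + 3 ^ s) := (hF.reg 54 rfl).trans (by simp)
    have e3 : τ.reg 55 = s * ((2 * K + 1) * 3 ^ K) := (hF.reg 55 rfl).trans (by simp)
    have e5 : τ.reg 1 = 1 := (hF.reg 1 rfl).trans (by simp [hE.one])
    have e6 : τ.reg 2 = 2 := (hF.reg 2 rfl).trans (by simp [hE.two])
    have e7 : τ.arr 8 (s * ((2 * K + 1) * 3 ^ K) + c) = dg s c := by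
      rw [hF.arr 8 rfl]; exact hE.dig s hs c (by omega)
    have hd := dg_lt s c
    have hr := raise_lt hs hc
    -- The raised index is at least `c`, so its cell has not been overwritten yet.
    have e9 : τ.arr 18 (c + (2 - dg s c) * 3 ^ s) = σ.arr 18 (c + (2 - dg s c) * 3 ^ s) := by
      rw [hI _ hr, if_neg (by omega)]
    have key : ∀ v, v = σ.arr 18 (c + (2 - dg s c) * 3 ^ s) +
        (if dg s c = 2 then 1 else 0) - σ.arr 18 (3 ^ s + 3 ^ s) → ∀ c' < 3 ^ K,
        Function.update (τ.arr 18) c v c' =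
          if c' < c + 1 then σ.arr 18 (c' + (2 - dg s c') * 3 ^ s) +
        (if dg s c' = 2 then 1 else 0) - σ.arr 18 (3 ^ s + 3 ^ s) else σ.arr 18 c' := by
      rintro v rfl c' hc'
      by_cases h : c' = c
      · subst h; rw [Function.update_self, if_pos (Nat.lt_succ_self _)]
      · rw [Function.update_of_ne h, hI c' hc']
        have : c' < c + 1 ↔ c' < c := by omega
        simp [this]
    refine Run.of_wp (by decide) ?_
    simp only [forgetCell, Program.wp, Instr.wp, Test.Holds]
    simp only [State.setReg_reg, State.setReg_arr, State.setArr_arr, State.setArr_reg,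
      Nat.reduceEqDiff, OfNat.ofNat_ne_zero, OfNat.zero_ne_ofNat, OfNat.one_ne_ofNat,
      OfNat.ofNat_ne_one, if_true, if_false, hτ, e1, e2, e3, e5, e6, e7, e9]
    have := hW.three
    refine ⟨by omega, by omega, ⟨by omega, by omega, by omega⟩, by omega,
      fun h => ⟨hw1, hδ, ?_⟩, fun h => ⟨hδ, ?_⟩⟩
    · exact key _ (by simp [h])
    · exact key _ (by simp [h])

/-! ## Moving tables -/

/-- Copy the table at address register `48` of array `16` to array `dst`. -/
def loadTable (dst : ℕ) : Program :=
  (.instr (.const 57 0) ;; .instr (.copy 58 48)) ;;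
    forUp 57 9 (.instr (.load 59 16 58) ;; .instr (.store dst 57 59) ;; .instr (.add 58 58 1))

/-- Copy the table in array `src` to address register `48` of array `16`. -/
def storeTable (src : ℕ) : Program :=
  (.instr (.const 57 0) ;; .instr (.copy 58 48)) ;;
    forUp 57 9 (.instr (.load 59 src 57) ;; .instr (.store 16 58 59) ;; .instr (.add 58 58 1))

theorem run_loadTable {dst : ℕ} (hd : dst ≠ 16) (hW : WordSize K w) (hE : TEnv K σ) :
    Run w (loadTable dst) σ (3 ^ K * 5 + 3) (fun τ =>
      ∀ c < 3 ^ K, τ.arr dst c = σ.arr 16 (σ.reg 48 + c)) := by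
  have hw1 := hW.one_lt
  refine Run.wp_seq (B₂ := 3 ^ K * 5 + 1) ?_ (by simp [Program.cost]; omega)
  simp only [Program.wp, Instr.wp]
  refine ⟨by omega, ?_⟩
  refine Run.mono (Run.forUp (a := 0) (b := 3 ^ K) (B := 3) (fun c τ => τ.reg 58 = σ.reg 48 + c ∧
    ∀ c' < c, τ.arr dst c' = σ.arr 16 (σ.reg 48 + c'))
    (by simp) (by simp [hE.M]) (by simp [hE.one]) (Nat.zero_le _) hw1 rfl rfl rfl ?_ ?_) (by simp)
    (fun τ h _ => h.2.2)
  · simp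
  · rintro c τ - hc hτ hF ⟨h58, hI⟩
    have e1 : τ.reg 1 = 1 := (hF.reg 1 rfl).trans (by simp [hE.one])
    have e16 : τ.arr 16 = σ.arr 16 := hF.arr 16 (by simp [RAM.forUp, Program.wa, Instr.wa]; omega)
    refine Run.of_wp (by simp [Program.cost]) ?_
    simp only [Program.wp, Instr.wp]
    simp [h58, e1, e16, hτ, hW.ne_zero]
    refine ⟨by ring, fun c' hc' => ?_⟩
    by_cases h : c' = c
    · subst h; simp
    · rw [Function.update_of_ne h]; exact hI c' (by omega)

theorem run_storeTable {src : ℕ} (hd : src ≠ 16) (hW : WordSize K w) (hE : TEnv K σ) :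
    Run w (storeTable src) σ (3 ^ K * 5 + 3) (fun τ => ∀ x, τ.arr 16 x =
      if σ.reg 48 ≤ x ∧ x < σ.reg 48 + 3 ^ K then σ.arr src (x - σ.reg 48) else σ.arr 16 x) := by
  have hw1 := hW.one_lt
  refine Run.wp_seq (B₂ := 3 ^ K * 5 + 1)
    (Q := fun τ => ∀ x, τ.arr 16 x =
      if σ.reg 48 ≤ x ∧ x < σ.reg 48 + 3 ^ K then σ.arr src (x - σ.reg 48) else σ.arr 16 x)
    ?_ (by simp [Program.cost]; omega)
  simp only [Program.wp, Instr.wp]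
  refine ⟨by omega, ?_⟩
  refine Run.mono (Run.forUp (a := 0) (b := 3 ^ K) (B := 3) (fun c τ => τ.reg 58 = σ.reg 48 + c ∧
    ∀ x, τ.arr 16 x =
      if σ.reg 48 ≤ x ∧ x < σ.reg 48 + c then σ.arr src (x - σ.reg 48) else σ.arr 16 x)
    (by simp) (by simp [hE.M]) (by simp [hE.one]) (Nat.zero_le _) hw1 rfl rfl rfl ?_ ?_) (by simp)
    (fun τ h _ => h.2.2)
  · refine ⟨by simp, fun x => ?_⟩
    rw [if_neg (by omega)]; rfl
  · rintro c τ - hc hτ hF ⟨h58, hI⟩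
    have e1 : τ.reg 1 = 1 := (hF.reg 1 rfl).trans (by simp [hE.one])
    have esrc : τ.arr src = σ.arr src := hF.arr src (by simp [RAM.forUp, Program.wa, Instr.wa]; omega)
    refine Run.of_wp (by simp [Program.cost]) ?_
    simp only [Program.wp, Instr.wp]
    simp [h58, e1, esrc, hτ, hW.ne_zero]
    refine ⟨by ring, fun x => ?_⟩
    by_cases h : x = σ.reg 48 + c
    · subst h; simp
    · rw [Function.update_of_ne h, hI x]
      have : σ.reg 48 ≤ x ∧ x < σ.reg 48 + (c + 1) ↔ σ.reg 48 ≤ x ∧ x < σ.reg 48 + c := by omega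
      simp [this]

end

/-! ### Dynamic programming over the rooted decomposition -/

section

/-! ## Tables of partial graphs -/

/-- The table `A` with offset `o` holds the costs of a partial graph. -/
def Tab (K : ℕ) (slot : ℕ → ℕ) (W : Set ℕ) (E E' : ℕ → ℕ → Prop) (A : ℕ → ℕ) (o : ℕ) : Prop :=
  ∀ c < 3 ^ K, ∀ m, Val K slot W E E' c m ↔ A c + o ≤ m

variable {K : ℕ} {slot : ℕ → ℕ} {W W₁ W₂ : Set ℕ} {E E' E₁ E₂ : ℕ → ℕ → Prop} {A A₁ A₂ : ℕ → ℕ}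
  {o o₁ o₂ : ℕ}

theorem Tab.congr (h : Tab K slot W E E' A o) (hA : ∀ c < 3 ^ K, A₁ c = A c) :
    Tab K slot W E E' A₁ o := fun c hc m => by rw [hA c hc]; exact h c hc m

theorem tab_init : Tab K slot ∅ noEdge noEdge (cnt K) 0 := fun _ _ _ => val_init

/-- For a table normalised to 0 at code 0, the offset is the cost of code 0, and paying for all
slots adds at most `K`. This bounds the number of cost layers in a join. -/
theorem Tab.le (h : Tab K slot W E noEdge A o) (h0 : A 0 = 0)
    (hs : ∀ v u, E v u → u ∉ W → slot u < K) {c : ℕ} (hc : c < 3 ^ K) : A c ≤ K := by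
  have h1 := (h 0 (by positivity) o).2 (by omega)
  have h2 := (h c hc _).1 (Val.of_zero hs h1)
  omega

theorem Tab.edge (h : Tab K slot W E E' A o) {u v : ℕ}
    (hE : ∀ x y, E₂ x y ↔ E' x y ∨ (x = u ∧ y = v) ∨ (x = v ∧ y = u)) :
    Tab K slot W E E₂ (fun c => A (edgeIdx (slot u) (slot v) c)) o := by
  intro c hc m
  rw [val_edge rfl rfl hE (fun t => dg_edgeIdx t)]
  exact h _ (lt_of_le_of_lt (edgeIdx_le _ _ _) hc) m

theorem Tab.close (h : Tab K slot W E E' A o) (hE' : ∀ u v, E' u v → u ∉ W ∧ v ∉ W)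
    (hE : ∀ u v, E₂ u v ↔ E u v ∨ E' u v) : Tab K slot W E₂ noEdge (closeF A K) o := by
  intro c hc m
  rw [val_close hc hE' hE]
  constructor
  · rintro ⟨c', hc', P, hP, h1, m', h2, h3⟩
    have h4 := (h c' hc' m').1 h2
    have := (closeF_le A K (m := A c' + P.card) hc).2 ⟨c', hc', P, hP, h1, le_rfl⟩
    omega
  · intro hm
    obtain ⟨c', hc', P, hP, h1, h2⟩ := (closeF_le A K (m := m - o) hc).1 (by omega)
    exact ⟨c', hc', P, hP, h1, A c' + o, (h c' hc' _).2 le_rfl, by omega⟩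

theorem closeF_zero (A : ℕ → ℕ) (h : A 0 = 0) (s : ℕ) : closeF A s 0 = 0 := by
  induction s with
  | zero => exact h
  | succ s ih => simp [closeF, ih]

theorem Tab.forget (h : Tab K slot W E noEdge A o) {v s : ℕ} (hv : v ∉ W) (hs : slot v = s)
    (hsK : s < K) (huniq : ∀ x y, E x y → y ∉ W → slot y = s → y = v)
    (hsym : ∀ x y, E x y → E y x) :
    Tab K slot (insert v W) E noEdge (fun c => A (c + (2 - dg s c) * 3 ^ s) +
      (if dg s c = 2 then 1 else 0) - A (3 ^ s + 3 ^ s)) (o + A (3 ^ s + 3 ^ s)) := by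
  have key : ∀ c < 3 ^ K, ∀ m, Val K slot (insert v W) E noEdge c m ↔
      A (c + (2 - dg s c) * 3 ^ s) + (if dg s c = 2 then 1 else 0) + o ≤ m := by
    intro c hc m
    rw [val_forget hv hs hsK huniq hsym (fun t => dg_raise s c t)]
    constructor
    · rintro ⟨m', h1, h2⟩
      have := (h _ (raise_lt hsK hc) m').1 h1
      omega
    · intro hm
      exact ⟨_, (h _ (raise_lt hsK hc) _).2 le_rfl, by omega⟩
  intro c hc m
  -- Code 0 is the cheapest in the new table, so subtracting its entry is never truncated.
  have h1 := (key c hc _).2 le_rfl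
  have h2 := (key 0 (by positivity) _).1 h1.to_zero
  have e : 0 + (2 - dg s 0) * 3 ^ s = 3 ^ s + 3 ^ s := by simp; ring
  rw [e] at h2
  simp only [dg_zero] at h2
  rw [key c hc]
  simp only [OfNat.zero_ne_ofNat, if_false] at h2 ⊢
  omega

theorem Tab.join (h₁ : Tab K slot W₁ E₁ noEdge A₁ o₁) (h₂ : Tab K slot W₂ E₂ noEdge A₂ o₂)
    (hE₁ : ∀ u v, E₁ u v → u ∉ W₂ ∧ v ∉ W₂) (hE₂ : ∀ u v, E₂ u v → u ∉ W₁ ∧ v ∉ W₁)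
    (hW : ∀ v ∈ W₁, v ∉ W₂) (hE : ∀ u v, E u v ↔ E₁ u v ∨ E₂ u v)
    (hA : ∀ c < 3 ^ K, ∀ m, A c ≤ m ↔
      ∃ c' < 3 ^ K, ∃ P ⊆ Finset.range K, (∀ t, dg t c' = if t ∈ P then 0 else dg t c) ∧
        ∃ a < 3 ^ K, ∃ b < 3 ^ K, (∀ t < K, cov (dg t a) (dg t b) (dg t c')) ∧
          A₁ a + A₂ b + P.card ≤ m) :
    Tab K slot (W₁ ∪ W₂) E noEdge A (o₁ + o₂) := by
  intro c hc m
  rw [val_join hc hE₁ hE₂ hW hE]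
  constructor
  · rintro ⟨c', hc', P, hP, h3, a, ha, b, hb, hcov, m₁, m₂, h4, h5, h6⟩
    have := (h₁ a ha m₁).1 h4
    have := (h₂ b hb m₂).1 h5
    have := (hA c hc (A₁ a + A₂ b + P.card)).2 ⟨c', hc', P, hP, h3, a, ha, b, hb, hcov, le_rfl⟩
    omega
  · intro hm
    obtain ⟨c', hc', P, hP, h3, a, ha, b, hb, hcov, h4⟩ := (hA c hc (m - (o₁ + o₂))).1 (by omega)
    exact ⟨c', hc', P, hP, h3, a, ha, b, hb, hcov, A₁ a + o₁, A₂ b + o₂, (h₁ a ha _).2 le_rfl,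
      (h₂ b hb _).2 le_rfl, by omega⟩

/-! ## Rooted tree decompositions with slots -/

/-- A rooted tree decomposition of a graph with vertices below `n`: nodes below `N`, parents before
their children, the first node `top v` that contains `v`, and a slot for every vertex. -/
structure Rooted (n N K : ℕ) where
  Adj : ℕ → ℕ → Prop
  bag : ℕ → List ℕ
  par : ℕ → ℕ
  top : ℕ → ℕ
  slot : ℕ → ℕ
  el : ℕ → List (ℕ × ℕ)
  symm : ∀ u v, Adj u v → Adj v u
  bag_lt : ∀ x < N, ∀ v ∈ bag x, v < n
  bag_len : ∀ x < N, (bag x).length ≤ K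
  bag_nodup : ∀ x < N, (bag x).Nodup
  top_lt : ∀ v < n, top v < N
  top_mem : ∀ v < n, v ∈ bag (top v)
  top_le : ∀ x < N, ∀ v ∈ bag x, top v ≤ x
  par_lt : ∀ x < N, 0 < x → par x < x
  par_mem : ∀ x < N, ∀ v ∈ bag x, top v < x → v ∈ bag (par x)
  slot_lt : ∀ v < n, slot v < K
  slot_inj : ∀ x < N, ∀ u ∈ bag x, ∀ v ∈ bag x, slot u = slot v → u = v
  adj_bag : ∀ u v, Adj u v → ∃ x < N, u ∈ bag x ∧ v ∈ bag x
  mem_el : ∀ x < N, ∀ u v, (Adj u v ∧ max (top u) (top v) = x) ↔ ((u, v) ∈ el x ∨ (v, u) ∈ el x)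
  el_len : ∀ x < N, (el x).length ≤ K * K

variable {n N : ℕ} (D : Rooted n N K)

/-- Climb from any bag with both ends: neither end leaves the bag before its top is reached, so both
are still present at the later top. -/
theorem Rooted.adj_max {u v : ℕ} (h : D.Adj u v) :
    max (D.top u) (D.top v) < N ∧ u ∈ D.bag (max (D.top u) (D.top v)) ∧
      v ∈ D.bag (max (D.top u) (D.top v)) := by
  obtain ⟨x, hx, hu, hv⟩ := D.adj_bag u v h
  induction x using Nat.strong_induction_on with
  | _ x ih =>
    have h1 := D.top_le x hx u hu
    have h2 := D.top_le x hx v hv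
    rcases (max_le h1 h2).lt_or_eq with hlt | heq
    · have := D.par_lt x hx (by omega)
      exact ih _ this (by omega) (D.par_mem x hx u hu (by omega)) (D.par_mem x hx v hv (by omega))
    · rw [heq]; exact ⟨hx, hu, hv⟩

/-- The nodes from `t` on are merged into the nodes `rep z` below `t`. -/
structure Rooted.Merged (t : ℕ) (rep : ℕ → ℕ) : Prop where
  rep_lt : ∀ z < N, rep z < t
  rep_self : ∀ z < t, rep z = z
  mem_rep : ∀ z < N, ∀ v ∈ D.bag z, D.top v < t → v ∈ D.bag (rep z)
  rep_top : ∀ z < N, ∀ v ∈ D.bag z, t ≤ D.top v → rep (D.top v) = rep z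

/-- The finished vertices of node `y`. -/
def Rooted.fin (t : ℕ) (rep : ℕ → ℕ) (y : ℕ) : Set ℕ :=
  {v | v < n ∧ t ≤ D.top v ∧ rep (D.top v) = y}

/-- The edges that have been added at node `y`. -/
def Rooted.edg (t : ℕ) (rep : ℕ → ℕ) (y u v : ℕ) : Prop :=
  D.Adj u v ∧ t ≤ max (D.top u) (D.top v) ∧ rep (max (D.top u) (D.top v)) = y

variable {D} {t x : ℕ} {rep : ℕ → ℕ}

theorem Rooted.Merged.start : D.Merged N id where
  rep_lt z hz := hz
  rep_self _ _ := rfl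
  mem_rep _ _ _ h _ := h
  rep_top z hz v hv h := by
    have := D.top_le z hz v hv
    omega

/-- The class of `x` is absorbed by the parent of `x`. An unfinished vertex of the bag of `x` passes
to the parent's bag, and a vertex with top `x` occurs only in nodes represented by `x`. -/
theorem Rooted.Merged.step (hx : x < N) (hx0 : 0 < x) (h : D.Merged (x + 1) rep) :
    D.Merged x (fun z => if rep z = x then D.par x else rep z) := by
  have hp := D.par_lt x hx hx0
  constructor
  · intro z hz
    have := h.rep_lt z hz
    split_ifs <;> omega
  · intro z hz
    have := h.rep_self z (by omega)
    rw [this, if_neg (by omega)]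
  · intro z hz v hv hvx
    have h1 := h.mem_rep z hz v hv (by omega)
    split_ifs with hr
    · rw [hr] at h1
      exact D.par_mem x hx v h1 hvx
    · exact h1
  · intro z hz v hv hvx
    have : rep (D.top v) = rep z := by
      rcases hvx.lt_or_eq with hlt | heq
      · exact h.rep_top z hz v hv hlt
      -- The vertex lies in the bag of `rep z`, which therefore is not before its top `x`; and `rep
      -- z` is not after `x` either.
      · rw [← heq, h.rep_self x (by omega)]
        have h1 := h.mem_rep z hz v hv (by omega)
        have h2 := h.rep_lt z hz
        have h3 := D.top_le _ (by omega) v h1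
        omega
    rw [this]

/-- This keeps the partial graphs apart: an unfinished end lies in the bag of `y`, where slots are
unambiguous, and a finished end belongs to `y` alone. -/
theorem Rooted.Merged.edg_mem (h : D.Merged t rep) {y u v : ℕ} (he : D.edg t rep y u v) :
    v < n ∧ (D.top v < t → v ∈ D.bag y) ∧ (t ≤ D.top v → v ∈ D.fin t rep y) := by
  obtain ⟨h1, h2, h3⟩ := he
  obtain ⟨hN, -, hv⟩ := D.adj_max h1
  have hn := D.bag_lt _ hN v hv
  refine ⟨hn, fun h4 => ?_, fun h4 => ⟨hn, h4, ?_⟩⟩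
  · rw [← h3]; exact h.mem_rep _ hN v hv h4
  · rw [← h3]; exact h.rep_top _ hN v hv h4

theorem Rooted.edg_symm {y u v : ℕ} (h : D.edg t rep y u v) : D.edg t rep y v u := by
  obtain ⟨h1, h2, h3⟩ := h
  exact ⟨D.symm _ _ h1, by rwa [max_comm], by rwa [max_comm]⟩

end

section

/-! ## Processing a node -/

def edgeLoop : Program := .while (.lt 4 50) (edgeOp ;; .instr (.load 50 15 50))

def forgetStep : Program :=
  (.instr (.add 51 49 1) ;; .instr (.load 51 0 51) ;; .instr (.load 52 12 51) ;;
    .instr (.load 51 11 51)) ;; .ite (.eq 52 45) forgetOp .skip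

/-- Add the edges of the node in register `45`, and forget the vertices that end there; the table
is left in array `18`. -/
def procNode : Program :=
  (.instr (.load 46 5 45) ;; .instr (.load 46 4 46) ;; .instr (.load 48 17 45)) ;;
    loadTable 18 ;; .instr (.load 50 14 45) ;; edgeLoop ;; closeAll ;;
    (.instr (.load 47 0 46) ;; .instr (.add 47 46 47) ;; .instr (.copy 49 46)) ;;
    forUp 49 47 forgetStep

/-- The memory holds the rooted tree decomposition `D`. -/
structure MEnv {n N K : ℕ} (D : Rooted n N K) (pl : ℕ → List ℕ) (σ : State) : Prop where
  T : TEnv K σ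
  num : σ.reg 6 = N
  len : ∀ x < N, σ.arr 0 (σ.arr 4 (σ.arr 5 x)) = (D.bag x).length
  bag : ∀ x < N, ∀ i (h : i < (D.bag x).length),
    σ.arr 0 (σ.arr 4 (σ.arr 5 x) + 1 + i) = (D.bag x)[i]
  par : ∀ x < N, 0 < x → σ.arr 7 x = D.par x
  slot : ∀ v < n, σ.arr 11 v = D.slot v + 1
  top : ∀ v < n, σ.arr 12 v = D.top v
  chn : ∀ x < N, Chn (σ.arr 15) (σ.arr 14 x) (pl x)
  el : ∀ x < N, D.el x = (pl x).map fun p => (σ.arr 0 p, σ.arr 0 (p + 1))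
  base : ∀ x < N, σ.arr 17 x = x * 3 ^ K

variable {n N K w x : ℕ} {D : Rooted n N K} {pl : ℕ → List ℕ} {σ τ : State} {rep : ℕ → ℕ} {o : ℕ}

theorem MEnv.fr {P : Program} (h : MEnv D pl σ) (hF : Fr P σ τ)
    (hr : ∀ r < 12, r ≠ 0 → P.wr r = false) (ha : ∀ a < 18, a ≠ 16 → P.wa a = false) :
    MEnv D pl τ := by
  have e0 := hF.arr 0 (ha _ (by norm_num) (by norm_num))
  have e4 := hF.arr 4 (ha _ (by norm_num) (by norm_num))
  have e5 := hF.arr 5 (ha _ (by norm_num) (by norm_num))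
  have e7 := hF.arr 7 (ha _ (by norm_num) (by norm_num))
  have e11 := hF.arr 11 (ha _ (by norm_num) (by norm_num))
  have e12 := hF.arr 12 (ha _ (by norm_num) (by norm_num))
  have e14 := hF.arr 14 (ha _ (by norm_num) (by norm_num))
  have e15 := hF.arr 15 (ha _ (by norm_num) (by norm_num))
  have e17 := hF.arr 17 (ha _ (by norm_num) (by norm_num))
  refine ⟨h.T.fr hF hr (fun a h' => ha a (by omega) (by omega)),
    (hF.reg 6 (hr _ (by norm_num) (by norm_num))).trans h.num, ?_, ?_, ?_, ?_, ?_, ?_, ?_, ?_⟩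
  · rw [e0, e4, e5]; exact h.len
  · rw [e0, e4, e5]; exact h.bag
  · rw [e7]; exact h.par
  · rw [e11]; exact h.slot
  · rw [e12]; exact h.top
  · rw [e14, e15]; exact h.chn
  · rw [e0]; exact h.el
  · rw [e17]; exact h.base

/-- The version for the moment when the edges of `x` have been added but its own vertices are not
forgotten yet. -/
theorem Rooted.Merged.edg_mem' (h : D.Merged (x + 1) rep) {u v : ℕ}
    (he : D.edg x rep x u v) :
    v < n ∧ (D.top v ≤ x → v ∈ D.bag x) ∧ (x + 1 ≤ D.top v → v ∈ D.fin (x + 1) rep x) := by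
  obtain ⟨h1, h2, h3⟩ := he
  rcases h2.lt_or_eq with hlt | heq
  · obtain ⟨a, b, c⟩ := h.edg_mem (y := x) (u := u) (v := v) ⟨h1, hlt, h3⟩
    exact ⟨a, fun h => b (by omega), c⟩
  · obtain ⟨hN, -, hv⟩ := D.adj_max h1
    rw [← heq] at hv hN
    exact ⟨D.bag_lt x hN v hv, fun _ => hv, fun h4 => by
      have := D.top_le x hN v hv
      omega⟩

/-- The edges at the addresses in a list. -/
def edgesAt (inp : ℕ → ℕ) (l : List ℕ) (u v : ℕ) : Prop :=
  ∃ p ∈ l, (u = inp p ∧ v = inp (p + 1)) ∨ (u = inp (p + 1) ∧ v = inp p)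

theorem edgesAt_nil (inp : ℕ → ℕ) : edgesAt inp [] = noEdge := by
  funext u v; simp [edgesAt, noEdge]

theorem MEnv.edgesAt_iff (h : MEnv D pl σ) (hx : x < N) {u v : ℕ} :
    edgesAt (σ.arr 0) (pl x) u v ↔ D.Adj u v ∧ max (D.top u) (D.top v) = x := by
  rw [D.mem_el x hx, h.el x hx]
  simp only [edgesAt, List.mem_map, Prod.mk.injEq]
  constructor
  · rintro ⟨p, hp, ⟨rfl, rfl⟩ | ⟨rfl, rfl⟩⟩
    · exact Or.inl ⟨p, hp, rfl, rfl⟩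
    · exact Or.inr ⟨p, hp, rfl, rfl⟩
  · rintro (⟨p, hp, rfl, rfl⟩ | ⟨p, hp, rfl, rfl⟩)
    · exact ⟨p, hp, Or.inl ⟨rfl, rfl⟩⟩
    · exact ⟨p, hp, Or.inr ⟨rfl, rfl⟩⟩

theorem run_edgeLoop (hW : WordSize K w) (hE : MEnv D pl σ) (hx : x < N) {W : Set ℕ}
    {E : ℕ → ℕ → Prop} (h50 : σ.reg 50 = σ.arr 14 x)
    (hT : Tab K D.slot W E noEdge (σ.arr 18) o) (h0 : σ.arr 18 0 = 0) :
    Run w edgeLoop σ (K * K * (3 ^ K * 12 + 15) + 1) (fun τ =>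
      Tab K D.slot W E (edgesAt (σ.arr 0) (pl x)) (τ.arr 18) o ∧ τ.arr 18 0 = 0) := by
  have hlen : (pl x).length ≤ K * K := by
    have := D.el_len x hx
    rwa [hE.el x hx, List.length_map] at this
  -- The ghost state is the rest of the linked list; the edges of `pre` have been added, but are not
  -- closed yet.
  refine Run.mono (Run.while (ι := List ℕ) (fun l τ => ∃ pre, pl x = pre ++ l ∧
    Chn (σ.arr 15) (τ.reg 50) l ∧ Tab K D.slot W E (edgesAt (σ.arr 0) pre) (τ.arr 18) o ∧
    τ.arr 18 0 = 0) (fun l => l.length * (3 ^ K * 12 + 15)) (pl x) ?_ ?_)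
    (Nat.add_le_add_right (Nat.mul_le_mul_right _ hlen) 1) ?_
  · exact ⟨[], rfl, by rw [h50]; exact hE.chn x hx, by rwa [edgesAt_nil], h0⟩
  · rintro l τ ⟨pre, hl, hC, hT', h0'⟩ hb hF
    have hE' := hE.fr hF (by decide) (by decide)
    have e15 : τ.arr 15 = σ.arr 15 := hF.arr 15 rfl
    have e0 : τ.arr 0 = σ.arr 0 := hF.arr 0 rfl
    have e11 : τ.arr 11 = σ.arr 11 := hF.arr 11 rfl
    simp only [Test.Holds, hE'.T.zero] at hb
    cases l with
    | nil => simp only [Chn] at hC; omega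
    | cons p l =>
      obtain ⟨hp, hp0, hC⟩ := hC
      have hpm : p ∈ pl x := by rw [hl]; simp
      have hadj : D.Adj (σ.arr 0 p) (σ.arr 0 (p + 1)) :=
        ((hE.edgesAt_iff hx).1 ⟨p, hpm, Or.inl ⟨rfl, rfl⟩⟩).1
      obtain ⟨hN, hu, hv⟩ := D.adj_max hadj
      have hun := D.bag_lt _ hN _ hu
      have hvn := D.bag_lt _ hN _ hv
      refine ⟨3 ^ K * 12 + 14, Run.seq (B₂ := 1) (run_edgeOp (i := D.slot (σ.arr 0 p))
        (j := D.slot (σ.arr 0 (p + 1))) hW hE'.T (D.slot_lt _ hun) (D.slot_lt _ hvn) ?_ ?_)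
        (fun υ hυ hF' => Run.instr ?_) (by omega)⟩
      · rw [e11, e0, hp]; exact hE.slot _ hun
      · rw [e11, e0, hp]; exact hE.slot _ hvn
      · have f50 : υ.reg 50 = p := (hF'.reg 50 rfl).trans hp
        have f15 : υ.arr 15 = σ.arr 15 := (hF'.arr 15 rfl).trans e15
        simp only [Instr.wp, f50, f15]
        refine ⟨l, ⟨pre ++ [p], by simp [hl], by simpa using hC, ?_, ?_⟩, ?_⟩
        · refine (hT'.edge (u := σ.arr 0 p) (v := σ.arr 0 (p + 1)) ?_).congr (by simpa using hυ)
          intro a b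
          simp [edgesAt, or_and_right, exists_or]
        · have := hυ 0 (by positivity)
          simp only [State.setReg_arr]
          rw [this, edgeIdx]
          simpa using h0'
        · simp only [List.length_cons]; rw [add_mul]; omega
  · rintro τ ⟨l, ⟨pre, hl, hC, hT', h0'⟩, hb⟩ hF
    have e4 : τ.reg 4 = 0 := (hF.reg 4 rfl).trans hE.T.zero
    simp only [Test.Holds, e4] at hb
    cases l with
    | nil => rw [List.append_nil] at hl; rw [hl]; exact ⟨hT', h0'⟩
    | cons p l => exact absurd hC.2.1 (by have := hC.1; omega)

def forgetCost (K : ℕ) : ℕ := K * (3 ^ K * 12 + 15) + 1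

/-- The finished vertices after the first `i` vertices of the bag have been treated. -/
def Rooted.finUpTo (D : Rooted n N K) (x : ℕ) (rep : ℕ → ℕ) (i : ℕ) : Set ℕ :=
  {v | v ∈ D.fin (x + 1) rep x ∨ (v ∈ (D.bag x).take i ∧ D.top v = x)}

theorem run_forgetLoop (hW : WordSize K w) (hE : MEnv D pl σ) (hx : x < N)
    (hM : D.Merged (x + 1) rep) (h45 : σ.reg 45 = x)
    (h49 : σ.reg 49 = σ.arr 4 (σ.arr 5 x))
    (h47 : σ.reg 47 = σ.arr 4 (σ.arr 5 x) + (D.bag x).length)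
    (hT : Tab K D.slot (D.fin (x + 1) rep x) (D.edg x rep x) noEdge (σ.arr 18) o)
    (h0 : σ.arr 18 0 = 0) :
    Run w (forUp 49 47 forgetStep) σ (forgetCost K) (fun τ => ∃ δ,
      Tab K D.slot (D.fin x rep x) (D.edg x rep x) noEdge (τ.arr 18) (o + δ) ∧ τ.arr 18 0 = 0 ∧
        τ.reg 0 = σ.reg 0 + δ) := by
  have hw1 := hW.one_lt
  have hK := hW.K_lt
  generalize hb : σ.arr 4 (σ.arr 5 x) = b at h49 h47
  refine Run.mono (Run.forUp (a := b) (b := b + (D.bag x).length) (B := 3 ^ K * 12 + 13)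
    (fun j τ => ∃ δ, Tab K D.slot (D.finUpTo x rep (j - b)) (D.edg x rep x) noEdge (τ.arr 18) (o + δ)
      ∧ τ.arr 18 0 = 0 ∧ τ.reg 0 = σ.reg 0 + δ) h49 h47 hE.T.one (by omega) hw1 rfl rfl rfl ?_ ?_)
    ?_ ?_
  · refine ⟨0, ?_, h0, by simp⟩
    have : D.finUpTo x rep (b - b) = D.fin (x + 1) rep x := by
      ext v; simp [Rooted.finUpTo]
    rw [this]; exact hT
  · rintro j τ hbj hj hτ hF ⟨δ, hT', h0', hreg⟩
    obtain ⟨i, rfl⟩ : ∃ i, j = b + i := ⟨j - b, by omega⟩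
    have hi : i < (D.bag x).length := by omega
    have hE' := hE.fr hF (by decide) (by decide)
    have e5 : τ.arr 5 = σ.arr 5 := hF.arr 5 rfl
    have e4 : τ.arr 4 = σ.arr 4 := hF.arr 4 rfl
    have e45 : τ.reg 45 = x := (hF.reg 45 rfl).trans h45
    have hv := hE'.bag x hx i hi
    rw [e4, e5, hb] at hv
    have hvm : (D.bag x)[i] ∈ D.bag x := List.getElem_mem _
    generalize hvv : (D.bag x)[i] = v at hv hvm
    have hvn := D.bag_lt x hx v hvm
    have htake : (D.bag x).take (i + 1) = (D.bag x).take i ++ [v] := by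
      rw [List.take_succ_eq_append_getElem hi, hvv]
    rw [Nat.add_sub_cancel_left] at hT'
    refine Run.wp_seq (B₂ := 3 ^ K * 12 + 9) ?_ (by simp [Program.cost]; omega)
    simp only [Program.wp, Instr.wp]
    simp only [State.setReg_reg, State.setReg_arr, Nat.reduceEqDiff, if_true, if_false, hE'.T.one,
      hτ, add_right_comm b i 1, hv, hE'.top v hvn, hE'.slot v hvn]
    refine ⟨hw1, Run.ite (fun h => ?_) (fun h => ?_)⟩
    · simp only [Test.Holds, State.setReg_reg, Nat.reduceEqDiff, if_true, if_false, e45] at h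
      have hsl : ∀ u v, D.edg x rep x u v → v ∉ D.finUpTo x rep i → D.slot v < K :=
        fun u v huv _ => D.slot_lt v (hM.edg_mem' huv).1
      refine Run.mono (run_forgetOp hW (s := D.slot v) ?_ (D.slot_lt v hvn) (by simp) ?_) le_rfl ?_
      · exact (((hE'.T.setReg (by norm_num) _).setReg (by norm_num) _).setReg (by norm_num) _).setReg
          (by norm_num) _
      · intro c hc
        have := hT'.le h0' hsl hc
        simp only [State.setReg_arr]
        omega
      · rintro υ ⟨h1, h2⟩ hF'
        simp only [State.setReg_arr, State.setReg_reg, Nat.reduceEqDiff, OfNat.zero_ne_ofNat,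
          if_false] at h1 h2 ⊢
        have hnot : v ∉ D.finUpTo x rep i := by
          rintro (h' | h')
          · have := h'.2.1; omega
          · have hnd := (D.bag_nodup x hx).sublist (List.take_sublist (i + 1) (D.bag x))
            rw [htake, List.nodup_append] at hnd
            exact hnd.2.2 v h'.1 v (by simp) rfl
        -- The vertex treated has top `x`, so one more vertex of the bag is finished.
        have hins : D.finUpTo x rep (b + 1 + i - b) = insert v (D.finUpTo x rep i) := by
          rw [show b + 1 + i - b = i + 1 by omega]
          ext u
          simp only [Rooted.finUpTo, htake, Set.mem_ofPred_eq, Set.mem_insert_iff, List.mem_append,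
            List.mem_singleton]
          constructor
          · rintro (h' | ⟨h' | h', h''⟩)
            · exact Or.inr (Or.inl h')
            · exact Or.inr (Or.inr ⟨h', h''⟩)
            · exact Or.inl h'
          · rintro (h' | h' | h')
            · subst h'; exact Or.inr ⟨Or.inr rfl, h⟩
            · exact Or.inl h'
            · exact Or.inr ⟨Or.inl h'.1, h'.2⟩
        -- Unfinished ends of added edges lie in the bag of `x`, and there the slot determines the
        -- vertex.
        have hfor := hT'.forget (v := v) hnot rfl (D.slot_lt v hvn) (fun u z huz hz hs => by
          obtain ⟨k1, k2, k3⟩ := hM.edg_mem' huz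
          have hzx : z ∈ D.bag x := by
            apply k2
            by_contra hlt
            exact hz (Or.inl (k3 (by omega)))
          exact D.slot_inj x hx z hzx v hvm hs) (fun _ _ => Rooted.edg_symm)
        refine ⟨δ + τ.arr 18 (3 ^ D.slot v + 3 ^ D.slot v), ?_, ?_, ?_⟩
        · rw [hins, ← add_assoc]
          exact hfor.congr h1
        · rw [h1 0 (by positivity)]
          simp only [dg_zero, OfNat.zero_ne_ofNat, if_false, Nat.sub_zero, zero_add, add_zero]
          rw [two_mul, Nat.sub_self]
        · rw [h2, hreg, add_assoc]
    · simp only [Test.Holds, State.setReg_reg, Nat.reduceEqDiff, if_true, if_false, e45] at h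
      refine Run.of_wp (by simp [Program.cost]) ?_
      simp only [Program.wp, State.setReg_arr, State.setReg_reg, Nat.reduceEqDiff,
        OfNat.zero_ne_ofNat, if_false]
      refine ⟨δ, ?_, h0', hreg⟩
      convert hT' using 1
      rw [show b + 1 + i - b = i + 1 by omega]
      ext u
      simp only [Rooted.finUpTo, htake, Set.mem_ofPred_eq, List.mem_append, List.mem_singleton]
      constructor
      · rintro (h' | ⟨h' | h', h''⟩)
        · exact Or.inl h'
        · exact Or.inr ⟨h', h''⟩
        · exact absurd (h' ▸ h'') h
      · rintro (h' | h')
        · exact Or.inl h'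
        · exact Or.inr ⟨Or.inl h'.1, h'.2⟩
  · unfold forgetCost
    rw [Nat.add_sub_cancel_left]
    exact Nat.add_le_add_right (Nat.mul_le_mul_right _ (D.bag_len x hx)) 1
  · rintro τ ⟨-, δ, h1, h2⟩ -
    refine ⟨δ, ?_, h2⟩
    convert h1 using 1
    ext v
    rw [Nat.add_sub_cancel_left]
    simp only [Rooted.finUpTo, Rooted.fin, List.take_length, Set.mem_ofPred_eq]
    constructor
    · rintro ⟨k1, k2, k3⟩
      rcases k2.lt_or_eq with hlt | heq
      · exact Or.inl ⟨k1, hlt, k3⟩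
      · exact Or.inr ⟨by rw [heq]; exact D.top_mem v k1, heq.symm⟩
    · rintro (⟨k1, k2, k3⟩ | ⟨k1, k2⟩)
      · exact ⟨k1, by omega, k3⟩
      · exact ⟨D.bag_lt x hx v k1, by omega, by rw [k2]; exact hM.rep_self x (by omega)⟩

def procCost (K : ℕ) : ℕ :=
  3 + (3 ^ K * 5 + 3) + 1 + (K * K * (3 ^ K * 12 + 15) + 1) + closeCost K + 3 + forgetCost K

theorem run_procNode (hW : WordSize K w) (hE : MEnv D pl σ) (hx : x < N)
    (hM : D.Merged (x + 1) rep) (h45 : σ.reg 45 = x)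
    (hT : Tab K D.slot (D.fin (x + 1) rep x) (D.edg (x + 1) rep x) noEdge
      (fun c => σ.arr 16 (x * 3 ^ K + c)) o)
    (h0 : σ.arr 16 (x * 3 ^ K) = 0) :
    Run w procNode σ (procCost K) (fun τ => ∃ δ,
      Tab K D.slot (D.fin x rep x) (D.edg x rep x) noEdge (τ.arr 18) (o + δ) ∧ τ.arr 18 0 = 0 ∧
        τ.reg 0 = σ.reg 0 + δ) := by
  unfold procCost
  generalize hb : σ.arr 4 (σ.arr 5 x) = b
  have hlb := hE.len x hx
  rw [hb] at hlb
  refine Run.seq (B₁ := 3) (B₂ := (3 ^ K * 5 + 3) + 1 + (K * K * (3 ^ K * 12 + 15) + 1) +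
    closeCost K + 3 + forgetCost K) (R := fun τ => τ.reg 46 = b ∧ τ.reg 48 = x * 3 ^ K)
    (Run.of_wp (by decide) ?_) ?_ (by omega)
  · simp [Program.wp, Instr.wp, h45, hb, hE.base x hx]
  rintro τ₁ ⟨h46, h48⟩ F₁
  have E₁ := hE.fr F₁ (by decide) (by decide)
  refine Run.seq (B₂ := 1 + (K * K * (3 ^ K * 12 + 15) + 1) + closeCost K + 3 + forgetCost K)
    (run_loadTable (by norm_num) hW E₁.T) ?_ (by omega)
  intro τ₂ h₂ F₂
  have E₂ := E₁.fr F₂ (by decide) (by decide)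
  rw [h48, F₁.arr 16 rfl] at h₂
  refine Run.seq (B₁ := 1) (B₂ := (K * K * (3 ^ K * 12 + 15) + 1) + closeCost K + 3 + forgetCost K)
    (R := fun τ => τ = τ₂.setReg 50 (τ₂.arr 14 x)) (Run.instr ?_) ?_ (by omega)
  · simp only [Instr.wp]
    rw [F₂.reg 45 rfl, F₁.reg 45 rfl, h45]
  rintro τ₃ rfl F₃
  have E₃ := E₂.fr F₃ (by decide) (by decide)
  refine Run.seq (B₂ := closeCost K + 3 + forgetCost K)
    (run_edgeLoop hW E₃ hx (by simp) (hT.congr h₂) ?_) ?_ (by omega)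
  · have := h₂ 0 (by positivity)
    simpa [h0] using this
  rintro τ₄ ⟨h₄, h₄'⟩ F₄
  have E₄ := E₃.fr F₄ (by decide) (by decide)
  refine Run.seq (B₂ := 3 + forgetCost K) (run_closeAll hW E₄.T) ?_ (by unfold closeCost; omega)
  intro τ₅ h₅ F₅
  have E₅ := E₄.fr F₅ (by decide) (by decide)
  have f46 : τ₅.reg 46 = b := by
    rw [F₅.reg 46 rfl, F₄.reg 46 rfl, F₃.reg 46 rfl, F₂.reg 46 rfl, h46]
  have f45 : τ₅.reg 45 = x := by
    rw [F₅.reg 45 rfl, F₄.reg 45 rfl, F₃.reg 45 rfl, F₂.reg 45 rfl, F₁.reg 45 rfl, h45]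
  have f0 : τ₅.reg 0 = σ.reg 0 := by
    rw [F₅.reg 0 rfl, F₄.reg 0 rfl, F₃.reg 0 rfl, F₂.reg 0 rfl, F₁.reg 0 rfl]
  have fb : τ₅.arr 4 (τ₅.arr 5 x) = b := by
    rw [F₅.arr 4 rfl, F₄.arr 4 rfl, F₃.arr 4 rfl, F₂.arr 4 rfl, F₁.arr 4 rfl,
      F₅.arr 5 rfl, F₄.arr 5 rfl, F₃.arr 5 rfl, F₂.arr 5 rfl, F₁.arr 5 rfl, hb]
  have hlen := E₅.len x hx
  rw [fb] at hlen
  have hlenK := D.bag_len x hx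
  have hK := hW.K_lt
  refine Run.seq (B₁ := 3) (B₂ := forgetCost K)
    (R := fun τ => τ.reg 49 = b ∧ τ.reg 47 = b + (D.bag x).length ∧ τ.reg 0 = σ.reg 0)
    (Run.of_wp (by decide) ?_) ?_ (by omega)
  · simp [Program.wp, Instr.wp, f46, hlen, f0]
    omega
  rintro τ₆ ⟨h49, h47, g0⟩ F₆
  have E₆ := E₅.fr F₆ (by decide) (by decide)
  have fb' : τ₆.arr 4 (τ₆.arr 5 x) = b := by rw [F₆.arr 4 rfl, F₆.arr 5 rfl, fb]
  have e18 : τ₆.arr 18 = τ₅.arr 18 := F₆.arr 18 rfl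
  refine Run.mono (run_forgetLoop hW E₆ hx hM ((F₆.reg 45 rfl).trans f45) (by rw [fb', h49])
    (by rw [fb', h47]) (o := o) ?_ ?_) le_rfl ?_
  · refine (h₄.close ?_ ?_).congr (fun c hc => by rw [e18]; exact h₅ c hc)
    -- The later of the two tops is `x`, so neither end is finished before the vertices of `x` are.
    · intro u v huv
      have := (E₃.edgesAt_iff hx).1 huv
      exact ⟨fun h => by have := h.2.1; omega, fun h => by have := h.2.1; omega⟩
    · intro u v
      rw [E₃.edgesAt_iff hx]
      constructor
      · rintro ⟨k1, k2, k3⟩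
        rcases k2.lt_or_eq with hlt | heq
        · exact Or.inl ⟨k1, hlt, k3⟩
        · exact Or.inr ⟨k1, heq.symm⟩
      · rintro (⟨k1, k2, k3⟩ | ⟨k1, k2⟩)
        · exact ⟨k1, by omega, k3⟩
        · exact ⟨k1, by omega, by rw [k2]; exact hM.rep_self x (by omega)⟩
  · rw [e18, h₅ 0 (by positivity)]
    exact closeF_zero _ h₄' K
  · rintro τ ⟨δ, k1, k2, k3⟩ -
    exact ⟨δ, k1, k2, by rw [k3, g0]⟩

end

section

/-! ## The main loop -/

def mergeNode : Program :=
  .instr (.sub 45 45 1) ;; procNode ;; (.instr (.load 62 7 45) ;; .instr (.load 48 17 62)) ;;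
    loadTable 23 ;; join ;; storeTable 18

/-- Process all nodes, children before parents. -/
def mainLoop : Program :=
  .instr (.copy 45 6) ;; .while (.lt 1 45) mergeNode ;; .instr (.const 45 0) ;; procNode

variable {n N K w t : ℕ} {D : Rooted n N K} {pl : ℕ → List ℕ} {σ τ : State}

/-- The tables of the nodes below `t` are correct. -/
def Tables (D : Rooted n N K) (t : ℕ) (σ : State) : Prop :=
  ∃ (rep off : ℕ → ℕ), D.Merged t rep ∧
    (∀ y < t, Tab K D.slot (D.fin t rep y) (D.edg t rep y) noEdge
      (fun c => σ.arr 16 (y * 3 ^ K + c)) (off y) ∧ σ.arr 16 (y * 3 ^ K) = 0) ∧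
    σ.reg 0 = ∑ y ∈ Finset.range t, off y

def mergeCost (K : ℕ) : ℕ := 1 + procCost K + 2 + (3 ^ K * 5 + 3) + joinCost K + (3 ^ K * 5 + 3)

theorem run_mergeNode {x : ℕ} (hW : WordSize K w) (hE : MEnv D pl σ) (hx : x < N) (hx0 : 0 < x)
    (h45 : σ.reg 45 = x + 1) (hT : Tables D (x + 1) σ) :
    Run w mergeNode σ (mergeCost K) (fun τ => τ.reg 45 = x ∧ Tables D x τ) := by
  have hw1 := hW.one_lt
  obtain ⟨rep, off, hM, htab, hsum⟩ := hT
  obtain ⟨hTx, h0x⟩ := htab x (by omega)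
  have hp := D.par_lt x hx hx0
  obtain ⟨hTp, h0p⟩ := htab (D.par x) (by omega)
  unfold mergeCost
  refine Run.seq (B₁ := 1) (B₂ := procCost K + 2 + (3 ^ K * 5 + 3) + joinCost K + (3 ^ K * 5 + 3))
    (R := fun τ => τ = σ.setReg 45 x) (Run.instr ?_) ?_ (by omega)
  · simp [Instr.wp, hE.T.one, h45, hW.ne_zero]
  rintro τ₁ rfl F₁
  have E₁ := hE.fr F₁ (by decide) (by decide)
  refine Run.seq (B₂ := 2 + (3 ^ K * 5 + 3) + joinCost K + (3 ^ K * 5 + 3))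
    (run_procNode hW E₁ hx hM (by simp) (by simpa using hTx) (by simpa using h0x)) ?_ (by omega)
  rintro τ₂ ⟨δ, h₂, h₂0, h₂r⟩ F₂
  have E₂ := E₁.fr F₂ (by decide) (by decide)
  have f45 : τ₂.reg 45 = x := (F₂.reg 45 rfl).trans (by simp)
  refine Run.seq (B₁ := 2) (B₂ := (3 ^ K * 5 + 3) + joinCost K + (3 ^ K * 5 + 3))
    (R := fun τ => τ.reg 48 = D.par x * 3 ^ K) (Run.of_wp (by decide) ?_) ?_ (by omega)
  · simp [Program.wp, Instr.wp, f45, E₂.par x hx hx0, E₂.base (D.par x) (by omega)]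
  intro τ₃ h48 F₃
  have E₃ := E₂.fr F₃ (by decide) (by decide)
  refine Run.seq (B₂ := joinCost K + (3 ^ K * 5 + 3))
    (run_loadTable (by norm_num) hW E₃.T) ?_ (by omega)
  intro τ₄ h₄ F₄
  have E₄ := E₃.fr F₄ (by decide) (by decide)
  have e16 : τ₃.arr 16 = σ.arr 16 := by rw [F₃.arr 16 rfl, F₂.arr 16 rfl, F₁.arr 16 rfl]
  rw [h48, e16] at h₄
  have e18 : τ₄.arr 18 = τ₂.arr 18 := by rw [F₄.arr 18 rfl, F₃.arr 18 rfl]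
  have hTp' : Tab K D.slot (D.fin (x + 1) rep (D.par x)) (D.edg (x + 1) rep (D.par x)) noEdge
    (τ₄.arr 23) (off (D.par x)) := hTp.congr h₄
  have h23 : τ₄.arr 23 0 = 0 := by
    have := h₄ 0 (by positivity); simpa [h0p] using this
  have hL : ∀ c < 3 ^ K, τ₄.arr 18 c ≤ K := by
    intro c hc
    rw [e18]
    exact h₂.le h₂0 (fun u v huv _ => D.slot_lt v (hM.edg_mem' huv).1) hc
  have hR : ∀ c < 3 ^ K, τ₄.arr 23 c ≤ K := fun c hc =>
    hTp'.le h23 (fun u v huv _ => D.slot_lt v (hM.edg_mem huv).1) hc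
  refine Run.seq (B₂ := 3 ^ K * 5 + 3) (run_join hW E₄.T hL hR) ?_ (by omega)
  intro τ₅ h₅ F₅
  have E₅ := E₄.fr F₅ (by decide) (by decide)
  have g48 : τ₅.reg 48 = D.par x * 3 ^ K := by rw [F₅.reg 48 rfl, F₄.reg 48 rfl, h48]
  have g16 : τ₅.arr 16 = σ.arr 16 := by rw [F₅.arr 16 rfl, F₄.arr 16 rfl, e16]
  have g45 : τ₅.reg 45 = x := by rw [F₅.reg 45 rfl, F₄.reg 45 rfl, F₃.reg 45 rfl, f45]
  have g0 : τ₅.reg 0 = σ.reg 0 + δ := by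
    rw [F₅.reg 0 rfl, F₄.reg 0 rfl, F₃.reg 0 rfl, h₂r]; simp
  have h50 : τ₅.arr 18 0 = 0 := by
    have := (h₅ 0 (by positivity) 0).2 ⟨0, by positivity, ∅, by simp, by simp, 0, by positivity, 0,
      by positivity, fun t _ => Or.inl ⟨rfl, rfl⟩, by simp [h23, e18, h₂0]⟩
    omega
  -- From here on, the parent's new partial graph is identified as the disjoint union of the
  -- processed graph of `x` and the old graph of the parent.
  have hself := hM.rep_self x (by omega)
  have hJ : Tab K D.slot (D.fin x (fun z => if rep z = x then D.par x else rep z) (D.par x))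
      (D.edg x (fun z => if rep z = x then D.par x else rep z) (D.par x)) noEdge (τ₅.arr 18)
      (o := (off x + δ) + off (D.par x)) := by
    have hfin : D.fin x (fun z => if rep z = x then D.par x else rep z) (D.par x) =
        D.fin x rep x ∪ D.fin (x + 1) rep (D.par x) := by
      ext v
      simp only [Rooted.fin, Set.mem_ofPred_eq, Set.mem_union]
      constructor
      · rintro ⟨k1, k2, k3⟩
        split_ifs at k3 with h
        · exact Or.inl ⟨k1, k2, h⟩
        · refine Or.inr ⟨k1, ?_, k3⟩
          rcases k2.lt_or_eq with hlt | heq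
          · exact hlt
          · rw [← heq, hself] at h; exact absurd rfl h
      · rintro (⟨k1, k2, k3⟩ | ⟨k1, k2, k3⟩)
        · exact ⟨k1, k2, by rw [if_pos k3]⟩
        · exact ⟨k1, by omega, by rw [if_neg (by omega)]; exact k3⟩
    rw [hfin]
    refine (h₂.join (A₂ := τ₄.arr 23) hTp' ?_ ?_ ?_ ?_ (by rw [← e18]; exact h₅))
    · have key : ∀ u v, D.edg x rep x u v → v ∉ D.fin (x + 1) rep (D.par x) := by
        rintro u v huv ⟨k1, k2, k3⟩
        have := ((hM.edg_mem' huv).2.2 k2).2.2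
        omega
      exact fun u v huv => ⟨key _ _ (Rooted.edg_symm huv), key _ _ huv⟩
    · have key : ∀ u v, D.edg (x + 1) rep (D.par x) u v → v ∉ D.fin x rep x := by
        rintro u v huv ⟨k1, k2, k3⟩
        rcases k2.lt_or_eq with hlt | heq
        · have := ((hM.edg_mem huv).2.2 hlt).2.2
          omega
        -- A vertex with top `x` cannot lie in the bag of the parent, which comes before `x`.
        · have := (hM.edg_mem huv).2.1 (by omega)
          have := D.top_le _ (by omega) v this
          omega
      exact fun u v huv => ⟨key _ _ (Rooted.edg_symm huv), key _ _ huv⟩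
    · rintro v ⟨k1, k2, k3⟩ ⟨k4, k5, k6⟩
      omega
    · intro u v
      simp only [Rooted.edg]
      constructor
      · rintro ⟨k1, k2, k3⟩
        split_ifs at k3 with h
        · exact Or.inl ⟨k1, k2, h⟩
        · refine Or.inr ⟨k1, ?_, k3⟩
          rcases k2.lt_or_eq with hlt | heq
          · exact hlt
          · rw [← heq, hself] at h; exact absurd rfl h
      · rintro (⟨k1, k2, k3⟩ | ⟨k1, k2, k3⟩)
        · exact ⟨k1, k2, by rw [if_pos k3]⟩
        · exact ⟨k1, by omega, by rw [if_neg (by omega)]; exact k3⟩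
  refine Run.mono (run_storeTable (by norm_num) hW E₅.T) le_rfl ?_
  intro τ h F
  refine ⟨(F.reg 45 rfl).trans g45, fun z => if rep z = x then D.par x else rep z,
    Function.update off (D.par x) ((off x + δ) + off (D.par x)), hM.step hx hx0, ?_, ?_⟩
  · rw [g48] at h
    intro y hy
    by_cases hyp : y = D.par x
    · subst hyp
      rw [Function.update_self]
      refine ⟨hJ.congr fun c hc => ?_, ?_⟩
      · rw [h, if_pos (by omega), Nat.add_sub_cancel_left]
      · have := pow_pos (show 0 < 3 by norm_num) K
        rw [h, if_pos (by omega), Nat.sub_self, h50]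
    · rw [Function.update_of_ne hyp]
      obtain ⟨hTy, h0y⟩ := htab y (by omega)
      -- The tables of different nodes occupy disjoint blocks, so storing at the parent spares all
      -- others.
      have hne : ∀ c < 3 ^ K, ¬ (D.par x * 3 ^ K ≤ y * 3 ^ K + c ∧
          y * 3 ^ K + c < D.par x * 3 ^ K + 3 ^ K) := by
        rintro c hc ⟨k1, k2⟩
        rcases lt_or_gt_of_ne hyp with hlt | hlt
        · have := Nat.mul_le_mul_right (3 ^ K) (Nat.succ_le_of_lt hlt)
          rw [Nat.succ_mul] at this
          omega
        · have := Nat.mul_le_mul_right (3 ^ K) (Nat.succ_le_of_lt hlt)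
          rw [Nat.succ_mul] at this
          omega
      refine ⟨?_, ?_⟩
      · have e1 : D.fin x (fun z => if rep z = x then D.par x else rep z) y = D.fin (x + 1) rep y := by
          ext v
          simp only [Rooted.fin, Set.mem_ofPred_eq]
          refine and_congr_right fun k1 => ?_
          constructor
          · rintro ⟨k2, k3⟩
            split_ifs at k3 with h
            · omega
            · refine ⟨?_, k3⟩
              rcases k2.lt_or_eq with hlt | heq
              · exact hlt
              · rw [← heq, hself] at h; exact absurd rfl h
          · rintro ⟨k2, k3⟩
            exact ⟨by omega, by rw [if_neg (by omega)]; exact k3⟩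
        have e2 : D.edg x (fun z => if rep z = x then D.par x else rep z) y = D.edg (x + 1) rep y := by
          funext u v
          simp only [Rooted.edg]
          refine propext (and_congr_right fun k1 => ?_)
          constructor
          · rintro ⟨k2, k3⟩
            split_ifs at k3 with h
            · omega
            · refine ⟨?_, k3⟩
              rcases k2.lt_or_eq with hlt | heq
              · exact hlt
              · rw [← heq, hself] at h; exact absurd rfl h
          · rintro ⟨k2, k3⟩
            exact ⟨by omega, by rw [if_neg (by omega)]; exact k3⟩
        rw [e1, e2]
        exact hTy.congr fun c hc => by rw [h, if_neg (hne c hc), g16]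
      · have := hne 0 (by positivity)
        rw [add_zero] at this
        rw [h, if_neg this, g16, h0y]
  -- The offset of `x` passes to its parent together with the `δ` gained by forgetting, so the total
  -- still agrees with register 0.
  · rw [F.reg 0 rfl, g0, hsum, Finset.sum_range_succ]
    have hpm : D.par x ∈ Finset.range x := Finset.mem_range.2 hp
    rw [Finset.sum_update_of_mem hpm, ← Finset.sum_sdiff (Finset.singleton_subset_iff.2 hpm),
      Finset.sum_singleton]
    omega

def mainCost (N K : ℕ) : ℕ := 1 + ((N - 1) * (mergeCost K + 1) + 1) + 1 + procCost K

/-- At the root every vertex is finished and every edge is added, so the cost of code 0 is the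
domination number. As the table has entry 0 there, this number is the offset, that is, the content
of register 0. -/
theorem run_mainLoop (hW : WordSize K w) (hE : MEnv D pl σ) (hN : 1 ≤ N) (h0 : σ.reg 0 = 0)
    (hT : ∀ y < N, ∀ c < 3 ^ K, σ.arr 16 (y * 3 ^ K + c) = cnt K c) :
    Run w mainLoop σ (mainCost N K) (fun τ => ∀ m, τ.reg 0 ≤ m ↔ ∃ S : Finset ℕ,
      (∀ v ∈ S, v < n) ∧ S.card ≤ m ∧ ∀ v < n, v ∈ S ∨ ∃ u, D.Adj v u ∧ u ∈ S) := by
  have hw1 := hW.one_lt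
  unfold mainCost
  refine Run.seq (B₁ := 1) (B₂ := ((N - 1) * (mergeCost K + 1) + 1) + 1 + procCost K)
    (R := fun τ => τ = σ.setReg 45 N) (Run.instr (by simp [Instr.wp, hE.num])) ?_ (by omega)
  rintro τ₁ rfl F₁
  have E₁ := hE.fr F₁ (by decide) (by decide)
  refine Run.seq (B₂ := 1 + procCost K) (Run.while (ι := ℕ)
    (fun t τ => 1 ≤ t ∧ t ≤ N ∧ τ.reg 45 = t ∧ Tables D t τ)
    (fun t => (t - 1) * (mergeCost K + 1)) N ?_ ?_) ?_ (by omega)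
  · refine ⟨hN, le_rfl, by simp, id, fun _ => 0, Rooted.Merged.start, fun y hy => ⟨?_, ?_⟩, by simpa using h0⟩
    · have e1 : D.fin N id y = ∅ := by
        ext v
        simp only [Rooted.fin, Set.mem_ofPred_eq, Set.mem_empty_iff_false, iff_false]
        rintro ⟨k1, k2, k3⟩
        have := D.top_lt v k1
        omega
      have e2 : D.edg N id y = noEdge := by
        funext u v
        simp only [Rooted.edg, noEdge, eq_iff_iff, iff_false]
        rintro ⟨k1, k2, k3⟩
        have := (D.adj_max k1).1
        omega
      rw [e1, e2]
      exact tab_init.congr (by simpa using hT y hy)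
    · have := hT y hy 0 (by positivity)
      simpa [cnt] using this
  · rintro t τ ⟨ht1, htN, h45, hTt⟩ hb hF
    have hE' := E₁.fr hF (by decide) (by decide)
    simp only [Test.Holds, hE'.T.one, h45] at hb
    obtain ⟨x, rfl⟩ : ∃ x, t = x + 1 := ⟨t - 1, by omega⟩
    refine ⟨_, (run_mergeNode hW hE' (by omega) (by omega) h45 hTt).mono le_rfl ?_⟩
    rintro υ ⟨k1, k2⟩ -
    refine ⟨x, ⟨by omega, by omega, k1, k2⟩, ?_⟩
    obtain ⟨z, rfl⟩ : ∃ z, x = z + 1 := ⟨x - 1, by omega⟩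
    simp only [Nat.add_sub_cancel]
    rw [add_mul z 1]; omega
  · rintro τ ⟨t, ⟨ht1, htN, h45, hTt⟩, hb⟩ hF
    have hE' := E₁.fr hF (by decide) (by decide)
    simp only [Test.Holds, hE'.T.one, h45] at hb
    obtain rfl : t = 1 := by omega
    obtain ⟨rep, off, hM, htab, hsum⟩ := hTt
    obtain ⟨hTx, h0x⟩ := htab 0 (by omega)
    refine Run.seq (B₁ := 1) (B₂ := procCost K) (R := fun υ => υ = τ.setReg 45 0)
      (Run.instr ⟨by omega, rfl⟩) ?_ (by omega)
    rintro τ₂ rfl F₂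
    have E₂ := hE'.fr F₂ (by decide) (by decide)
    refine Run.mono (run_procNode hW E₂ (x := 0) (by omega) hM (by simp) (by simpa using hTx)
      (by simpa using h0x)) le_rfl ?_
    rintro υ ⟨δ, k1, k2, k3⟩ - m
    have hr : ∀ z < N, rep z = 0 := fun z hz => by have := hM.rep_lt z hz; omega
    have hred : υ.reg 0 = off 0 + δ := by rw [k3]; simp [hsum]
    have key := k1 0 (by positivity) m
    rw [k2, zero_add, ← hred, val_full] at key
    · rw [← key]
      have e1 : ∀ v, v ∈ D.fin 0 rep 0 ↔ v < n := by
        intro v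
        simp only [Rooted.fin, Set.mem_ofPred_eq]
        exact ⟨fun h => h.1, fun h => ⟨h, Nat.zero_le _, hr _ (D.top_lt v h)⟩⟩
      have e2 : ∀ u v, D.edg 0 rep 0 u v ↔ D.Adj u v := by
        intro u v
        exact ⟨fun h => h.1, fun h => ⟨h, Nat.zero_le _, hr _ (D.adj_max h).1⟩⟩
      simp only [e1, e2]
    · intro u v huv
      have kk : ∀ u v, D.edg 0 rep 0 u v → v ∈ D.fin 0 rep 0 := fun u v h =>
        have hv := (hM.edg_mem' h).1
        ⟨hv, Nat.zero_le _, hr _ (D.top_lt v hv)⟩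
      exact ⟨kk _ _ (Rooted.edg_symm huv), kk _ _ huv⟩

end

/-! ### Preprocessing: input, root, digits, slots and edge lists -/

section

/-! ## The input -/

/-- A graph with a tree decomposition, and how it is laid out in the memory `inp`; the largest bag
has `K` vertices. -/
structure Inst where
  n : ℕ
  N : ℕ
  m : ℕ
  K : ℕ
  inp : ℕ → ℕ
  adj : ℕ → ℕ → Prop
  tadj : ℕ → ℕ → Prop
  bag : ℕ → List ℕ
  bp : ℕ → ℕ
  one_le_N : 1 ≤ N
  inp_zero : inp 0 = n
  inp_one : inp 1 = N
  inp_two : inp 2 = m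
  edge_lt : ∀ j < m, inp (3 + 2 * j) < n ∧ inp (3 + 2 * j + 1) < n
  adj_iff : ∀ u v, adj u v ↔ ∃ j < m, (u = inp (3 + 2 * j) ∧ v = inp (3 + 2 * j + 1)) ∨
    (v = inp (3 + 2 * j) ∧ u = inp (3 + 2 * j + 1))
  edge_inj : ∀ j < m, ∀ j' < m,
    (inp (3 + 2 * j) = inp (3 + 2 * j') ∧ inp (3 + 2 * j + 1) = inp (3 + 2 * j' + 1)) → j = j'
  tree_lt : ∀ j < N - 1, inp (3 + 2 * m + 2 * j) < N ∧ inp (3 + 2 * m + 2 * j + 1) < N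
  tadj_iff : ∀ x y, tadj x y ↔ ∃ j < N - 1,
    (x = inp (3 + 2 * m + 2 * j) ∧ y = inp (3 + 2 * m + 2 * j + 1)) ∨
    (y = inp (3 + 2 * m + 2 * j) ∧ x = inp (3 + 2 * m + 2 * j + 1))
  conn : ∀ x < N, Relation.ReflTransGen tadj 0 x
  -- Only the first step from `x` towards `y` is needed: `p` is the neighbour of `x` on the side of
  -- `y`.
  path : ∀ v x y p, x < N → y < N → v ∈ bag x → v ∈ bag y → tadj x p →
    Relation.ReflTransGen (fun a b => tadj a b ∧ a ≠ x ∧ b ≠ x) p y → y ≠ x → v ∈ bag p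
  bp_zero : bp 0 = 3 + 2 * m + 2 * (N - 1)
  bp_succ : ∀ x < N, bp (x + 1) = bp x + 1 + (bag x).length
  inp_len : ∀ x < N, inp (bp x) = (bag x).length
  inp_bag : ∀ x < N, ∀ i (h : i < (bag x).length), inp (bp x + 1 + i) = (bag x)[i]
  bag_lt : ∀ x < N, ∀ v ∈ bag x, v < n
  bag_nodup : ∀ x < N, (bag x).Nodup
  bag_len : ∀ x < N, (bag x).length ≤ K
  exists_len : ∃ x < N, (bag x).length = K
  cover : ∀ v < n, ∃ x < N, v ∈ bag x
  adj_bag : ∀ u v, adj u v → ∃ x < N, u ∈ bag x ∧ v ∈ bag x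

/-! ## Linked lists -/

/-- Linked lists with elements below `B`, `k` elements in the lists below `N`; the targets of the
elements of list `x` are the `y` with `R x y`. -/
def Links (head nx tgt : ℕ → ℕ) (N B k : ℕ) (R : ℕ → ℕ → Prop) (l : ℕ → List ℕ) : Prop :=
  (∀ x, Chn nx (head x) (l x)) ∧ (∀ x, ∀ e ∈ l x, e < B) ∧ (∀ x, (l x).Nodup) ∧
    (∀ x y, (∃ e ∈ l x, tgt e = y) ↔ R x y) ∧ ∑ x ∈ Finset.range N, (l x).length = k

/-- The new element `e` is not below the bound `B` of the old elements, so no existing pointer is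
overwritten. -/
theorem Links.insert {head nx tgt tgt' : ℕ → ℕ} {N B B' k e a b : ℕ} {R R' : ℕ → ℕ → Prop}
    {l : ℕ → List ℕ} (h : Links head nx tgt N B k R l) (hB : B ≤ e) (he : e < B') (he0 : e ≠ 0)
    (ha : a < N) (ht : tgt' e = b) (ht' : ∀ e' < B, tgt' e' = tgt e')
    (hR : ∀ x y, R' x y ↔ R x y ∨ (x = a ∧ y = b)) :
    Links (Function.update head a e) (Function.update nx e (head a)) tgt' N B' (k + 1) R'
      (Function.update l a (e :: l a)) := by
  obtain ⟨h1, h2, h2', h3, h4⟩ := h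
  have hc : ∀ x, Chn (Function.update nx e (head a)) (head x) (l x) := fun x =>
    (h1 x).congr fun e' he' => Function.update_of_ne (by have := h2 x e' he'; omega) _ _
  refine ⟨fun x => ?_, fun x e' he' => ?_, fun x => ?_, fun x y => ?_, ?_⟩
  · by_cases hx : x = a
    · subst hx
      rw [Function.update_self, Function.update_self]
      exact ⟨rfl, he0, by rw [Function.update_self]; exact hc x⟩
    · rw [Function.update_of_ne hx, Function.update_of_ne hx]; exact hc x
  · by_cases hx : x = a
    · subst hx
      rw [Function.update_self, List.mem_cons] at he'
      rcases he' with rfl | he'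
      · exact he
      · have := h2 x e' he'; omega
    · rw [Function.update_of_ne hx] at he'
      have := h2 x e' he'; omega
  · by_cases hx : x = a
    · subst hx
      rw [Function.update_self, List.nodup_cons]
      exact ⟨fun h => by have := h2 x e h; omega, h2' x⟩
    · rw [Function.update_of_ne hx]; exact h2' x
  · have hold : (∃ e' ∈ l x, tgt' e' = y) ↔ R x y := by
      rw [← h3]
      refine exists_congr fun e' => and_congr_right fun he' => ?_
      rw [ht' e' (h2 x e' he')]
    rw [hR]
    by_cases hx : x = a
    · subst hx
      simp only [Function.update_self, List.mem_cons, or_and_right, exists_or, exists_eq_left, hold, ht]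
      constructor
      · rintro (rfl | h)
        · exact Or.inr (by simp)
        · exact Or.inl h
      · rintro (h | ⟨-, rfl⟩)
        · exact Or.inr h
        · exact Or.inl rfl
    · simp only [Function.update_of_ne hx, hold, hx, false_and, or_false]
  · have ham := Finset.mem_range.2 ha
    rw [← Finset.sum_sdiff (Finset.singleton_subset_iff.2 ham), Finset.sum_singleton] at h4 ⊢
    rw [Function.update_self, List.length_cons, ← h4, ← add_assoc]
    congr 2
    refine Finset.sum_congr rfl fun x hx => ?_
    rw [Finset.mem_sdiff, Finset.mem_singleton] at hx
    rw [Function.update_of_ne hx.2]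

theorem links_empty {head nx tgt : ℕ → ℕ} {N B : ℕ} (h : ∀ x, head x = 0) :
    Links head nx tgt N B 0 (fun _ _ => False) (fun _ => []) := by
  refine ⟨h, by simp, by simp, by simp, by simp⟩

variable {I : Inst} {w : ℕ} {σ : State}

/-! ## Reading the input -/

/-- The numbers at the beginning of the input, and the constants. -/
structure Start (I : Inst) (σ : State) : Prop where
  one : σ.reg 1 = 1
  two : σ.reg 2 = 2
  three : σ.reg 3 = 3
  zero : σ.reg 4 = 0
  n : σ.reg 5 = I.n
  N : σ.reg 6 = I.N
  m : σ.reg 7 = I.m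
  inp : σ.arr 0 = I.inp

theorem Start.fr {P : Program} {τ : State} (h : Start I σ) (hF : Fr P σ τ)
    (hr : ∀ r < 8, r ≠ 0 → P.wr r = false) (ha : P.wa 0 = false) : Start I τ where
  one := (hF.reg 1 (hr _ (by norm_num) (by norm_num))).trans h.one
  two := (hF.reg 2 (hr _ (by norm_num) (by norm_num))).trans h.two
  three := (hF.reg 3 (hr _ (by norm_num) (by norm_num))).trans h.three
  zero := (hF.reg 4 (hr _ (by norm_num) (by norm_num))).trans h.zero
  n := (hF.reg 5 (hr _ (by norm_num) (by norm_num))).trans h.n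
  N := (hF.reg 6 (hr _ (by norm_num) (by norm_num))).trans h.N
  m := (hF.reg 7 (hr _ (by norm_num) (by norm_num))).trans h.m
  inp := (hF.arr 0 ha).trans h.inp

/-- The number of edges may be longer than a word, so `3 + 2 * m` is reached by repeatedly adding 2.
-/
def readHead : Program :=
  (.instr (.const 1 1) ;; .instr (.const 2 2) ;; .instr (.const 3 3) ;; .instr (.load 5 0 4) ;;
    .instr (.load 6 0 1) ;; .instr (.load 7 0 2) ;; .instr (.copy 24 3) ;; .instr (.const 25 0)) ;;
    forUp 25 7 (.instr (.add 24 24 2))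

theorem run_readHead (hW : WordSize I.K w) (h4 : σ.reg 4 = 0) (h0 : σ.arr 0 = I.inp) :
    Run w readHead σ (I.m * 3 + 9) (fun τ => Start I τ ∧ τ.reg 24 = 3 + 2 * I.m) := by
  have hw1 := hW.one_lt
  have h3 := hW.three
  refine Run.wp_seq (B₂ := I.m * 3 + 1) ?_ (by simp [Program.cost]; omega)
  simp only [Program.wp, Instr.wp]
  refine ⟨hw1, by omega, h3, by omega, ?_⟩
  have hS : Start I (((((((((σ.setReg 1 1).setReg 2 2).setReg 3 3).setReg 5 I.n).setReg 6 I.N).setReg 7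
      I.m).setReg 24 3).setReg 25 0)) := by
    constructor <;> simp [h4, h0]
  simp only [State.setReg_reg, State.setReg_arr, h4, h0, Nat.reduceEqDiff, OfNat.ofNat_ne_one,
    if_true, if_false, I.inp_zero, I.inp_one, I.inp_two]
  refine Run.mono (Run.forUp (a := 0) (b := I.m) (B := 1) (fun j τ => τ.reg 24 = 3 + 2 * j)
    (by simp) (by simp) (by simp) (Nat.zero_le _) hw1 rfl rfl rfl (by simp) ?_) (by omega) ?_
  · intro j τ _ hj hτ hF hI
    have e2 : τ.reg 2 = 2 := (hF.reg 2 rfl).trans (by simp)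
    refine Run.instr ?_
    simp [Instr.wp, hI, e2]
    omega
  · rintro τ ⟨-, h⟩ hF
    exact ⟨hS.fr hF (by decide) (by decide), h⟩

/-- The tree edges among the first `j`. -/
def Inst.tadjUpTo (I : Inst) (k x y : ℕ) : Prop := ∃ j < k,
    (x = I.inp (3 + 2 * I.m + 2 * j) ∧ y = I.inp (3 + 2 * I.m + 2 * j + 1)) ∨
    (y = I.inp (3 + 2 * I.m + 2 * j) ∧ x = I.inp (3 + 2 * I.m + 2 * j + 1))

/-- The two addresses of a tree edge in the input serve as the list elements for its two directions.
They are at least 3, so 0 is free to mark the end of a list. -/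
def readTreeEdge : Program :=
  .instr (.load 26 0 24) ;; .instr (.add 28 24 1) ;; .instr (.load 27 0 28) ;;
    .instr (.store 3 24 27) ;; .instr (.load 29 1 26) ;; .instr (.store 2 24 29) ;;
    .instr (.store 1 26 24) ;; .instr (.store 3 28 26) ;; .instr (.load 29 1 27) ;;
    .instr (.store 2 28 29) ;; .instr (.store 1 27 28) ;; .instr (.add 24 24 2)

/-- Counting from 1 up to `N` gives one round for each of the `N - 1` tree edges. -/
def readTree : Program := .instr (.const 25 1) ;; forUp 25 6 readTreeEdge

theorem run_readTree (hW : WordSize I.K w) (hS : Start I σ) (h24 : σ.reg 24 = 3 + 2 * I.m)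
    (h1 : ∀ x, σ.arr 1 x = 0) :
    Run w readTree σ (I.N * 14 + 2) (fun τ => τ.reg 24 = I.bp 0 ∧
      ∃ l, Links (τ.arr 1) (τ.arr 2) (τ.arr 3) I.N (I.bp 0) (2 * (I.N - 1)) I.tadj l) := by
  have hw1 := hW.one_lt
  have h3 := hW.three
  have hN := I.one_le_N
  refine Run.wp_seq (B₂ := I.N * 14 + 1) ⟨hw1, ?_⟩ (by simp [Program.cost]; omega)
  refine Run.mono (Run.forUp (a := 1) (b := I.N) (B := 12) (fun i τ =>
    τ.reg 24 = 3 + 2 * I.m + 2 * (i - 1) ∧ ∃ l, Links (τ.arr 1) (τ.arr 2) (τ.arr 3) I.N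
      (3 + 2 * I.m + 2 * (i - 1)) (2 * (i - 1)) (I.tadjUpTo (i - 1)) l)
    (by simp) (by simp [hS.N]) (by simp [hS.one]) hN hw1 rfl rfl rfl ?_ ?_) ?_ ?_
  · refine ⟨by simp [h24], fun _ => [], ?_⟩
    have : I.tadjUpTo (1 - 1) = fun _ _ => False := by
      funext x y; simp [Inst.tadjUpTo]
    rw [this]
    exact links_empty (by simpa using h1)
  · rintro i τ hi1 hi hτ hF ⟨k24, l, hl⟩
    obtain ⟨j, rfl⟩ : ∃ j, i = j + 1 := ⟨i - 1, by omega⟩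
    simp only [Nat.add_sub_cancel] at k24 hl ⊢
    have e0 : τ.arr 0 = I.inp := (hF.arr 0 rfl).trans hS.inp
    have e1 : τ.reg 1 = 1 := (hF.reg 1 rfl).trans (by simp [hS.one])
    have e2 : τ.reg 2 = 2 := (hF.reg 2 rfl).trans (by simp [hS.two])
    obtain ⟨ha, hb⟩ := I.tree_lt j (by omega)
    generalize hae : I.inp (3 + 2 * I.m + 2 * j) = a at ha
    generalize hbe : I.inp (3 + 2 * I.m + 2 * j + 1) = b at hb
    generalize hp : 3 + 2 * I.m + 2 * j = p at k24 hl hae hbe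
    refine Run.of_wp (by decide) ?_
    simp only [readTreeEdge, Program.wp, Instr.wp]
    simp only [State.setReg_reg, State.setReg_arr, State.setArr_arr, State.setArr_reg,
      Nat.reduceEqDiff, OfNat.ofNat_ne_zero, OfNat.zero_ne_ofNat, OfNat.one_ne_ofNat,
      OfNat.ofNat_ne_one, if_true, if_false, zero_ne_one, k24, e0, e1, e2, hae, hbe]
    have q1 := hl.insert (e := p) (B' := p + 1) (a := a) (b := b)
      (tgt' := Function.update (τ.arr 3) p b) (R' := fun x y => I.tadjUpTo j x y ∨ (x = a ∧ y = b))
      le_rfl (by omega) (by omega) ha (by simp)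
      (fun e' he' => Function.update_of_ne (by omega) _ _) (fun _ _ => Iff.rfl)
    have q2 := q1.insert (e := p + 1) (B' := p + 2) (a := b) (b := a)
      (tgt' := Function.update (Function.update (τ.arr 3) p b) (p + 1) a)
      (R' := I.tadjUpTo (j + 1)) le_rfl (by omega) (by omega) hb (by simp)
      (fun e' he' => Function.update_of_ne (by omega) _ _) ?_
    · refine ⟨hw1, by omega, by omega, Function.update (Function.update l a (p :: l a)) b
        ((p + 1) :: Function.update l a (p :: l a) b), ?_⟩
      convert q2 using 1 <;> omega
    · intro x y
      constructor
      · rintro ⟨j', hj', h⟩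
        rcases Nat.lt_succ_iff_lt_or_eq.1 hj' with hlt | rfl
        · exact Or.inl (Or.inl ⟨j', hlt, h⟩)
        · rw [hp, hae, hbe] at h
          rcases h with h | h
          · exact Or.inl (Or.inr h)
          · exact Or.inr ⟨h.2, h.1⟩
      · rintro ((⟨j', hj', h⟩ | h) | h)
        · exact ⟨j', by omega, h⟩
        · exact ⟨j, by omega, Or.inl (by rw [hp, hae, hbe]; exact h)⟩
        · exact ⟨j, by omega, Or.inr (by rw [hp, hae, hbe]; exact ⟨h.2, h.1⟩)⟩
  · have := Nat.mul_le_mul_right 14 (Nat.sub_le I.N 1)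
    omega
  · rintro τ ⟨-, k24, l, hl⟩ -
    have e : I.tadjUpTo (I.N - 1) = I.tadj := by
      funext x y; exact propext (I.tadj_iff x y).symm
    rw [I.bp_zero, ← e]
    exact ⟨k24, l, hl⟩

def readBags : Program :=
  (.instr (.const 25 0) ;; .instr (.const 8 0)) ;;
    forUp 25 6 (.instr (.store 4 25 24) ;; .instr (.load 26 0 24) ;;
      .ite (.lt 8 26) (.instr (.copy 8 26)) .skip ;; .instr (.add 24 24 26) ;;
      .instr (.add 24 24 1))

theorem run_readBags (hW : WordSize I.K w) (hS : Start I σ) (h24 : σ.reg 24 = I.bp 0) :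
    Run w readBags σ (I.N * 8 + 3) (fun τ => τ.reg 8 = I.K ∧ ∀ x < I.N, τ.arr 4 x = I.bp x) := by
  have hw1 := hW.one_lt
  have hK := hW.K_lt
  refine Run.wp_seq (B₂ := I.N * 8 + 1) ⟨by omega, by omega, ?_⟩ (by simp [Program.cost]; omega)
  refine Run.mono (Run.forUp (a := 0) (b := I.N) (B := 6) (fun i τ =>
    τ.reg 24 = I.bp i ∧ (∀ x < i, τ.arr 4 x = I.bp x) ∧ (∀ x < i, (I.bag x).length ≤ τ.reg 8) ∧
      (τ.reg 8 = 0 ∨ ∃ x < i, (I.bag x).length = τ.reg 8))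
    (by simp) (by simp [hS.N]) (by simp [hS.one]) (Nat.zero_le _) hw1 rfl rfl rfl ?_ ?_) (by omega) ?_
  · simp [h24]
  · rintro i τ - hi hτ hF ⟨k24, k4, k8, k8'⟩
    have e0 : τ.arr 0 = I.inp := (hF.arr 0 rfl).trans hS.inp
    have e1 : τ.reg 1 = 1 := (hF.reg 1 rfl).trans (by simp [hS.one])
    have hlen := I.inp_len i hi
    have hlK := I.bag_len i hi
    refine Run.of_wp (by decide) ?_
    simp only [Program.wp, Instr.wp, Test.Holds]
    simp only [State.setReg_reg, State.setReg_arr, State.setArr_arr, State.setArr_reg,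
      Nat.reduceEqDiff, OfNat.ofNat_ne_zero, OfNat.zero_ne_ofNat, OfNat.one_ne_ofNat,
      OfNat.ofNat_ne_one, if_true, if_false, zero_ne_one, k24, e0, e1, hlen, hτ]
    have h4' : ∀ x < i + 1, Function.update (τ.arr 4) i (I.bp i) x = I.bp x := by
      intro x hx
      by_cases hxi : x = i
      · subst hxi; simp
      · rw [Function.update_of_ne hxi]; exact k4 x (by omega)
    have hbs := I.bp_succ i hi
    refine ⟨fun hlt => ⟨by omega, hw1, by omega, h4', fun x hx => ?_, ?_⟩,
      fun hlt => ⟨by omega, hw1, by omega, h4', fun x hx => ?_, ?_⟩⟩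
    · rcases Nat.lt_succ_iff_lt_or_eq.1 hx with h | rfl
      · have := k8 x h; omega
      · exact le_rfl
    · exact Or.inr ⟨i, by omega, rfl⟩
    · rcases Nat.lt_succ_iff_lt_or_eq.1 hx with h | rfl
      · exact k8 x h
      · omega
    · rcases k8' with h | ⟨x, hx, h⟩
      · exact Or.inl h
      · exact Or.inr ⟨x, by omega, h⟩
  · rintro τ ⟨-, -, k4, k8, k8'⟩ -
    refine ⟨?_, k4⟩
    obtain ⟨x, hx, hxK⟩ := I.exists_len
    have h1 := k8 x hx
    rcases k8' with h | ⟨y, hy, h⟩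
    · have := hW.pos; omega
    · have := I.bag_len y hy; omega

end

section

/-! ## Breadth first search in the tree -/

/-- An enumeration of the nodes of the tree, and the position of the parent for every position. -/
structure Bfs (I : Inst) (order par : ℕ → ℕ) : Prop where
  lt : ∀ i < I.N, order i < I.N
  inj : ∀ i < I.N, ∀ j < I.N, order i = order j → i = j
  par_lt : ∀ i < I.N, 0 < i → par i < i
  adj : ∀ i < I.N, 0 < i → I.tadj (order (par i)) (order i)

theorem Inst.tadj_symm (I : Inst) {x y : ℕ} (h : I.tadj x y) : I.tadj y x := by
  rw [I.tadj_iff] at h ⊢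
  obtain ⟨j, hj, h⟩ := h
  exact ⟨j, hj, h.symm⟩

theorem Inst.tadj_lt (I : Inst) {x y : ℕ} (h : I.tadj x y) : y < I.N := by
  rw [I.tadj_iff] at h
  obtain ⟨j, hj, h⟩ := h
  have := I.tree_lt j hj
  rcases h with h | h <;> omega

variable {I : Inst} {order par : ℕ → ℕ}

theorem Bfs.surj (h : Bfs I order par) {x : ℕ} (hx : x < I.N) : ∃ i < I.N, order i = x := by
  have h1 : (Finset.range I.N).image order = Finset.range I.N := by
    refine Finset.eq_of_subset_of_card_le ?_ ?_
    · intro y hy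
      obtain ⟨i, hi, rfl⟩ := Finset.mem_image.1 hy
      exact Finset.mem_range.2 (h.lt i (Finset.mem_range.1 hi))
    · rw [Finset.card_image_of_injOn]
      intro i hi j hj
      exact h.inj i (by simpa using hi) j (by simpa using hj)
  have h2 : x ∈ (Finset.range I.N).image order := by rw [h1]; exact Finset.mem_range.2 hx
  obtain ⟨i, hi, rfl⟩ := Finset.mem_image.1 h2
  exact ⟨i, Finset.mem_range.1 hi, rfl⟩

/-- Earlier nodes are joined to the root by earlier nodes, hence without passing `order i`. So the
way from `order i` to any earlier node begins with its parent, and the path condition applies. -/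
theorem Bfs.mem_par (h : Bfs I order par) {i j v : ℕ} (hi : i < I.N) (hj : j < i)
    (hvi : v ∈ I.bag (order i)) (hvj : v ∈ I.bag (order j)) : v ∈ I.bag (order (par i)) := by
  have hp := h.par_lt i hi (by omega)
  have hne : ∀ j < i, order j ≠ order i := fun j hj he => by
    have := h.inj j (by omega) i hi he
    omega
  have up : ∀ j < i, Relation.ReflTransGen
      (fun a b => I.tadj a b ∧ a ≠ order i ∧ b ≠ order i) (order 0) (order j) ∧
      Relation.ReflTransGen
      (fun a b => I.tadj a b ∧ a ≠ order i ∧ b ≠ order i) (order j) (order 0) := by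
    intro j
    induction j using Nat.strong_induction_on with
    | _ j ih =>
      intro hj
      rcases Nat.eq_zero_or_pos j with rfl | h0
      · exact ⟨.refl, .refl⟩
      · have h1 := h.par_lt j (by omega) h0
        have h2 := h.adj j (by omega) h0
        have h3 := ih _ h1 (by omega)
        have n1 := hne _ hj
        have n2 := hne (par j) (by omega)
        exact ⟨h3.1.tail ⟨h2, n2, n1⟩, .head ⟨I.tadj_symm h2, n1, n2⟩ h3.2⟩
  exact I.path v (order i) (order j) (order (par i)) (h.lt i hi) (h.lt j (by omega)) hvi hvj
    (I.tadj_symm (h.adj i hi (by omega))) ((up _ hp).2.trans (up _ hj).1) (hne _ hj)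

/-- The state of the search: `qt` nodes are visited, and the first `qh` of them are finished. -/
structure BfsInv (I : Inst) (qh qt : ℕ) (order vis par : ℕ → ℕ) : Prop where
  le : qh ≤ qt
  pos : 1 ≤ qt
  zero : order 0 = 0
  lt : ∀ i < qt, order i < I.N
  inj : ∀ i < qt, ∀ j < qt, order i = order j → i = j
  par_lt : ∀ i < qt, 0 < i → par i < i
  adj : ∀ i < qt, 0 < i → I.tadj (order (par i)) (order i)
  vis_iff : ∀ y, vis y ≠ 0 ↔ ∃ i < qt, order i = y
  closed : ∀ i < qh, ∀ y, I.tadj (order i) y → vis y ≠ 0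

theorem BfsInv.push {qh qt : ℕ} {vis : ℕ → ℕ} (h : BfsInv I qh qt order vis par) (hq : qh < qt)
    {y : ℕ} (hy : I.tadj (order qh) y) (hv : vis y = 0) :
    BfsInv I qh (qt + 1) (Function.update order qt y) (Function.update vis y 1)
      (Function.update par qt qh) := by
  have hnew : ∀ i < qt, order i ≠ y := fun i hi he => (h.vis_iff y).2 ⟨i, hi, he⟩ hv
  have ho : ∀ i < qt, Function.update order qt y i = order i := fun i hi =>
    Function.update_of_ne (by omega) _ _
  refine ⟨by omega, by omega, ?_, ?_, ?_, ?_, ?_, ?_, ?_⟩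
  · rw [ho 0 h.pos]; exact h.zero
  · intro i hi
    rcases Nat.lt_succ_iff_lt_or_eq.1 hi with hi | rfl
    · rw [ho i hi]; exact h.lt i hi
    · rw [Function.update_self]; exact I.tadj_lt hy
  · intro i hi j hj
    rcases Nat.lt_succ_iff_lt_or_eq.1 hi with hi | rfl <;>
      rcases Nat.lt_succ_iff_lt_or_eq.1 hj with hj | rfl
    · rw [ho i hi, ho j hj]; exact h.inj i hi j hj
    · rw [ho i hi, Function.update_self]; exact fun he => absurd he (hnew i hi)
    · rw [ho j hj, Function.update_self]; exact fun he => absurd he.symm (hnew j hj)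
    · exact fun _ => rfl
  · intro i hi h0
    rcases Nat.lt_succ_iff_lt_or_eq.1 hi with hi | rfl
    · rw [Function.update_of_ne (by omega)]; exact h.par_lt i hi h0
    · rw [Function.update_self]; exact hq
  · intro i hi h0
    rcases Nat.lt_succ_iff_lt_or_eq.1 hi with hi | rfl
    · have := h.par_lt i hi h0
      rw [Function.update_of_ne hi.ne, ho i hi, ho _ (by omega)]
      exact h.adj i hi h0
    · rw [Function.update_self, Function.update_self, ho qh hq]; exact hy
  · intro z
    by_cases hz : z = y
    · subst hz
      rw [Function.update_self]
      exact ⟨fun _ => ⟨qt, by omega, Function.update_self _ _ _⟩, fun _ => one_ne_zero⟩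
    · rw [Function.update_of_ne hz, h.vis_iff]
      constructor
      · rintro ⟨i, hi, he⟩
        exact ⟨i, by omega, by rw [ho i hi, he]⟩
      · rintro ⟨i, hi, he⟩
        rcases Nat.lt_succ_iff_lt_or_eq.1 hi with hi | rfl
        · exact ⟨i, hi, by rw [← ho i hi, he]⟩
        · rw [Function.update_self] at he; exact absurd he.symm hz
  · intro i hi z hz
    rw [ho i (by omega)] at hz
    by_cases hzy : z = y
    · subst hzy; rw [Function.update_self]; exact one_ne_zero
    · rw [Function.update_of_ne hzy]; exact h.closed i hi z hz

/-- When the queue is used up, the visited nodes contain node 0 and are closed under adjacency, so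
by connectedness all nodes have been found. -/
theorem BfsInv.bfs {qt : ℕ} {vis : ℕ → ℕ} (h : BfsInv I qt qt order vis par) :
    Bfs I order par := by
  have hv : ∀ x, Relation.ReflTransGen I.tadj 0 x → vis x ≠ 0 := by
    intro x hx
    induction hx with
    | refl => exact (h.vis_iff 0).2 ⟨0, h.pos, h.zero⟩
    | tail _ hxy ih =>
      obtain ⟨i, hi, rfl⟩ := (h.vis_iff _).1 ih
      exact h.closed i hi _ hxy
  have h1 : I.N ≤ qt := by
    have : Finset.range I.N ⊆ (Finset.range qt).image order := by
      intro x hx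
      obtain ⟨i, hi, he⟩ := (h.vis_iff x).1 (hv x (I.conn x (Finset.mem_range.1 hx)))
      exact Finset.mem_image.2 ⟨i, Finset.mem_range.2 hi, he⟩
    have h2 := (Finset.card_le_card this).trans Finset.card_image_le
    simpa using h2
  exact ⟨fun i hi => h.lt i (by omega), fun i hi j hj => h.inj i (by omega) j (by omega),
    fun i hi => h.par_lt i (by omega), fun i hi => h.adj i (by omega)⟩

def bfsScan : Program :=
  .while (.lt 4 28) (.instr (.load 29 3 28) ;; .instr (.load 30 6 29) ;;
    .ite (.eq 30 4) (.instr (.store 6 29 1) ;; .instr (.store 5 26 29) ;;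
      .instr (.store 7 26 25) ;; .instr (.add 26 26 1)) .skip ;; .instr (.load 28 2 28))

def bfs : Program :=
  (.instr (.store 6 4 1) ;; .instr (.const 26 1) ;; .instr (.const 25 0)) ;;
    .while (.lt 25 26) ((.instr (.load 27 5 25) ;; .instr (.load 28 1 27)) ;; bfsScan ;;
      .instr (.add 25 25 1))

variable {w : ℕ} {σ : State}

theorem run_bfsScan (hw : 1 < 2 ^ w) (h1 : σ.reg 1 = 1) (h4 : σ.reg 4 = 0) {qh qt x : ℕ}
    {l : List ℕ} (hx : σ.arr 5 qh = x) (h25 : σ.reg 25 = qh) (h26 : σ.reg 26 = qt) (hq : qh < qt)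
    (hI : BfsInv I qh qt (σ.arr 5) (σ.arr 6) (σ.arr 7)) (hc : Chn (σ.arr 2) (σ.reg 28) l)
    (hl : ∀ y, (∃ e ∈ l, σ.arr 3 e = y) ↔ I.tadj x y) :
    Run w bfsScan σ (9 * l.length + 1) (fun τ => τ.arr 5 qh = x ∧ ∃ qt', qh < qt' ∧
      τ.reg 26 = qt' ∧ (∀ i ≤ qh, τ.arr 5 i = σ.arr 5 i) ∧
      BfsInv I (qh + 1) qt' (τ.arr 5) (τ.arr 6) (τ.arr 7)) := by
  refine Run.mono (Run.while (ι := List ℕ) (fun l' τ => Chn (σ.arr 2) (τ.reg 28) l' ∧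
    ∃ qt', τ.reg 26 = qt' ∧ qh < qt' ∧ (∀ i ≤ qh, τ.arr 5 i = σ.arr 5 i) ∧
    BfsInv I qh qt' (τ.arr 5) (τ.arr 6) (τ.arr 7) ∧
    (∀ e ∈ l, e ∈ l' ∨ τ.arr 6 (σ.arr 3 e) ≠ 0) ∧ (∀ e ∈ l', e ∈ l)) (fun l' => 9 * l'.length) l
    ⟨hc, qt, h26, hq, fun _ _ => rfl, hI, fun e he => Or.inl he, fun e he => he⟩ ?_) le_rfl ?_
  · rintro l' τ ⟨hc, qt', k26, hq', ho, hI', hd, hs⟩ hb hF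
    have e1 : τ.reg 1 = 1 := (hF.reg 1 rfl).trans h1
    have e4 : τ.reg 4 = 0 := (hF.reg 4 rfl).trans h4
    have e25 : τ.reg 25 = qh := (hF.reg 25 rfl).trans h25
    have e2 : τ.arr 2 = σ.arr 2 := hF.arr 2 rfl
    have e3 : τ.arr 3 = σ.arr 3 := hF.arr 3 rfl
    simp only [Test.Holds, e4] at hb
    cases l' with
    | nil => have : τ.reg 28 = 0 := hc; omega
    | cons e l' =>
      obtain ⟨rfl, -, hc⟩ := hc
      generalize hre : τ.reg 28 = e at hc hd hs hb
      have hte : I.tadj x (σ.arr 3 e) := (hl _).1 ⟨e, hs e (by simp), rfl⟩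
      refine ⟨8, Run.of_wp (by decide) ?_⟩
      simp only [Program.wp, Instr.wp, Test.Holds]
      simp only [State.setReg_reg, State.setReg_arr, State.setArr_arr, State.setArr_reg,
        Nat.reduceEqDiff, OfNat.ofNat_ne_zero, OfNat.zero_ne_ofNat, OfNat.one_ne_ofNat,
        OfNat.ofNat_ne_one, if_true, if_false, zero_ne_one, e1, e2, e3, e4, e25, k26, hre]
      generalize hy : σ.arr 3 e = y at hte
      have hs' : ∀ e' ∈ l', e' ∈ l := fun e' he' => hs e' (by simp [he'])
      refine ⟨fun hv => ⟨hw, l', ⟨hc, qt' + 1, rfl, by omega, ?_, ?_, ?_, hs'⟩, ?_⟩,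
        fun hv => ⟨l', ⟨hc, qt', rfl, hq', ho, hI', ?_, hs'⟩, ?_⟩⟩
      · intro i hi
        rw [Function.update_of_ne (by omega)]; exact ho i hi
      · refine hI'.push hq' ?_ hv
        rw [ho qh le_rfl, hx]; exact hte
      · intro e' he'
        by_cases hy' : σ.arr 3 e' = y
        · right; rw [hy', Function.update_self]; exact one_ne_zero
        · rw [Function.update_of_ne hy']
          rcases hd e' he' with h | h
          · rcases List.mem_cons.1 h with rfl | h
            · exact absurd hy hy'
            · exact Or.inl h
          · exact Or.inr h
      · simp only [List.length_cons]; omega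
      · intro e' he'
        rcases hd e' he' with h | h
        · rcases List.mem_cons.1 h with rfl | h
          · right; rw [hy]; exact hv
          · exact Or.inl h
        · exact Or.inr h
      · simp only [List.length_cons]; omega
  · rintro τ ⟨l', ⟨hc, qt', k26, hq', ho, hI', hd, hs⟩, hb⟩ hF
    have e4 : τ.reg 4 = 0 := (hF.reg 4 rfl).trans h4
    simp only [Test.Holds, e4] at hb
    cases l' with
    | cons e l' => obtain ⟨h1, h2, -⟩ := hc; omega
    | nil =>
      refine ⟨(ho qh le_rfl).trans hx, qt', hq', k26, ho, ⟨hq', hI'.pos, hI'.zero, hI'.lt, hI'.inj,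
        hI'.par_lt, hI'.adj, hI'.vis_iff, fun i hi y hy => ?_⟩⟩
      rcases Nat.lt_succ_iff_lt_or_eq.1 hi with hi | rfl
      · exact hI'.closed i hi y hy
      · rw [ho i le_rfl, hx] at hy
        obtain ⟨e, he, rfl⟩ := (hl y).2 hy
        exact (hd e he).resolve_left (by simp)

theorem run_bfs (hW : WordSize I.K w) (hS : Start I σ) {l : ℕ → List ℕ} {B k : ℕ}
    (hl : Links (σ.arr 1) (σ.arr 2) (σ.arr 3) I.N B k I.tadj l)
    (h5 : ∀ x, σ.arr 5 x = 0) (h6 : ∀ x, σ.arr 6 x = 0) :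
    Run w bfs σ (9 * k + 5 * I.N + 4) (fun τ => Bfs I (τ.arr 5) (τ.arr 7)) := by
  have hw1 := hW.one_lt
  have hN := I.one_le_N
  obtain ⟨hl1, -, -, hl4, hl5⟩ := hl
  refine Run.wp_seq (B₂ := 9 * k + 5 * I.N + 1) ⟨hw1, by omega, ?_⟩ (by simp [Program.cost]; omega)
  have hsum : ∑ x ∈ Finset.range I.N, (9 * (l x).length + 5) = 9 * k + 5 * I.N := by
    rw [Finset.sum_add_distrib, ← Finset.mul_sum, hl5]; simp [mul_comm]
  rw [← hsum]
  -- The ghost state is the set of nodes that are not finished. A node pays 9 for each element of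
  -- its list and 5 for itself when it leaves the set.
  refine Run.mono (Run.while (ι := Finset ℕ) (fun U τ => ∃ qh qt, τ.reg 25 = qh ∧ τ.reg 26 = qt ∧
    BfsInv I qh qt (τ.arr 5) (τ.arr 6) (τ.arr 7) ∧
    (∀ x, x ∈ U ↔ x < I.N ∧ ∀ i < qh, τ.arr 5 i ≠ x))
    (fun U => ∑ x ∈ U, (9 * (l x).length + 5)) (Finset.range I.N) ?_ ?_) le_rfl ?_
  · refine ⟨0, 1, by simp, by simp, ⟨by omega, by omega, by simp [h5], ?_, ?_, ?_, ?_, ?_, ?_⟩, ?_⟩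
    · simp [h5]; omega
    · intro i hi j hj _; omega
    · intro i hi h0; omega
    · intro i hi h0; omega
    · intro y
      simp only [State.setReg_arr, State.setArr_arr, if_true, hS.zero, hS.one]
      by_cases hy : y = 0
      · subst hy; simp [h5]
      · rw [Function.update_of_ne hy]
        simp [h5, h6, Ne.symm hy]
    · intro i hi; omega
    · simp
  · rintro U τ ⟨qh, qt, k25, k26, hI, hU⟩ hb hF
    have e1 : τ.reg 1 = 1 := (hF.reg 1 rfl).trans (by simp [hS.one])
    have e4 : τ.reg 4 = 0 := (hF.reg 4 rfl).trans (by simp [hS.zero])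
    have a1 : τ.arr 1 = σ.arr 1 := (hF.arr 1 rfl).trans (by simp)
    have a2 : τ.arr 2 = σ.arr 2 := (hF.arr 2 rfl).trans (by simp)
    have a3 : τ.arr 3 = σ.arr 3 := (hF.arr 3 rfl).trans (by simp)
    simp only [Test.Holds, k25, k26] at hb
    generalize hx : τ.arr 5 qh = x
    have hxU : x ∈ U := (hU x).2 ⟨hx ▸ hI.lt qh hb, fun i hi he => by
      have := hI.inj i (by omega) qh hb (he.trans hx.symm); omega⟩
    refine ⟨9 * (l x).length + 4, ?_⟩
    refine Run.wp_seq (B₂ := 9 * (l x).length + 2) ?_ (by simp [Program.cost]; omega)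
    simp only [Program.wp, Instr.wp]
    simp only [State.setReg_reg, State.setReg_arr, k25, hx, Nat.reduceEqDiff, if_true, if_false]
    refine Run.seq (B₂ := 1) (run_bfsScan (qh := qh) (qt := qt) (x := x) (l := l x) hw1
      (by simpa using e1) (by simpa using e4) hx (by simpa using k25) (by simpa using k26) hb
      hI (by simpa [a1, a2] using hl1 x) (by simpa [a3] using hl4 x)) ?_ (by omega)
    rintro τ' ⟨k5, qt', hq', k26', ho, hI'⟩ hF'
    have f1 : τ'.reg 1 = 1 := (hF'.reg 1 rfl).trans (by simp [e1])
    have f25 : τ'.reg 25 = qh := (hF'.reg 25 rfl).trans (by simp [k25])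
    refine Run.instr ?_
    simp only [Instr.wp, f1, f25]
    refine ⟨hw1, U.erase x, ⟨qh + 1, qt', by simp, by simpa using k26', hI', fun z => ?_⟩, ?_⟩
    · simp only [State.setReg_arr] at ho ⊢
      rw [Finset.mem_erase, hU]
      constructor
      · rintro ⟨h1, h2, h3⟩
        refine ⟨h2, fun i hi => ?_⟩
        rcases Nat.lt_succ_iff_lt_or_eq.1 hi with hi | rfl
        · rw [ho i (by omega)]; exact h3 i hi
        · rw [k5]; exact Ne.symm h1
      · rintro ⟨h2, h3⟩
        refine ⟨fun h => h3 qh (by omega) (by rw [k5, h]), h2, fun i hi => ?_⟩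
        rw [← ho i (by omega)]; exact h3 i (by omega)
    · have := Finset.add_sum_erase U (fun x => 9 * (l x).length + 5) hxU
      omega
  · rintro τ ⟨U, ⟨qh, qt, k25, k26, hI, -⟩, hb⟩ -
    simp only [Test.Holds, k25, k26] at hb
    have := hI.le
    obtain rfl : qh = qt := by omega
    exact hI.bfs

end

section

/-! ## Tables of powers and digits -/

def powers : Program :=
  (.instr (.const 9 1) ;; .instr (.const 25 0)) ;;
    forUp 25 8 (.instr (.store 9 25 9) ;; .instr (.mul 9 9 3)) ;;
    (.instr (.add 11 8 8) ;; .instr (.add 11 11 1) ;; .instr (.mul 10 11 9))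

/-- Without a division, digits are produced by counting: one counter runs modulo `3 ^ s`, and the
digit advances modulo 3 when it overflows. -/
def digitStep : Program :=
  .instr (.store 8 24 28) ;; .instr (.add 24 24 1) ;; .instr (.add 27 27 1) ;;
    .ite (.eq 27 26) (.instr (.const 27 0) ;; .instr (.add 28 28 1) ;;
      .ite (.eq 28 3) (.instr (.const 28 0)) .skip) .skip

def digits : Program :=
  (.instr (.const 24 0) ;; .instr (.const 25 0)) ;;
    forUp 25 8 ((.instr (.load 26 9 25) ;; .instr (.const 27 0) ;; .instr (.const 28 0) ;;
      .instr (.const 29 0)) ;; forUp 29 10 digitStep)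

variable {I : Inst} {w : ℕ} {σ : State}

theorem run_powers (hW : WordSize I.K w) (hS : Start I σ) (h8 : σ.reg 8 = I.K) :
    Run w powers σ (I.K * 4 + 6) (fun τ => τ.reg 9 = 3 ^ I.K ∧ (∀ s < I.K, τ.arr 9 s = 3 ^ s) ∧
      τ.reg 11 = 2 * I.K + 1 ∧ τ.reg 10 = (2 * I.K + 1) * 3 ^ I.K) := by
  have hw1 := hW.one_lt
  have hK := hW.K_lt
  have hQ := hW.Q_lt
  have h3 := hW.three
  refine Run.wp_seq (B₂ := I.K * 4 + 4) ⟨hw1, by omega, ?_⟩ (by simp [Program.cost]; omega)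
  refine Run.forUp_seq (a := 0) (b := I.K) (B := 2) (B₂ := 3) (fun i τ =>
    τ.reg 9 = 3 ^ i ∧ ∀ s < i, τ.arr 9 s = 3 ^ s)
    (by simp) (by simp [h8]) (by simp [hS.one]) (Nat.zero_le _) hw1 rfl rfl rfl (by simp) ?_ ?_
    (by omega)
  · rintro i τ - hi hτ hF ⟨k9, ka⟩
    have e3 : τ.reg 3 = 3 := (hF.reg 3 rfl).trans (by simp [hS.three])
    refine Run.of_wp (by decide) ?_
    have p1 := hW.pow_lt hi.le
    have p2 := hW.pow_lt (s := i + 1) hi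
    rw [pow_succ] at p2
    simp only [Program.wp, Instr.wp]
    simp only [State.setReg_reg, State.setReg_arr, State.setArr_arr, State.setArr_reg,
      Nat.reduceEqDiff, if_true, if_false, k9, e3, hτ]
    refine ⟨⟨p1, h3, p2⟩, (pow_succ _ _).symm, fun s hs => ?_⟩
    rcases Nat.lt_succ_iff_lt_or_eq.1 hs with hs | rfl
    · rw [Function.update_of_ne hs.ne]; exact ka s hs
    · exact Function.update_self _ _ _
  · rintro τ hτ ⟨k9, ka⟩ hF
    have e8 : τ.reg 8 = I.K := (hF.reg 8 rfl).trans (by simp [h8])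
    have e1 : τ.reg 1 = 1 := (hF.reg 1 rfl).trans (by simp [hS.one])
    refine Run.of_wp (by decide) ?_
    simp only [Program.wp, Instr.wp]
    simp only [State.setReg_reg, State.setReg_arr, Nat.reduceEqDiff, OfNat.one_ne_ofNat,
      if_true, if_false, k9, e8, e1, ← two_mul]
    exact ⟨by omega, hw1, ⟨hK, hW.M_lt, hQ⟩, trivial, ka, trivial, trivial⟩

theorem run_digitRow (hW : WordSize I.K w) (h1 : σ.reg 1 = 1) (h3 : σ.reg 3 = 3) {s o : ℕ}
    (h26 : σ.reg 26 = 3 ^ s) (h10 : σ.reg 10 = (2 * I.K + 1) * 3 ^ I.K) (h24 : σ.reg 24 = o)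
    (h27 : σ.reg 27 = 0) (h28 : σ.reg 28 = 0) (h29 : σ.reg 29 = 0) :
    Run w (forUp 29 10 digitStep) σ ((2 * I.K + 1) * 3 ^ I.K * 10 + 1) (fun τ =>
      τ.reg 24 = o + (2 * I.K + 1) * 3 ^ I.K ∧ (∀ x < o, τ.arr 8 x = σ.arr 8 x) ∧
      ∀ c < (2 * I.K + 1) * 3 ^ I.K, τ.arr 8 (o + c) = dg s c) := by
  have hw1 := hW.one_lt
  refine Run.mono (Run.forUp (a := 0) (b := (2 * I.K + 1) * 3 ^ I.K) (B := 8) (fun c τ =>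
    τ.reg 24 = o + c ∧ τ.reg 27 = c % 3 ^ s ∧ τ.reg 28 = dg s c ∧
    (∀ x < o, τ.arr 8 x = σ.arr 8 x) ∧ ∀ c' < c, τ.arr 8 (o + c') = dg s c')
    h29 h10 h1 (Nat.zero_le _) hw1 rfl rfl rfl (by simp [h24, h27, h28]) ?_) (by omega) ?_
  · rintro c τ - hc hτ hF ⟨k24, k27, k28, ka, kb⟩
    have e3 : τ.reg 3 = 3 := (hF.reg 3 rfl).trans h3
    have e1 : τ.reg 1 = 1 := (hF.reg 1 rfl).trans h1
    have e26 : τ.reg 26 = 3 ^ s := (hF.reg 26 rfl).trans h26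
    have hp : 0 < 3 ^ s := by positivity
    refine Run.of_wp (by decide) ?_
    simp only [digitStep, Program.wp, Instr.wp, Test.Holds]
    simp only [State.setReg_reg, State.setReg_arr, State.setArr_arr, State.setArr_reg,
      Nat.reduceEqDiff, OfNat.one_ne_ofNat, if_true, if_false, k24, k27, k28, e1, e3, e26]
    have ka' : ∀ x < o, Function.update (τ.arr 8) (o + c) (dg s c) x = σ.arr 8 x := by
      intro x hx; rw [Function.update_of_ne (by omega)]; exact ka x hx
    have kb' : ∀ c' < c + 1, Function.update (τ.arr 8) (o + c) (dg s c) (o + c') = dg s c' := by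
      intro c' hc'
      rcases Nat.lt_succ_iff_lt_or_eq.1 hc' with h | rfl
      · rw [Function.update_of_ne (by omega)]; exact kb c' h
      · exact Function.update_self _ _ _
    have hd := Nat.div_add_mod c (3 ^ s)
    have hl := Nat.mod_lt c hp
    refine ⟨hw1, hw1, fun heq => ?_, fun hne => ?_⟩
    · have hs : c + 1 = 3 ^ s * (c / 3 ^ s + 1) := by rw [mul_add, mul_one]; omega
      have hm : (c + 1) % 3 ^ s = 0 := by rw [hs]; exact Nat.mul_mod_right _ _
      have hq : (c + 1) / 3 ^ s = c / 3 ^ s + 1 := by rw [hs]; exact Nat.mul_div_cancel_left _ hp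
      have hg : dg s (c + 1) = (dg s c + 1) % 3 := by
        rw [dg, dg, hq]; omega
      have hg3 : dg s c < 3 := Nat.mod_lt _ (by norm_num)
      refine ⟨by omega, hw1, fun h => ⟨by omega, by omega, hm.symm, ?_, ka', kb'⟩,
        fun h => ⟨by omega, hm.symm, ?_, ka', kb'⟩⟩
      · rw [hg, h]
      · rw [hg, Nat.mod_eq_of_lt (by omega)]
    · have hq : (c + 1) / 3 ^ s = c / 3 ^ s := by
        conv_lhs => rw [← hd, add_assoc, Nat.mul_add_div hp,
          Nat.div_eq_of_lt (show c % 3 ^ s + 1 < 3 ^ s by omega), add_zero]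
      have hm : (c + 1) % 3 ^ s = c % 3 ^ s + 1 := by
        conv_lhs => rw [← hd, add_assoc, Nat.mul_add_mod, Nat.mod_eq_of_lt (by omega)]
      exact ⟨by omega, hm.symm, by rw [dg, dg, hq], ka', kb'⟩
  · rintro τ ⟨-, k24, -, -, ka, kb⟩ -
    exact ⟨k24, ka, kb⟩

theorem run_digits (hW : WordSize I.K w) (hS : Start I σ) (h8 : σ.reg 8 = I.K)
    (h10 : σ.reg 10 = (2 * I.K + 1) * 3 ^ I.K) (h9 : ∀ s < I.K, σ.arr 9 s = 3 ^ s) :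
    Run w digits σ (I.K * ((2 * I.K + 1) * 3 ^ I.K * 10 + 7) + 3) (fun τ =>
      ∀ s < I.K, ∀ c < (2 * I.K + 1) * 3 ^ I.K,
        τ.arr 8 (s * ((2 * I.K + 1) * 3 ^ I.K) + c) = dg s c) := by
  have hw1 := hW.one_lt
  generalize hQ : (2 * I.K + 1) * 3 ^ I.K = Q at *
  refine Run.wp_seq (B₂ := I.K * (Q * 10 + 7) + 1) ⟨by omega, by omega, ?_⟩
    (by simp [Program.cost]; omega)
  refine Run.mono (Run.forUp (a := 0) (b := I.K) (B := Q * 10 + 5) (fun i τ =>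
    τ.reg 24 = i * Q ∧ ∀ s < i, ∀ c < Q, τ.arr 8 (s * Q + c) = dg s c)
    (by simp) (by simp [h8]) (by simp [hS.one]) (Nat.zero_le _) hw1 rfl rfl rfl (by simp) ?_)
    (by simp) ?_
  · rintro i τ - hi hτ hF ⟨k24, ka⟩
    have e3 : τ.reg 3 = 3 := (hF.reg 3 rfl).trans (by simp [hS.three])
    have e1 : τ.reg 1 = 1 := (hF.reg 1 rfl).trans (by simp [hS.one])
    have e10 : τ.reg 10 = Q := (hF.reg 10 rfl).trans (by simp [h10])
    have e9 : τ.arr 9 i = 3 ^ i := by rw [hF.arr 9 rfl]; exact h9 i hi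
    refine Run.wp_seq (B₂ := Q * 10 + 1) ⟨by omega, by omega, by omega, ?_⟩
      (by simp [Program.cost]; omega)
    have := run_digitRow (I := I) (s := i) (o := i * Q) (σ := (((τ.setReg 26 (τ.arr 9 (τ.reg 25))).setReg 27 0).setReg 28 0).setReg 29 0) hW (by simpa using e1) (by simpa using e3)
      (by simp [hτ, e9]) (by simp [e10, hQ]) (by simp [k24]) (by simp) (by simp) (by simp)
    rw [hQ] at this
    refine this.mono le_rfl ?_
    rintro τ' ⟨k24', kx, kc⟩ -
    refine ⟨by simp [k24']; ring, fun s hs c hc => ?_⟩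
    rw [State.setReg_arr]
    rcases Nat.lt_succ_iff_lt_or_eq.1 hs with hs | rfl
    · have : (s + 1) * Q ≤ i * Q := Nat.mul_le_mul_right _ hs
      rw [kx _ (by rw [Nat.succ_mul] at this; omega)]
      exact ka s hs c hc
    · exact kc c hc
  · rintro τ ⟨-, -, ka⟩ -
    exact ka

end

section

/-! ## Slots -/

/-- The vertices in the bags at positions below `i` have got slots `sl` (counted from `1`; `0` is no
slot) that are distinct in every bag, and `tp` is their first position. -/
structure SlotInv (I : Inst) (order : ℕ → ℕ) (i : ℕ) (sl tp us : ℕ → ℕ) : Prop where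
  ne_zero : ∀ v, sl v ≠ 0 ↔ ∃ j < i, v ∈ I.bag (order j)
  le : ∀ v, sl v ≤ I.K
  inj : ∀ j < i, ∀ u ∈ I.bag (order j), ∀ v ∈ I.bag (order j), sl u = sl v → u = v
  top : ∀ v, sl v ≠ 0 → tp v < i ∧ v ∈ I.bag (order (tp v)) ∧
    ∀ j < i, v ∈ I.bag (order j) → tp v ≤ j
  used : ∀ s, us s ≤ i

/-- Position `i` is being processed: the first `p` vertices of its bag have slots, too, and the slots
in use in the bag are stamped with `i + 1`. -/
structure SlotMid (I : Inst) (order : ℕ → ℕ) (i p : ℕ) (sl tp us : ℕ → ℕ) : Prop where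
  ne_zero : ∀ v, sl v ≠ 0 ↔ (∃ j < i, v ∈ I.bag (order j)) ∨ v ∈ (I.bag (order i)).take p
  le : ∀ v, sl v ≤ I.K
  inj : ∀ j < i, ∀ u ∈ I.bag (order j), ∀ v ∈ I.bag (order j), sl u = sl v → u = v
  inj_bag : ∀ u ∈ I.bag (order i), ∀ v ∈ I.bag (order i), sl u ≠ 0 → sl u = sl v → u = v
  top : ∀ v, sl v ≠ 0 → tp v < i + 1 ∧ v ∈ I.bag (order (tp v)) ∧
    ∀ j < i + 1, v ∈ I.bag (order j) → tp v ≤ j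
  used : ∀ s, us s ≤ i + 1
  stamp : ∀ s ≠ 0, us s = i + 1 ↔ ∃ v ∈ I.bag (order i), sl v = s

variable {I : Inst} {w : ℕ} {σ : State} {order par sl tp us us' : ℕ → ℕ} {i p : ℕ}

/-- By `Bfs.mem_par`, the vertices of the bag that already have slots all lie in the parent's bag,
where their slots are distinct. -/
theorem SlotInv.mid (h : SlotInv I order i sl tp us) (hB : Bfs I order par) (hi : i < I.N)
    (hu : ∀ s, us' s ≤ i + 1) (hs : ∀ s ≠ 0, us' s = i + 1 ↔ ∃ v ∈ I.bag (order i), sl v = s) :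
    SlotMid I order i 0 sl tp us' where
  ne_zero v := by simpa using h.ne_zero v
  le := h.le
  inj := h.inj
  inj_bag u hu v hv h0 he := by
    obtain ⟨j, hj, hju⟩ := (h.ne_zero u).1 h0
    obtain ⟨k, hk, hkv⟩ := (h.ne_zero v).1 (he ▸ h0)
    exact h.inj (par i) (hB.par_lt i hi (by omega)) u (hB.mem_par hi hj hu hju) v
      (hB.mem_par hi hk hv hkv) he
  top v hv := by
    obtain ⟨h1, h2, h3⟩ := h.top v hv
    refine ⟨by omega, h2, fun j hj hvj => ?_⟩
    rcases Nat.lt_succ_iff_lt_or_eq.1 hj with hj | rfl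
    · exact h3 j hj hvj
    · exact h1.le
  used := hu
  stamp := hs

theorem SlotMid.inv (h : SlotMid I order i p sl tp us) (hp : (I.bag (order i)).length = p) :
    SlotInv I order (i + 1) sl tp us where
  ne_zero v := by
    rw [h.ne_zero, ← hp, List.take_length]
    constructor
    · rintro (⟨j, hj, hv⟩ | hv)
      · exact ⟨j, by omega, hv⟩
      · exact ⟨i, by omega, hv⟩
    · rintro ⟨j, hj, hv⟩
      rcases Nat.lt_succ_iff_lt_or_eq.1 hj with hj | rfl
      · exact Or.inl ⟨j, hj, hv⟩
      · exact Or.inr hv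
  le := h.le
  inj j hj u hu v hv he := by
    rcases Nat.lt_succ_iff_lt_or_eq.1 hj with hj | rfl
    · exact h.inj j hj u hu v hv he
    · refine h.inj_bag u hu v hv ((h.ne_zero u).2 (Or.inr ?_)) he
      rwa [← hp, List.take_length]
  top := h.top
  used := h.used

theorem SlotMid.skip (h : SlotMid I order i p sl tp us) (hp : p < (I.bag (order i)).length)
    (h0 : sl (I.bag (order i))[p] ≠ 0) : SlotMid I order i (p + 1) sl tp us :=
  { h with
    ne_zero := fun v => by
      rw [List.take_add_one, List.getElem?_eq_getElem hp, List.mem_append, ← or_assoc, ← h.ne_zero]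
      refine ⟨Or.inl, fun h' => h'.elim id fun h' => ?_⟩
      simp only [Option.toList_some, List.mem_singleton] at h'
      rwa [h'] }

/-- Pigeonhole: the bag has at most `K` vertices and one of them has no slot, so fewer than `K`
slots are stamped. -/
theorem SlotMid.free (h : SlotMid I order i p sl tp us) (hB : Bfs I order par) (hi : i < I.N)
    (hp : p < (I.bag (order i)).length) (h0 : sl (I.bag (order i))[p] = 0) :
    ∃ s, 1 ≤ s ∧ s ≤ I.K ∧ us s ≠ i + 1 := by
  by_contra! hcon
  have hsub : Finset.Icc 1 I.K ⊆ ((I.bag (order i)).toFinset.erase (I.bag (order i))[p]).image sl := by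
    intro s hs
    rw [Finset.mem_Icc] at hs
    obtain ⟨v, hv, rfl⟩ := (h.stamp s (by omega)).1 (hcon s hs.1 hs.2)
    refine Finset.mem_image.2 ⟨v, Finset.mem_erase.2 ⟨?_, List.mem_toFinset.2 hv⟩, rfl⟩
    rintro rfl
    omega
  have h1 := (Finset.card_le_card hsub).trans Finset.card_image_le
  have h2 : (I.bag (order i))[p] ∈ (I.bag (order i)).toFinset :=
    List.mem_toFinset.2 (List.getElem_mem hp)
  rw [Nat.card_Icc, Finset.card_erase_of_mem h2] at h1
  have h3 := (List.toFinset_card_le (I.bag (order i))).trans (I.bag_len _ (hB.lt i hi))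
  have h4 : 0 < (I.bag (order i)).toFinset.card := Finset.card_pos.2 ⟨_, h2⟩
  omega

/-- A vertex without a slot occurs in no earlier bag, so giving it one disturbs nothing before
position `i`. -/
theorem SlotMid.put (h : SlotMid I order i p sl tp us) (hp : p < (I.bag (order i)).length) {v s : ℕ}
    (hv : (I.bag (order i))[p] = v) (h0 : sl v = 0) (hs0 : 1 ≤ s) (hsK : s ≤ I.K)
    (hus : us s ≠ i + 1) :
    SlotMid I order i (p + 1) (Function.update sl v s) (Function.update tp v i)
      (Function.update us s (i + 1)) := by
  have hold : ∀ j < i, ∀ u ∈ I.bag (order j), u ≠ v := by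
    rintro j hj u hu rfl
    exact (h.ne_zero u).2 (Or.inl ⟨j, hj, hu⟩) h0
  have hmem : v ∈ I.bag (order i) := hv ▸ List.getElem_mem hp
  have hfresh : ∀ u ∈ I.bag (order i), sl u ≠ s := fun u hu he =>
    hus ((h.stamp s (by omega)).2 ⟨u, hu, he⟩)
  refine ⟨fun u => ?_, fun u => ?_, fun j hj u hu u' hu' => ?_, fun u hu u' hu' => ?_, fun u => ?_,
    fun t => ?_, fun t ht => ?_⟩
  · rw [List.take_add_one, List.getElem?_eq_getElem hp, List.mem_append, ← or_assoc, ← h.ne_zero, hv]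
    by_cases hu : u = v
    · subst hu; simp; omega
    · simp [hu]
  · by_cases hu : u = v
    · subst hu; simpa using hsK
    · rw [Function.update_of_ne hu]; exact h.le u
  · rw [Function.update_of_ne (hold j hj u hu), Function.update_of_ne (hold j hj u' hu')]
    exact h.inj j hj u hu u' hu'
  · by_cases e : u = v <;> by_cases e' : u' = v
    · rw [e, e']; exact fun _ _ => rfl
    · subst e
      rw [Function.update_self, Function.update_of_ne e']
      exact fun _ he => absurd he.symm (hfresh u' hu')
    · subst e'
      rw [Function.update_self, Function.update_of_ne e]
      exact fun _ he => absurd he (hfresh u hu)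
    · rw [Function.update_of_ne e, Function.update_of_ne e']
      exact h.inj_bag u hu u' hu'
  · by_cases e : u = v
    · subst e
      rw [Function.update_self, Function.update_self]
      refine fun _ => ⟨by omega, hmem, fun j hj hu => ?_⟩
      rcases Nat.lt_succ_iff_lt_or_eq.1 hj with hj | rfl
      · exact absurd rfl (hold j hj u hu)
      · exact le_rfl
    · rw [Function.update_of_ne e, Function.update_of_ne e]
      exact h.top u
  · by_cases e : t = s
    · subst e; simp
    · rw [Function.update_of_ne e]; exact h.used t
  · by_cases e : t = s
    · subst e
      rw [Function.update_self]
      exact ⟨fun _ => ⟨v, hmem, Function.update_self _ _ _⟩, fun _ => rfl⟩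
    · rw [Function.update_of_ne e, h.stamp t ht]
      refine exists_congr fun u => and_congr_right fun hu => ?_
      by_cases hu : u = v
      · subst hu
        rw [Function.update_self, h0]
        exact ⟨fun h => absurd h.symm ht, fun h => absurd h.symm e⟩
      · rw [Function.update_of_ne hu]

/-- A vertex that has no slot yet stamps cell 0, which belongs to no slot. -/
def stampStep : Program :=
  .instr (.add 29 28 1) ;; .instr (.load 29 0 29) ;; .instr (.load 30 11 29) ;; .instr (.store 13 30 31)

def slotSearch : Program :=
  (.instr (.const 30 1) ;; .instr (.load 32 13 30)) ;;
    .while (.eq 32 31) (.instr (.add 30 30 1) ;; .instr (.load 32 13 30))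

def slotStep : Program :=
  (.instr (.add 29 28 1) ;; .instr (.load 29 0 29) ;; .instr (.load 30 11 29)) ;;
    .ite (.eq 30 4) (slotSearch ;; .instr (.store 11 29 30) ;; .instr (.store 13 30 31) ;;
      .instr (.store 12 29 25)) .skip

/-- As the stamp `i + 1` is different for every position, the array of stamps never has to be
cleared. -/
def slotNode : Program :=
  (.instr (.load 26 5 25) ;; .instr (.load 26 4 26) ;; .instr (.load 27 0 26) ;;
    .instr (.add 27 26 27) ;; .instr (.add 31 25 1) ;; .instr (.copy 28 26)) ;;
    forUp 28 27 stampStep ;; .instr (.copy 28 26) ;; forUp 28 27 slotStep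

def slots : Program := .instr (.const 25 0) ;; forUp 25 6 slotNode

theorem run_slotSearch (hW : WordSize I.K w) (h1 : σ.reg 1 = 1) {a s : ℕ} (h31 : σ.reg 31 = a)
    (hs : 1 ≤ s) (hsK : s ≤ I.K) (hus : σ.arr 13 s ≠ a) :
    Run w slotSearch σ (I.K * 3 + 3) (fun τ => ∃ s', τ.reg 30 = s' ∧ 1 ≤ s' ∧ s' ≤ I.K ∧
      σ.arr 13 s' ≠ a) := by
  have hw1 := hW.one_lt
  refine Run.wp_seq (B₂ := I.K * 3 + 1) ⟨hw1, ?_⟩ (by simp [Program.cost]; omega)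
  refine Run.mono (Run.while (ι := ℕ) (fun s' τ => τ.reg 30 = s' ∧ τ.reg 32 = σ.arr 13 s' ∧ 1 ≤ s' ∧
    s' ≤ s) (fun s' => (s - s') * 3) 1 ⟨by simp, by simp, le_rfl, hs⟩ ?_) (by omega) ?_
  · rintro s' τ ⟨k30, k32, hs', hss⟩ hb hF
    have e1 : τ.reg 1 = 1 := (hF.reg 1 rfl).trans (by simp [h1])
    have e31 : τ.reg 31 = a := (hF.reg 31 rfl).trans (by simp [h31])
    have e13 : τ.arr 13 = σ.arr 13 := (hF.arr 13 rfl).trans (by simp)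
    simp only [Test.Holds, k32, e31] at hb
    have hne : s' ≠ s := by rintro rfl; exact hus hb
    refine ⟨2, Run.of_wp (by decide) ?_⟩
    simp only [Program.wp, Instr.wp]
    simp only [State.setReg_reg, State.setReg_arr, Nat.reduceEqDiff, if_true, if_false, k30, e1, e13]
    exact ⟨hw1, s' + 1, ⟨rfl, rfl, by omega, by omega⟩, by omega⟩
  · rintro τ ⟨s', ⟨k30, k32, hs', hss⟩, hb⟩ hF
    have e31 : τ.reg 31 = a := (hF.reg 31 rfl).trans (by simp [h31])
    simp only [Test.Holds, k32, e31] at hb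
    exact ⟨s', k30, hs', by omega, hb⟩

theorem run_slotNode (hW : WordSize I.K w) (hS : Start I σ) (hB : Bfs I (σ.arr 5) par)
    (h4 : ∀ x < I.N, σ.arr 4 x = I.bp x) (hi : i < I.N) (h25 : σ.reg 25 = i)
    (hI : SlotInv I (σ.arr 5) i (σ.arr 11) (σ.arr 12) (σ.arr 13)) :
    Run w slotNode σ (I.K * (I.K * 3 + 18) + 9) (fun τ =>
      SlotInv I (σ.arr 5) (i + 1) (τ.arr 11) (τ.arr 12) (τ.arr 13)) := by
  have hw1 := hW.one_lt
  have hKw := hW.K_lt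
  have hx := hB.lt i hi
  have hlen := I.inp_len _ hx
  have hbag := I.inp_bag _ hx
  have hlK := I.bag_len _ hx
  have h4x := h4 _ hx
  generalize hord : σ.arr 5 i = x at *
  generalize I.bp x = b at *
  refine Run.wp_seq (B₂ := I.K * (I.K * 3 + 18) + 3) ?_ (by simp [Program.cost]; omega)
  simp only [Program.wp, Instr.wp]
  simp only [State.setReg_reg, State.setReg_arr, Nat.reduceEqDiff, OfNat.one_ne_ofNat, if_true,
    if_false, h25, hord, h4x, hS.inp, hS.one, hlen]
  refine ⟨by omega, hw1, ?_⟩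
  obtain ⟨L, hL⟩ : ∃ L, (I.bag x).length = L := ⟨_, rfl⟩
  rw [hL] at hlK ⊢
  have hc : L * 6 + 1 + (1 + (L * (I.K * 3 + 12) + 1)) ≤ I.K * (I.K * 3 + 18) + 3 := by
    have := Nat.mul_le_mul_right (I.K * 3 + 18) hlK
    have e : L * (I.K * 3 + 18) = L * (I.K * 3 + 12) + L * 6 := by ring
    omega
  refine Run.forUp_seq (a := b) (b := b + L) (B := 4) (B₂ := 1 + (L * (I.K * 3 + 12) + 1))
    (fun j τ => (∀ s, τ.arr 13 s ≤ i + 1) ∧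
      ∀ s ≠ 0, τ.arr 13 s = i + 1 ↔ ∃ v ∈ (I.bag x).take (j - b), σ.arr 11 v = s)
    (by simp) (by simp) (by simp [hS.one]) (by omega) hw1 rfl rfl rfl ?_ ?_ ?_
    (by rw [Nat.add_sub_cancel_left]; exact hc)
  · refine ⟨fun s => ?_, fun s hs => ?_⟩
    · have := hI.used s; simp only [State.setReg_arr]; omega
    · have := hI.used s
      simp only [State.setReg_arr, Nat.sub_self, List.take_zero, List.not_mem_nil, false_and,
        exists_false, iff_false]
      omega
  · rintro j τ hbj hj hτ hF ⟨hu, hst⟩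
    obtain ⟨p, rfl⟩ : ∃ p, j = b + p := ⟨j - b, by omega⟩
    have e1 : τ.reg 1 = 1 := (hF.reg 1 rfl).trans (by simp [hS.one])
    have e31 : τ.reg 31 = i + 1 := (hF.reg 31 rfl).trans (by simp)
    have e0 : τ.arr 0 = I.inp := (hF.arr 0 rfl).trans (by simp [hS.inp])
    have e11 : τ.arr 11 = σ.arr 11 := (hF.arr 11 rfl).trans (by simp)
    have hp : p < (I.bag x).length := by omega
    have hv : I.inp (b + p + 1) = (I.bag x)[p] := by rw [← hbag p (by omega)]; congr 1; omega
    refine Run.of_wp (by decide) ?_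
    simp only [stampStep, Program.wp, Instr.wp]
    simp only [State.setReg_reg, State.setReg_arr, State.setArr_arr, State.setArr_reg,
      Nat.reduceEqDiff, OfNat.one_ne_ofNat, if_true, if_false, hτ, e0, e1, e11, e31, hv]
    refine ⟨hw1, fun s => ?_, fun s hs => ?_⟩
    · by_cases h : s = σ.arr 11 (I.bag x)[p]
      · rw [h, Function.update_self]
      · rw [Function.update_of_ne h]; exact hu s
    · rw [add_assoc, Nat.add_sub_cancel_left, List.take_add_one, List.getElem?_eq_getElem hp]
      simp only [Option.toList_some, List.mem_append, List.mem_singleton, or_and_right, exists_or,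
        exists_eq_left]
      by_cases h : s = σ.arr 11 (I.bag x)[p]
      · rw [h, Function.update_self]; simp
      · rw [Function.update_of_ne h, hst s hs, Nat.add_sub_cancel_left]
        exact ⟨Or.inl, fun h' => h'.resolve_right (Ne.symm h)⟩
  rintro τ₁ - ⟨hu, hst⟩ F₁
  rw [Nat.add_sub_cancel_left, ← hL, List.take_length] at hst
  have a11 : τ₁.arr 11 = σ.arr 11 := (F₁.arr 11 rfl).trans (by simp)
  have a12 : τ₁.arr 12 = σ.arr 12 := (F₁.arr 12 rfl).trans (by simp)
  have hM : SlotMid I (σ.arr 5) i 0 (τ₁.arr 11) (τ₁.arr 12) (τ₁.arr 13) := by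
    rw [a11, a12]; exact hI.mid hB hi hu (by rw [hord]; exact hst)
  refine Run.wp_seq (B₂ := L * (I.K * 3 + 12) + 1) ?_ (by simp [Program.cost])
  have r26 : τ₁.reg 26 = b := (F₁.reg 26 rfl).trans (by simp)
  have r27 : τ₁.reg 27 = b + L := (F₁.reg 27 rfl).trans (by simp)
  have r1 : τ₁.reg 1 = 1 := (F₁.reg 1 rfl).trans (by simp [hS.one])
  refine Run.mono (Run.forUp (a := b) (b := b + L) (B := I.K * 3 + 10) (fun j τ =>
      SlotMid I (σ.arr 5) i (j - b) (τ.arr 11) (τ.arr 12) (τ.arr 13))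
    (by simp [r26]) (by simp [r27]) (by simp [r1]) (by omega) hw1 rfl rfl rfl
    (by simpa using hM) ?_) (by rw [Nat.add_sub_cancel_left]) ?_
  · rintro j τ hbj hj hτ hF hM'
    obtain ⟨p, rfl⟩ : ∃ p, j = b + p := ⟨j - b, by omega⟩
    have e1 : τ.reg 1 = 1 := (hF.reg 1 rfl).trans (by simp [r1])
    have e4 : τ.reg 4 = 0 := (hF.reg 4 rfl).trans (by simp [F₁.reg 4 rfl, hS.zero])
    have e25 : τ.reg 25 = i := (hF.reg 25 rfl).trans (by simp [F₁.reg 25 rfl, h25])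
    have e31 : τ.reg 31 = i + 1 := (hF.reg 31 rfl).trans (by simp [F₁.reg 31 rfl])
    have e0 : τ.arr 0 = I.inp := (hF.arr 0 rfl).trans (by simp [F₁.arr 0 rfl, hS.inp])
    have hp : p < (I.bag x).length := by omega
    have hv : I.inp (b + p + 1) = (I.bag x)[p] := by rw [← hbag p (by omega)]; congr 1; omega
    have hsub : b + p + 1 - b = p + 1 := by omega
    rw [Nat.add_sub_cancel_left] at hM'
    refine Run.wp_seq (B₂ := I.K * 3 + 7) ?_ (by simp [Program.cost]; omega)
    simp only [Program.wp, Instr.wp]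
    simp only [State.setReg_reg, State.setReg_arr, Nat.reduceEqDiff, OfNat.one_ne_ofNat, if_true,
      if_false, hτ, e0, e1, hv]
    refine ⟨hw1, ?_⟩
    have hp' : p < (I.bag (σ.arr 5 i)).length := by rw [hord]; exact hp
    have hgv : (I.bag (σ.arr 5 i))[p] = (I.bag x)[p] := by simp only [hord]
    generalize (I.bag x)[p] = v at hgv
    refine Run.ite (fun hb => ?_) (fun hb => ?_)
    · simp only [Test.Holds, State.setReg_reg, Nat.reduceEqDiff, if_true,
        if_false, e4] at hb
      obtain ⟨s, hs0, hsK, hus⟩ := hM'.free hB hi hp' (by rw [hgv]; exact hb)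
      refine Run.seq (B₂ := 3) (run_slotSearch (a := i + 1) (s := s) hW (by simp [e1]) (by simp [e31])
        hs0 hsK (by simpa using hus)) ?_ (by omega)
      rintro τ' ⟨s', k30, hs0', hsK', hus'⟩ hF'
      have f29 : τ'.reg 29 = v := (hF'.reg 29 rfl).trans (by simp)
      have f31 : τ'.reg 31 = i + 1 := (hF'.reg 31 rfl).trans (by simp [e31])
      have f25 : τ'.reg 25 = i := (hF'.reg 25 rfl).trans (by simp [e25])
      have f11 : τ'.arr 11 = τ.arr 11 := (hF'.arr 11 rfl).trans (by simp)
      have f12 : τ'.arr 12 = τ.arr 12 := (hF'.arr 12 rfl).trans (by simp)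
      have f13 : τ'.arr 13 = τ.arr 13 := (hF'.arr 13 rfl).trans (by simp)
      refine Run.of_wp (by decide) ?_
      simp only [Program.wp, Instr.wp]
      simp only [State.setReg_reg, State.setReg_arr, State.setArr_arr, State.setArr_reg,
        Nat.reduceEqDiff, if_true, if_false, k30, f29, f31, f25, f11, f12, f13, hsub]
      exact hM'.put hp' hgv hb hs0' hsK' (by simpa using hus')
    · simp only [Test.Holds, State.setReg_reg, Nat.reduceEqDiff, if_true,
        if_false, e4] at hb
      refine Run.of_wp (by simp [Program.cost]) ?_
      simp only [Program.wp, State.setReg_arr, hsub]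
      exact hM'.skip hp' (by rw [hgv]; exact hb)
  · rintro τ ⟨-, h⟩ -
    exact h.inv (by rw [Nat.add_sub_cancel_left, hord, hL])

theorem run_slots (hW : WordSize I.K w) (hS : Start I σ) (hB : Bfs I (σ.arr 5) par)
    (h4 : ∀ x < I.N, σ.arr 4 x = I.bp x) (h11 : ∀ v, σ.arr 11 v = 0) (h13 : ∀ s, σ.arr 13 s = 0) :
    Run w slots σ (I.N * (I.K * (I.K * 3 + 18) + 11) + 2) (fun τ =>
      SlotInv I (σ.arr 5) I.N (τ.arr 11) (τ.arr 12) (τ.arr 13)) := by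
  have hw1 := hW.one_lt
  refine Run.wp_seq (B₂ := I.N * (I.K * (I.K * 3 + 18) + 11) + 1) ⟨by omega, ?_⟩
    (by simp [Program.cost]; omega)
  refine Run.mono (Run.forUp (a := 0) (b := I.N) (B := I.K * (I.K * 3 + 18) + 9) (fun j τ =>
      SlotInv I (σ.arr 5) j (τ.arr 11) (τ.arr 12) (τ.arr 13))
    (by simp) (by simp [hS.N]) (by simp [hS.one]) (by omega) hw1 rfl rfl rfl ?_ ?_) (by simp) ?_
  · constructor <;> simp [h11, h13]
  · rintro j τ - hj hτ hF hI
    have hS' : Start I τ := by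
      refine Start.fr (P := .seq (.instr (.const 25 0)) (forUp 25 6 slotNode)) hS
        ⟨fun r hr => ?_, fun a ha => ?_⟩ (by decide) (by decide)
      · simp only [Program.wr, Bool.or_eq_false_iff] at hr
        rw [hF.reg r hr.2]
        simpa [Instr.wr] using fun h : r = 25 => absurd h (by simpa [Instr.wr] using hr.1)
      · simp only [Program.wa, Bool.or_eq_false_iff] at ha
        rw [hF.arr a ha.2]; rfl
    have e5 : τ.arr 5 = σ.arr 5 := (hF.arr 5 rfl).trans (by simp)
    have e4 : τ.arr 4 = σ.arr 4 := (hF.arr 4 rfl).trans (by simp)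
    have := run_slotNode (par := par) hW hS' (by rw [e5]; exact hB) (by rw [e4]; exact h4) hj hτ
      (by rw [e5]; exact hI)
    rw [e5] at this
    exact this.mono le_rfl fun τ' h _ => h
  · rintro τ ⟨-, h⟩ -
    exact h

end

section

/-! ## Distributing the edges to the nodes -/

def bucketStep : Program :=
  .instr (.load 26 0 24) ;; .instr (.add 28 24 1) ;; .instr (.load 27 0 28) ;;
    .instr (.load 26 12 26) ;; .instr (.load 27 12 27) ;;
    .ite (.lt 26 27) (.instr (.copy 26 27)) .skip ;; .instr (.load 29 14 26) ;;
    .instr (.store 15 24 29) ;; .instr (.store 14 26 24) ;; .instr (.add 24 24 2)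

def buckets : Program :=
  (.instr (.copy 24 3) ;; .instr (.const 25 0)) ;; forUp 25 7 bucketStep

/-- The edge at address `p` belongs to node `x`; only the first `k` edges are considered. -/
def Inst.bucket (I : Inst) (tp : ℕ → ℕ) (k x p : ℕ) : Prop :=
  ∃ j < k, p = 3 + 2 * j ∧ max (tp (I.inp (3 + 2 * j))) (tp (I.inp (3 + 2 * j + 1))) = x

variable {I : Inst} {w : ℕ} {σ : State}

theorem run_buckets (hW : WordSize I.K w) (hS : Start I σ) (htp : ∀ v < I.n, σ.arr 12 v < I.N)
    (h14 : ∀ x, σ.arr 14 x = 0) :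
    Run w buckets σ (I.m * 13 + 3) (fun τ => ∃ l,
      Links (τ.arr 14) (τ.arr 15) id I.N (3 + 2 * I.m) I.m (I.bucket (σ.arr 12) I.m) l) := by
  have hw1 := hW.one_lt
  have h3 := hW.three
  refine Run.wp_seq (B₂ := I.m * 13 + 1) ?_ (by simp [Program.cost]; omega)
  simp only [Program.wp, Instr.wp]
  refine ⟨by omega, ?_⟩
  refine Run.mono (Run.forUp (a := 0) (b := I.m) (B := 11) (fun j τ =>
    τ.reg 24 = 3 + 2 * j ∧ ∃ l, Links (τ.arr 14) (τ.arr 15) id I.N (3 + 2 * j) j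
      (I.bucket (σ.arr 12) j) l)
    (by simp) (by simp [hS.m]) (by simp [hS.one]) (Nat.zero_le _) hw1 rfl rfl rfl ?_ ?_)
    (by simp) ?_
  · refine ⟨by simp [hS.three], fun _ => [], ?_⟩
    have : I.bucket (σ.arr 12) 0 = fun _ _ => False := by
      funext x y; simp [Inst.bucket]
    rw [this]
    exact links_empty (by simpa using h14)
  · rintro j τ - hj hτ hF ⟨k24, l, hl⟩
    have e0 : τ.arr 0 = I.inp := (hF.arr 0 rfl).trans (by simp [hS.inp])
    have e12 : τ.arr 12 = σ.arr 12 := (hF.arr 12 rfl).trans (by simp)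
    have e1 : τ.reg 1 = 1 := (hF.reg 1 rfl).trans (by simp [hS.one])
    have e2 : τ.reg 2 = 2 := (hF.reg 2 rfl).trans (by simp [hS.two])
    obtain ⟨hu, hv⟩ := I.edge_lt j hj
    have hR : ∀ x y, I.bucket (σ.arr 12) (j + 1) x y ↔ I.bucket (σ.arr 12) j x y ∨
        (x = max (σ.arr 12 (I.inp (3 + 2 * j))) (σ.arr 12 (I.inp (3 + 2 * j + 1))) ∧
          y = 3 + 2 * j) := by
      intro x y
      constructor
      · rintro ⟨j', hj', h1, h2⟩
        rcases Nat.lt_succ_iff_lt_or_eq.1 hj' with hj' | rfl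
        · exact Or.inl ⟨j', hj', h1, h2⟩
        · exact Or.inr ⟨h2.symm, h1⟩
      · rintro (⟨j', hj', h1, h2⟩ | ⟨h1, h2⟩)
        · exact ⟨j', by omega, h1, h2⟩
        · exact ⟨j, by omega, h2, h1.symm⟩
    have htu := htp _ hu
    have htv := htp _ hv
    have q := hl.insert (e := 3 + 2 * j) (B' := 3 + 2 * (j + 1)) (tgt' := id) (b := 3 + 2 * j)
      (R' := I.bucket (σ.arr 12) (j + 1)) le_rfl (by omega) (by omega) (max_lt htu htv) rfl
      (fun _ _ => rfl) hR
    refine Run.of_wp (by decide) ?_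
    simp only [bucketStep, Program.wp, Instr.wp, Test.Holds]
    simp only [State.setReg_reg, State.setReg_arr, State.setArr_arr, State.setArr_reg,
      Nat.reduceEqDiff, OfNat.ofNat_ne_zero, OfNat.zero_ne_ofNat, OfNat.one_ne_ofNat,
      OfNat.ofNat_ne_one, if_true, if_false, k24, e0, e1, e2, e12]
    refine ⟨hw1, fun hlt => ⟨by omega, by ring, ?_⟩, fun hlt => ⟨by omega, by ring, ?_⟩⟩
    · rw [max_eq_right hlt.le] at q
      exact ⟨_, q⟩
    · rw [max_eq_left (not_lt.1 hlt)] at q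
      exact ⟨_, q⟩
  · rintro τ ⟨-, -, h⟩ -
    exact h

/-! ## Initial tables -/

/-- Table addresses may exceed a word, so they come from a running pointer instead of a product. -/
def tableRow : Program :=
  .instr (.load 27 22 26) ;; .instr (.store 16 24 27) ;; .instr (.add 24 24 1)

def tables : Program :=
  (.instr (.const 24 0) ;; .instr (.const 25 0)) ;;
    forUp 25 6 ((.instr (.store 17 25 24) ;; .instr (.const 26 0)) ;; forUp 26 9 tableRow)

theorem run_tables (hW : WordSize I.K w) (hS : Start I σ) (h9 : σ.reg 9 = 3 ^ I.K)
    (h22 : ∀ c < 3 ^ I.K, σ.arr 22 c = cnt I.K c) :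
    Run w tables σ (I.N * (3 ^ I.K * 5 + 5) + 3) (fun τ => (∀ x < I.N, τ.arr 17 x = x * 3 ^ I.K) ∧
      ∀ x < I.N, ∀ c < 3 ^ I.K, τ.arr 16 (x * 3 ^ I.K + c) = cnt I.K c) := by
  have hw1 := hW.one_lt
  generalize hM : 3 ^ I.K = M at *
  refine Run.wp_seq (B₂ := I.N * (M * 5 + 5) + 1) ⟨by omega, by omega, ?_⟩
    (by simp [Program.cost]; omega)
  refine Run.mono (Run.forUp (a := 0) (b := I.N) (B := M * 5 + 3) (fun i τ =>
    τ.reg 24 = i * M ∧ (∀ x < i, τ.arr 17 x = x * M) ∧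
      ∀ x < i, ∀ c < M, τ.arr 16 (x * M + c) = cnt I.K c)
    (by simp) (by simp [hS.N]) (by simp [hS.one]) (Nat.zero_le _) hw1 rfl rfl rfl (by simp) ?_)
    (by simp) ?_
  · rintro i τ - hi hτ hF ⟨k24, ka, kb⟩
    have e1 : τ.reg 1 = 1 := (hF.reg 1 rfl).trans (by simp [hS.one])
    have e9 : τ.reg 9 = M := (hF.reg 9 rfl).trans (by simp [h9])
    have e22 : τ.arr 22 = σ.arr 22 := (hF.arr 22 rfl).trans (by simp)
    refine Run.wp_seq (B₂ := M * 5 + 1) ⟨by omega, ?_⟩ (by simp [Program.cost]; omega)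
    have k17 : ∀ x < i + 1, Function.update (τ.arr 17) i (i * M) x = x * M := by
      intro x hx
      rcases Nat.lt_succ_iff_lt_or_eq.1 hx with hx | rfl
      · rw [Function.update_of_ne hx.ne]; exact ka x hx
      · exact Function.update_self _ _ _
    refine Run.mono (Run.forUp (a := 0) (b := M) (B := 3) (fun c τ' =>
      τ'.reg 24 = i * M + c ∧ (∀ x < i, ∀ c < M, τ'.arr 16 (x * M + c) = cnt I.K c) ∧
        ∀ c' < c, τ'.arr 16 (i * M + c') = cnt I.K c')
      (by simp) (by simp [e9]) (by simp [e1]) (Nat.zero_le _) hw1 rfl rfl rfl ?_ ?_) (by simp) ?_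
    · exact ⟨by simp [k24], by simpa using kb, fun _ h => absurd h (by omega)⟩
    · rintro c τ' - hc hτ' hF' ⟨f24, fa, fb⟩
      have g1 : τ'.reg 1 = 1 := (hF'.reg 1 rfl).trans (by simp [e1])
      have g22 : τ'.arr 22 c = cnt I.K c := by
        rw [hF'.arr 22 rfl]; simp [e22, h22 c hc]
      refine Run.of_wp (by decide) ?_
      simp only [tableRow, Program.wp, Instr.wp]
      simp only [State.setReg_reg, State.setReg_arr, State.setArr_arr, State.setArr_reg,
        Nat.reduceEqDiff, OfNat.one_ne_ofNat, if_true, if_false, f24, g1, g22, hτ']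
      refine ⟨hw1, by ring, fun x hx c' hc' => ?_, fun c' hc' => ?_⟩
      · have := Nat.mul_le_mul_right M (Nat.succ_le_of_lt hx)
        rw [Nat.succ_mul] at this
        rw [Function.update_of_ne (by omega)]; exact fa x hx c' hc'
      · rcases Nat.lt_succ_iff_lt_or_eq.1 hc' with hc' | rfl
        · rw [Function.update_of_ne (by omega)]; exact fb c' hc'
        · exact Function.update_self _ _ _
    · rintro τ' ⟨-, f24, fa, fb⟩ hF'
      refine ⟨by simp [f24]; ring, ?_, fun x hx c hc => ?_⟩
      · rw [State.setReg_arr, hF'.arr 17 rfl]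
        simpa [k24, hτ] using k17
      · rw [State.setReg_arr]
        rcases Nat.lt_succ_iff_lt_or_eq.1 hx with hx | rfl
        · exact fa x hx c hc
        · exact fb c hc
  · rintro τ ⟨-, -, ka, kb⟩ -
    exact ⟨ka, kb⟩

end

section

/-! ## The whole program -/

variable {I : Inst} {w : ℕ} {σ : State} {order par sl tp us : ℕ → ℕ}

theorem SlotInv.ne_zero_of_mem (h : SlotInv I order I.N sl tp us) {i v : ℕ} (hi : i < I.N)
    (hv : v ∈ I.bag (order i)) : sl v ≠ 0 := (h.ne_zero v).2 ⟨i, hi, hv⟩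

theorem SlotInv.ne_zero_of_lt (h : SlotInv I order I.N sl tp us) (hB : Bfs I order par) {v : ℕ}
    (hv : v < I.n) : sl v ≠ 0 := by
  obtain ⟨x, hx, hvx⟩ := I.cover v hv
  obtain ⟨i, hi, rfl⟩ := hB.surj hx
  exact h.ne_zero_of_mem hi hvx

/-- The climbing argument of `Rooted.adj_max`, needed already to show that the edge lists yield a
rooted decomposition. -/
theorem SlotInv.mem_max (h : SlotInv I order I.N sl tp us) (hB : Bfs I order par) {u v : ℕ}
    (huv : I.adj u v) : max (tp u) (tp v) < I.N ∧ u ∈ I.bag (order (max (tp u) (tp v))) ∧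
      v ∈ I.bag (order (max (tp u) (tp v))) := by
  obtain ⟨x, hx, hu, hv⟩ := I.adj_bag u v huv
  obtain ⟨i, hi, rfl⟩ := hB.surj hx
  clear hx
  induction i using Nat.strong_induction_on with
  | _ i ih =>
    obtain ⟨-, h1, h2⟩ := h.top u (h.ne_zero_of_mem hi hu)
    obtain ⟨-, h3, h4⟩ := h.top v (h.ne_zero_of_mem hi hv)
    have h2 := h2 i hi hu
    have h4 := h4 i hi hv
    rcases (max_le h2 h4).lt_or_eq with hlt | heq
    · have hp := hB.par_lt i hi (by omega)
      have hu' : u ∈ I.bag (order (par i)) := hB.mem_par hi (by omega) hu h1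
      have hv' : v ∈ I.bag (order (par i)) := hB.mem_par hi (by omega) hv h3
      exact ih _ hp (by omega) hu' hv'
    · rw [heq]; exact ⟨hi, hu, hv⟩

theorem Inst.adj_edge (I : Inst) {j : ℕ} (hj : j < I.m) :
    I.adj (I.inp (3 + 2 * j)) (I.inp (3 + 2 * j + 1)) :=
  (I.adj_iff _ _).2 ⟨j, hj, Or.inl ⟨rfl, rfl⟩⟩

/-- Every edge is an ordered pair of vertices of some bag; hence reading all edges is within the
time bound. -/
theorem Inst.m_le (I : Inst) : I.m ≤ I.N * (I.K * I.K) := by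
  have hsub : (Finset.range I.m).image (fun j => (I.inp (3 + 2 * j), I.inp (3 + 2 * j + 1))) ⊆
      (Finset.range I.N).biUnion fun x => (I.bag x).toFinset ×ˢ (I.bag x).toFinset := by
    intro e he
    obtain ⟨j, hj, rfl⟩ := Finset.mem_image.1 he
    obtain ⟨x, hx, hu, hv⟩ := I.adj_bag _ _ (I.adj_edge (Finset.mem_range.1 hj))
    simp only [Finset.mem_biUnion, Finset.mem_range, Finset.mem_product, List.mem_toFinset]
    exact ⟨x, hx, hu, hv⟩
  have h1 := Finset.card_le_card hsub
  rw [Finset.card_image_of_injOn, Finset.card_range] at h1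
  · refine h1.trans ((Finset.card_biUnion_le_card_mul _ _ (I.K * I.K) fun x hx => ?_).trans
      (by rw [Finset.card_range]))
    have := (List.toFinset_card_le (I.bag x)).trans (I.bag_len x (Finset.mem_range.1 hx))
    rw [Finset.card_product]
    exact Nat.mul_le_mul this this
  · intro j hj j' hj' he
    simp only [Finset.coe_range, Set.mem_Iio, Prod.mk.injEq] at hj hj' he
    exact I.edge_inj j hj j' hj' he

/-- The edges assigned to a node have both ends in its bag, and different addresses hold different
pairs. -/
theorem SlotInv.length_le (h : SlotInv I order I.N sl tp us) (hB : Bfs I order par) {x : ℕ}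
    {l : List ℕ} (hl : l.Nodup) (hx : ∀ p ∈ l, I.bucket tp I.m x p) : l.length ≤ I.K * I.K := by
  rcases l.eq_nil_or_concat with rfl | ⟨l', p', hl'⟩
  · simp
  have hxN : x < I.N := by
    obtain ⟨j, hj, -, rfl⟩ := hx p' (by rw [hl']; simp)
    exact (h.mem_max hB (I.adj_edge hj)).1
  have hsub : l.toFinset.image (fun p => (I.inp p, I.inp (p + 1))) ⊆
      (I.bag (order x)).toFinset ×ˢ (I.bag (order x)).toFinset := by
    intro e he
    obtain ⟨p, hp, rfl⟩ := Finset.mem_image.1 he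
    obtain ⟨j, hj, rfl, rfl⟩ := hx p (List.mem_toFinset.1 hp)
    simpa using (h.mem_max hB (I.adj_edge hj)).2
  have h1 := Finset.card_le_card hsub
  rw [Finset.card_image_of_injOn, List.toFinset_card_of_nodup hl, Finset.card_product] at h1
  · have := (List.toFinset_card_le (I.bag (order x))).trans (I.bag_len _ (hB.lt x hxN))
    exact h1.trans (Nat.mul_le_mul this this)
  · intro p hp p' hp' he
    obtain ⟨j, hj, rfl, -⟩ := hx p (by simpa using hp)
    obtain ⟨j', hj', rfl, -⟩ := hx p' (by simpa using hp')
    simp only [Prod.mk.injEq] at he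
    rw [I.edge_inj j hj j' hj' he]

/-- The rooted tree decomposition that the first part of the program computes. -/
def Inst.rooted (I : Inst) {order par sl tp us : ℕ → ℕ} {l : ℕ → List ℕ} (hB : Bfs I order par)
    (h : SlotInv I order I.N sl tp us) (hl : ∀ x, (l x).Nodup)
    (hx : ∀ x p, p ∈ l x ↔ I.bucket tp I.m x p) : Rooted I.n I.N I.K where
  Adj := I.adj
  bag x := I.bag (order x)
  par := par
  top := tp
  slot v := sl v - 1
  el x := (l x).map fun p => (I.inp p, I.inp (p + 1))
  symm u v huv := by
    rw [I.adj_iff] at huv ⊢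
    obtain ⟨j, hj, huv⟩ := huv
    exact ⟨j, hj, huv.symm⟩
  bag_lt x hx' := I.bag_lt _ (hB.lt x hx')
  bag_len x hx' := I.bag_len _ (hB.lt x hx')
  bag_nodup x hx' := I.bag_nodup _ (hB.lt x hx')
  top_lt v hv := (h.top v (h.ne_zero_of_lt hB hv)).1
  top_mem v hv := (h.top v (h.ne_zero_of_lt hB hv)).2.1
  top_le x hx' v hv := (h.top v (h.ne_zero_of_mem hx' hv)).2.2 x hx' hv
  par_lt := hB.par_lt
  par_mem x hx' v hv ht := hB.mem_par hx' ht hv (h.top v (h.ne_zero_of_mem hx' hv)).2.1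
  slot_lt v hv := by
    have := h.ne_zero_of_lt hB hv
    have := h.le v
    omega
  slot_inj x hx' u hu v hv he := by
    have := h.ne_zero_of_mem hx' hu
    have := h.ne_zero_of_mem hx' hv
    exact h.inj x hx' u hu v hv (by omega)
  adj_bag u v huv := by
    obtain ⟨x, hx', hu, hv⟩ := I.adj_bag u v huv
    obtain ⟨i, hi, rfl⟩ := hB.surj hx'
    exact ⟨i, hi, hu, hv⟩
  mem_el x _ u v := by
    simp only [List.mem_map, Prod.mk.injEq, hx]
    constructor
    · rintro ⟨huv, rfl⟩
      obtain ⟨j, hj, ⟨rfl, rfl⟩ | ⟨rfl, rfl⟩⟩ := (I.adj_iff u v).1 huv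
      · exact Or.inl ⟨_, ⟨j, hj, rfl, rfl⟩, rfl, rfl⟩
      · exact Or.inr ⟨_, ⟨j, hj, rfl, max_comm _ _⟩, rfl, rfl⟩
    · rintro (⟨p, ⟨j, hj, rfl, rfl⟩, rfl, rfl⟩ | ⟨p, ⟨j, hj, rfl, rfl⟩, rfl, rfl⟩)
      · exact ⟨I.adj_edge hj, rfl⟩
      · exact ⟨(I.adj_iff _ _).2 ⟨j, hj, Or.inr ⟨rfl, rfl⟩⟩, max_comm _ _⟩
  el_len x _ := by
    rw [List.length_map]
    exact h.length_le hB (hl x) fun p hp => (hx x p).1 hp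

/-- A variant of `TEnv.fr` for the preprocessing, which still writes other registers and arrays in
the range that `TEnv.fr` protects. -/
theorem TEnv.keep {K : ℕ} {σ τ : State} {P : Program} (h : TEnv K σ) (hF : Fr P σ τ)
    (hr : ∀ r ∈ [1, 2, 4, 8, 9, 10, 11], P.wr r = false) (h8 : P.wa 8 = false)
    (h9 : P.wa 9 = false) : TEnv K τ where
  one := (hF.reg 1 (hr _ (by decide))).trans h.one
  two := (hF.reg 2 (hr _ (by decide))).trans h.two
  zero := (hF.reg 4 (hr _ (by decide))).trans h.zero
  slots := (hF.reg 8 (hr _ (by decide))).trans h.slots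
  M := (hF.reg 9 (hr _ (by decide))).trans h.M
  Q := (hF.reg 10 (hr _ (by decide))).trans h.Q
  L := (hF.reg 11 (hr _ (by decide))).trans h.L
  pw := by rw [hF.arr 9 h9]; exact h.pw
  dig := by rw [hF.arr 8 h8]; exact h.dig

/-- The arrays in the list hold zeros. -/
def Zeros (L : List ℕ) (σ : State) : Prop := ∀ a ∈ L, ∀ i, σ.arr a i = 0

theorem Zeros.fr {L L' : List ℕ} {τ : State} {P : Program} (h : Zeros L σ) (hF : Fr P σ τ)
    (hL : ∀ a ∈ L', a ∈ L ∧ P.wa a = false) : Zeros L' τ := fun a ha i => by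
  rw [hF.arr a (hL a ha).2]; exact h a (hL a ha).1 i

def solve : Program :=
  readHead ;; readTree ;; readBags ;; bfs ;; powers ;; digits ;; slotPasses 9 cntBody ;; slots ;;
    buckets ;; tables ;; mainLoop

def solveCost (N m K : ℕ) : ℕ :=
  (m * 3 + 9) + ((N * 14 + 2) + ((N * 8 + 3) + ((9 * (2 * (N - 1)) + 5 * N + 4) + ((K * 4 + 6) +
    ((K * ((2 * K + 1) * 3 ^ K * 10 + 7) + 3) + ((K * (3 ^ K * 8 + 6) + 3) +
    ((N * (K * (K * 3 + 18) + 11) + 2) + ((m * 13 + 3) + ((N * (3 ^ K * 5 + 5) + 3) +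
    mainCost N K)))))))))

theorem run_solve (hW : WordSize I.K w) (hr : ∀ r, σ.reg r = 0) (h0 : σ.arr 0 = I.inp)
    (ha : ∀ a ≠ 0, ∀ i, σ.arr a i = 0) :
    Run w solve σ (solveCost I.N I.m I.K) (fun τ => ∀ m, τ.reg 0 ≤ m ↔ ∃ S : Finset ℕ,
      (∀ v ∈ S, v < I.n) ∧ S.card ≤ m ∧ ∀ v < I.n, v ∈ S ∨ ∃ u, I.adj v u ∧ u ∈ S) := by
  -- These arrays are used without being initialised, so their zeros are tracked until each is first
  -- needed.
  have Z : Zeros [1, 5, 6, 11, 13, 14, 22] σ := fun a h => ha a (by rintro rfl; simp at h)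
  refine Run.seq (run_readHead hW (hr 4) h0) ?_ le_rfl
  rintro τ₁ ⟨S₁, k24⟩ F₁
  have Z₁ := Z.fr (L' := [1, 5, 6, 11, 13, 14, 22]) F₁ (by decide)
  refine Run.seq (run_readTree hW S₁ k24 (Z₁ 1 (by decide))) ?_ le_rfl
  rintro τ₂ ⟨k24, l, hl⟩ F₂
  have S₂ := S₁.fr F₂ (by decide) (by decide)
  have Z₂ := Z₁.fr (L' := [5, 6, 11, 13, 14, 22]) F₂ (by decide)
  refine Run.seq (run_readBags hW S₂ k24) ?_ le_rfl
  rintro τ₃ ⟨k8, k4⟩ F₃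
  have S₃ := S₂.fr F₃ (by decide) (by decide)
  have Z₃ := Z₂.fr (L' := [5, 6, 11, 13, 14, 22]) F₃ (by decide)
  rw [← F₃.arr 1 rfl, ← F₃.arr 2 rfl, ← F₃.arr 3 rfl] at hl
  refine Run.seq (run_bfs hW S₃ hl (Z₃ 5 (by decide)) (Z₃ 6 (by decide))) ?_ le_rfl
  rintro τ₄ hB F₄
  have S₄ := S₃.fr F₄ (by decide) (by decide)
  have Z₄ := Z₃.fr (L' := [11, 13, 14, 22]) F₄ (by decide)
  have k8₄ := (F₄.reg 8 rfl).trans k8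
  refine Run.seq (run_powers hW S₄ k8₄) ?_ le_rfl
  rintro τ₅ ⟨k9, ka9, k11, k10⟩ F₅
  have S₅ := S₄.fr F₅ (by decide) (by decide)
  have Z₅ := Z₄.fr (L' := [11, 13, 14, 22]) F₅ (by decide)
  have k8₅ := (F₅.reg 8 rfl).trans k8₄
  refine Run.seq (run_digits hW S₅ k8₅ k10 ka9) ?_ le_rfl
  rintro τ₆ hd F₆
  have S₆ := S₅.fr F₆ (by decide) (by decide)
  have Z₆ := Z₅.fr (L' := [11, 13, 14, 22]) F₆ (by decide)
  have T₆ : TEnv I.K τ₆ := ⟨S₆.one, S₆.two, S₆.zero, (F₆.reg 8 rfl).trans k8₅,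
    (F₆.reg 9 rfl).trans k9, (F₆.reg 10 rfl).trans k10, (F₆.reg 11 rfl).trans k11,
    by rw [F₆.arr 9 rfl]; exact ka9, hd⟩
  refine Run.seq (run_cnt hW T₆ (Z₆ 22 (by decide))) ?_ le_rfl
  rintro τ₇ hcnt F₇
  have S₇ := S₆.fr F₇ (by decide) (by decide)
  have Z₇ := Z₆.fr (L' := [11, 13, 14]) F₇ (by decide)
  have T₇ := T₆.fr F₇ (by decide) (by decide)
  have a5 : τ₇.arr 5 = τ₄.arr 5 := by rw [F₇.arr 5 rfl, F₆.arr 5 rfl, F₅.arr 5 rfl]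
  have a4 : τ₇.arr 4 = τ₃.arr 4 := by rw [F₇.arr 4 rfl, F₆.arr 4 rfl, F₅.arr 4 rfl, F₄.arr 4 rfl]
  have a7 : τ₇.arr 7 = τ₄.arr 7 := by rw [F₇.arr 7 rfl, F₆.arr 7 rfl, F₅.arr 7 rfl]
  rw [← a5, ← a7] at hB
  rw [← a4] at k4
  refine Run.seq (run_slots hW S₇ hB k4 (Z₇ 11 (by decide)) (Z₇ 13 (by decide))) ?_ le_rfl
  rintro τ₈ hI F₈
  have S₈ := S₇.fr F₈ (by decide) (by decide)
  have Z₈ := Z₇.fr (L' := [14]) F₈ (by decide)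
  have T₈ := T₇.keep F₈ (by decide) rfl rfl
  refine Run.seq (run_buckets hW S₈ (fun v hv => (hI.top v (hI.ne_zero_of_lt hB hv)).1)
    (Z₈ 14 (by decide))) ?_ le_rfl
  rintro τ₉ ⟨pl, hp⟩ F₉
  have S₉ := S₈.fr F₉ (by decide) (by decide)
  have T₉ := T₈.keep F₉ (by decide) rfl rfl
  refine Run.seq (run_tables hW S₉ T₉.M (by rw [F₉.arr 22 rfl, F₈.arr 22 rfl]; exact hcnt)) ?_ le_rfl
  rintro τ ⟨hbase, htab⟩ F
  have S := S₉.fr F (by decide) (by decide)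
  have b5 : τ.arr 5 = τ₇.arr 5 := by rw [F.arr 5 rfl, F₉.arr 5 rfl, F₈.arr 5 rfl]
  have b4 : τ.arr 4 = τ₇.arr 4 := by rw [F.arr 4 rfl, F₉.arr 4 rfl, F₈.arr 4 rfl]
  have b7 : τ.arr 7 = τ₇.arr 7 := by rw [F.arr 7 rfl, F₉.arr 7 rfl, F₈.arr 7 rfl]
  have b11 : τ.arr 11 = τ₈.arr 11 := by rw [F.arr 11 rfl, F₉.arr 11 rfl]
  have b12 : τ.arr 12 = τ₈.arr 12 := by rw [F.arr 12 rfl, F₉.arr 12 rfl]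
  have r0 : τ.reg 0 = 0 := by
    rw [F.reg 0 rfl, F₉.reg 0 rfl, F₈.reg 0 rfl, F₇.reg 0 rfl, F₆.reg 0 rfl, F₅.reg 0 rfl,
      F₄.reg 0 rfl, F₃.reg 0 rfl, F₂.reg 0 rfl, F₁.reg 0 rfl, hr]
  obtain ⟨p1, -, p3, p4, -⟩ := hp
  have p4' : ∀ x p, p ∈ pl x ↔ I.bucket (τ₈.arr 12) I.m x p := fun x p => by
    rw [← p4 x p]; simp
  have hE : MEnv (I.rooted hB hI p3 p4') pl τ := by
    refine ⟨T₉.keep F (by decide) rfl rfl, S.N, fun x hx => ?_, fun x hx i h => ?_, fun x hx h => ?_,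
      fun v hv => ?_, fun v hv => ?_, fun x hx => ?_, fun x hx => ?_, hbase⟩
    · rw [b5, b4, k4 _ (hB.lt x hx), S.inp]
      exact I.inp_len _ (hB.lt x hx)
    · rw [b5, b4, k4 _ (hB.lt x hx), S.inp]
      exact I.inp_bag _ (hB.lt x hx) i h
    · rw [b7]; rfl
    · rw [b11]
      exact (Nat.sub_add_cancel (Nat.one_le_iff_ne_zero.2 (hI.ne_zero_of_lt hB hv))).symm
    · rw [b12]; rfl
    · rw [F.arr 14 rfl, F.arr 15 rfl]; exact p1 x
    · rw [S.inp]; rfl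
  exact run_mainLoop hW hE I.one_le_N r0 htab

theorem solveCost_le {N m K : ℕ} (hN : 1 ≤ N) (hK : 1 ≤ K) (hm : m ≤ N * (K * K)) :
    solveCost N m K ≤ 2000 * (N * (K * K * 3 ^ K)) := by
  have hE : 1 ≤ 3 ^ K := Nat.one_le_pow _ _ (by norm_num)
  obtain ⟨n, rfl⟩ : ∃ n, N = n + 1 := ⟨N - 1, by omega⟩
  simp only [solveCost, mainCost, mergeCost, procCost, joinCost, fillCost, passCost, productCost,
    minCost, closeCost, forgetCost, Nat.add_sub_cancel]
  generalize 3 ^ K = E at *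
  -- Every monomial of the cost is compared with `K * K * E`, with or without the factor `n`; the
  -- rest is linear.
  have h1 : K ≤ K * K := Nat.le_mul_of_pos_left _ hK
  have h2 : K * E ≤ K * K * E := Nat.mul_le_mul_right _ h1
  have h3 : E ≤ K * E := Nat.le_mul_of_pos_left _ hK
  have h4 : K * K ≤ K * K * E := Nat.le_mul_of_pos_right _ hE
  have g1 := Nat.mul_le_mul_left n h1
  have g2 := Nat.mul_le_mul_left n h2
  have g3 := Nat.mul_le_mul_left n h3
  have g4 := Nat.mul_le_mul_left n h4
  have g0 := Nat.mul_le_mul_left n hK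
  linarith

end

/-! ### From the listing to the instance, and the final bounds -/

section

/-! ## Reading lists of numbers -/

theorem flatMap_pair_length {α : Type*} (f g : α → ℕ) (l : List α) :
    (l.flatMap fun e => [f e, g e]).length = 2 * l.length := by
  induction l with
  | nil => rfl
  | cons e l ih => rw [List.flatMap_cons, List.length_append, ih, List.length_cons]; simp; omega

theorem flatMap_pair_getD {α : Type*} (f g : α → ℕ) (l : List α) (j : ℕ) (h : j < l.length) :
    (l.flatMap fun e => [f e, g e]).getD (2 * j) 0 = f l[j] ∧
      (l.flatMap fun e => [f e, g e]).getD (2 * j + 1) 0 = g l[j] := by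
  induction l generalizing j with
  | nil => simp at h
  | cons e l ih =>
    cases j with
    | zero => simp
    | succ j =>
      have := ih j (by simpa using h)
      simpa [Nat.mul_succ] using this

/-- The blocks below `N`, each with its length in front. -/
def blocks (b : ℕ → List ℕ) (N : ℕ) : List ℕ :=
  (List.range N).flatMap fun x => (b x).length :: b x

/-- The position of block `x`. -/
def blockPos (b : ℕ → List ℕ) (x : ℕ) : ℕ := ∑ y ∈ Finset.range x, ((b y).length + 1)

theorem blocks_length (b : ℕ → List ℕ) (N : ℕ) : (blocks b N).length = blockPos b N := by
  induction N with
  | zero => rfl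
  | succ N ih =>
    rw [blocks] at ih
    rw [blocks, List.range_succ, List.flatMap_append, List.length_append, ih, blockPos, blockPos,
      Finset.sum_range_succ]
    simp

theorem blocks_getD (b : ℕ → List ℕ) {N x i : ℕ} (hx : x < N) (hi : i < (b x).length + 1) :
    (blocks b N).getD (blockPos b x + i) 0 = ((b x).length :: b x).getD i 0 := by
  induction N with
  | zero => omega
  | succ N ih =>
    have e : blocks b (N + 1) = blocks b N ++ ((b N).length :: b N) := by
      rw [blocks, List.range_succ, List.flatMap_append]; simp [blocks]
    rw [e]
    rcases Nat.lt_succ_iff_lt_or_eq.1 hx with h | rfl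
    · have h1 : blockPos b (x + 1) ≤ blockPos b N := by
        refine Finset.sum_le_sum_of_subset fun y hy => ?_
        rw [Finset.mem_range] at hy ⊢
        omega
      rw [blockPos, Finset.sum_range_succ, ← blockPos] at h1
      rw [List.getD_append _ _ _ _ (by rw [blocks_length]; omega)]
      exact ih h
    · rw [List.getD_append_right _ _ _ _ (by rw [blocks_length]; omega), blocks_length,
        Nat.add_sub_cancel_left]

/-! ## Edge lists -/

/-- Adjacency of numbers as vertices. -/
def natAdj {n : ℕ} (G : SimpleGraph (Fin n)) (u v : ℕ) : Prop :=
  ∃ (hu : u < n) (hv : v < n), G.Adj ⟨u, hu⟩ ⟨v, hv⟩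

theorem natAdj_val {n : ℕ} {G : SimpleGraph (Fin n)} {u v : Fin n} :
    natAdj G u v ↔ G.Adj u v := ⟨fun ⟨_, _, h⟩ => h, fun h => ⟨u.2, v.2, h⟩⟩

variable {n N : ℕ} {G : SimpleGraph (Fin n)}

theorem natAdj_iff {es : List (Fin n × Fin n)} (h : IsEdgeList G es) {inp : ℕ → ℕ} {o : ℕ}
    (hi : ∀ j (hj : j < es.length), inp (o + 2 * j) = es[j].1 ∧ inp (o + 2 * j + 1) = es[j].2)
    (u v : ℕ) : natAdj G u v ↔ ∃ j < es.length,
      (u = inp (o + 2 * j) ∧ v = inp (o + 2 * j + 1)) ∨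
      (v = inp (o + 2 * j) ∧ u = inp (o + 2 * j + 1)) := by
  constructor
  · rintro ⟨hu, hv, huv⟩
    obtain ⟨e, he, heq⟩ := List.mem_map.1 ((h.2 _ _).2 huv)
    obtain ⟨j, hj, rfl⟩ := List.mem_iff_getElem.1 he
    refine ⟨j, hj, ?_⟩
    rw [(hi j hj).1, (hi j hj).2]
    rcases Sym2.eq_iff.1 heq with ⟨h1, h2⟩ | ⟨h1, h2⟩ <;> simp [h1, h2]
  · rintro ⟨j, hj, huv⟩
    rw [(hi j hj).1, (hi j hj).2] at huv
    have hadj : G.Adj es[j].1 es[j].2 :=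
      (h.2 _ _).1 (List.mem_map.2 ⟨es[j], List.getElem_mem hj, rfl⟩)
    rcases huv with ⟨rfl, rfl⟩ | ⟨rfl, rfl⟩
    · exact natAdj_val.2 hadj
    · exact natAdj_val.2 hadj.symm

theorem edgeList_inj {es : List (Fin n × Fin n)} (h : IsEdgeList G es) {j j' : ℕ}
    (hj : j < es.length) (hj' : j' < es.length) (he : es[j] = es[j']) : j = j' :=
  (List.Nodup.getElem_inj_iff (List.Nodup.of_map _ h.1)).1 he

/-- The input does not state the number of tree edges; this fixes where the bags begin. -/
theorem length_edgeList_tree {T : SimpleGraph (Fin N)} (hT : T.IsTree) {es : List (Fin N × Fin N)}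
    (h : IsEdgeList T es) : es.length = N - 1 := by
  classical
  have h1 := hT.card_edgeFinset
  have h2 : T.edgeFinset = (es.map fun e => s(e.1, e.2)).toFinset := by
    ext e
    induction e using Sym2.ind with
    | _ u v => rw [SimpleGraph.mem_edgeFinset, SimpleGraph.mem_edgeSet, List.mem_toFinset, h.2]
  rw [h2, List.toFinset_card_of_nodup h.1, List.length_map, Fintype.card_fin] at h1
  omega

theorem natAdj_connected (hG : G.Preconnected) {u v : ℕ} (hu : u < n) (hv : v < n) :
    Relation.ReflTransGen (natAdj G) u v := by
  obtain ⟨p⟩ := hG ⟨u, hu⟩ ⟨v, hv⟩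
  suffices ∀ {a b : Fin n}, G.Walk a b → Relation.ReflTransGen (natAdj G) a b from this p
  intro a b p
  induction p with
  | nil => exact .refl
  | cons h _ ih => exact .head (natAdj_val.2 h) ih

/-- Translates the path condition of `Inst` into walks, so that `x` can be put in front of the
shortened walk to give a path. -/
theorem exists_walk_avoiding {x p y : ℕ} (hx : x < n) (hy : y < n) (hyx : y ≠ x)
    (h : Relation.ReflTransGen (fun a b => natAdj G a b ∧ a ≠ x ∧ b ≠ x) p y) :
    ∃ (hp : p < n) (q : G.Walk ⟨p, hp⟩ ⟨y, hy⟩), (⟨x, hx⟩ : Fin n) ∉ q.support := by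
  induction h using Relation.ReflTransGen.head_induction_on with
  | refl => exact ⟨hy, .nil, by simpa using Ne.symm hyx⟩
  | head h _ ih =>
    obtain ⟨⟨ha, hb, hab⟩, hax, -⟩ := h
    obtain ⟨_, q, hq⟩ := ih
    refine ⟨ha, .cons hab q, ?_⟩
    rw [SimpleGraph.Walk.support_cons, List.mem_cons, not_or]
    exact ⟨by simpa using Ne.symm hax, hq⟩

/-! ## The instance described by an input listing -/

variable {T : TreeDecomposition G (Fin N)} (L : InputListing T)

/-- The bag of node `x`. -/
def natBag (x : ℕ) : List ℕ :=
  if h : x < N then (L.bagList ⟨x, h⟩).map Fin.val else []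

theorem natBag_of_lt {x : ℕ} (h : x < N) : natBag L x = (L.bagList ⟨x, h⟩).map Fin.val := dif_pos h

theorem mem_natBag {x v : ℕ} (hx : x < N) :
    v ∈ natBag L x ↔ ∃ hv : v < n, (⟨v, hv⟩ : Fin n) ∈ T.bag ⟨x, hx⟩ := by
  rw [natBag_of_lt L hx, List.mem_map]
  constructor
  · rintro ⟨v, hv, rfl⟩
    exact ⟨v.2, (L.mem_bagList _ _).1 hv⟩
  · rintro ⟨hv, h⟩
    exact ⟨⟨v, hv⟩, (L.mem_bagList _ _).2 h, rfl⟩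

theorem length_natBag {x : ℕ} (hx : x < N) : (natBag L x).length = (T.bag ⟨x, hx⟩).card := by
  rw [natBag_of_lt L hx, List.length_map, ← List.toFinset_card_of_nodup (L.nodup_bagList _)]
  congr 1
  ext v
  rw [List.mem_toFinset, L.mem_bagList]

theorem code_eq : L.code = [n, N, L.edges.length] ++ (L.edges.flatMap fun e => [(e.1 : ℕ), (e.2 : ℕ)])
    ++ (L.treeEdges.flatMap fun e => [(e.1 : ℕ), (e.2 : ℕ)]) ++ blocks (natBag L) N := by
  rw [InputListing.code]
  congr 1
  rw [blocks, ← List.map_coe_finRange_eq_range, List.flatMap_map]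
  congr 1
  funext x
  rw [natBag_of_lt L x.2, List.length_map]
  simpa [Function.comp_def] using List.flatMap_pure_eq_map Fin.val (L.bagList x)

theorem code_edges (j : ℕ) (hj : j < L.edges.length) :
    L.code.getD (3 + 2 * j) 0 = L.edges[j].1 ∧ L.code.getD (3 + 2 * j + 1) 0 = L.edges[j].2 := by
  have h := flatMap_pair_getD (fun e : Fin n × Fin n => (e.1 : ℕ)) (fun e => (e.2 : ℕ)) L.edges j hj
  have hl := flatMap_pair_length (fun e : Fin n × Fin n => (e.1 : ℕ)) (fun e => (e.2 : ℕ)) L.edges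
  rw [code_eq, List.append_assoc, List.append_assoc]
  constructor
  · rw [List.getD_append_right _ _ _ _ (by simp), List.getD_append _ _ _ _ (by rw [hl]; simp; omega),
      ← h.1]
    congr 1; simp
  · rw [List.getD_append_right _ _ _ _ (by simp; omega),
      List.getD_append _ _ _ _ (by rw [hl]; simp; omega), ← h.2]
    congr 1; simp; omega

theorem code_treeEdges (j : ℕ) (hj : j < L.treeEdges.length) :
    L.code.getD (3 + 2 * L.edges.length + 2 * j) 0 = L.treeEdges[j].1 ∧
      L.code.getD (3 + 2 * L.edges.length + 2 * j + 1) 0 = L.treeEdges[j].2 := by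
  have h := flatMap_pair_getD (fun e : Fin N × Fin N => (e.1 : ℕ)) (fun e => (e.2 : ℕ)) L.treeEdges j hj
  have hl := flatMap_pair_length (fun e : Fin n × Fin n => (e.1 : ℕ)) (fun e => (e.2 : ℕ)) L.edges
  have hl' := flatMap_pair_length (fun e : Fin N × Fin N => (e.1 : ℕ)) (fun e => (e.2 : ℕ)) L.treeEdges
  have h3 : ([n, N, L.edges.length] ++ (L.edges.flatMap fun e => [(e.1 : ℕ), (e.2 : ℕ)])).length =
    3 + 2 * L.edges.length := by rw [List.length_append, hl]; simp
  rw [code_eq, List.append_assoc]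
  constructor
  · rw [List.getD_append_right _ _ _ _ (by rw [h3]; omega),
      List.getD_append _ _ _ _ (by rw [h3, hl']; omega), ← h.1, h3]
    congr 1; omega
  · rw [List.getD_append_right _ _ _ _ (by rw [h3]; omega),
      List.getD_append _ _ _ _ (by rw [h3, hl']; omega), ← h.2, h3]
    congr 1; omega

theorem code_bags {x i : ℕ} (hx : x < N) (hi : i < (natBag L x).length + 1) :
    L.code.getD (3 + 2 * L.edges.length + 2 * (N - 1) + blockPos (natBag L) x + i) 0 =
      ((natBag L x).length :: natBag L x).getD i 0 := by
  have hl := flatMap_pair_length (fun e : Fin n × Fin n => (e.1 : ℕ)) (fun e => (e.2 : ℕ)) L.edges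
  have hl' := flatMap_pair_length (fun e : Fin N × Fin N => (e.1 : ℕ)) (fun e => (e.2 : ℕ)) L.treeEdges
  rw [length_edgeList_tree T.isTree L.isEdgeList_treeEdges] at hl'
  have h3 : ([n, N, L.edges.length] ++ (L.edges.flatMap fun e => [(e.1 : ℕ), (e.2 : ℕ)]) ++
      (L.treeEdges.flatMap fun e => [(e.1 : ℕ), (e.2 : ℕ)])).length =
    3 + 2 * L.edges.length + 2 * (N - 1) := by
    rw [List.length_append, List.length_append, hl, hl']; simp
  rw [code_eq, List.getD_append_right _ _ _ _ (by rw [h3]; omega), h3, ← blocks_getD _ hx hi]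
  congr 1; omega

/-- The instance described by an input listing. -/
def inst (L : InputListing T) : Inst where
  n := n
  N := N
  m := L.edges.length
  K := Finset.univ.sup fun x => (T.bag x).card
  inp i := L.code.getD i 0
  adj := natAdj G
  tadj := natAdj T.tree
  bag := natBag L
  bp x := 3 + 2 * L.edges.length + 2 * (N - 1) + blockPos (natBag L) x
  one_le_N := by
    obtain ⟨x⟩ := T.isTree.connected.nonempty
    have := x.2
    omega
  inp_zero := by simp [code_eq]
  inp_one := by simp [code_eq]
  inp_two := by simp [code_eq]
  edge_lt j hj := by
    rw [(code_edges L j hj).1, (code_edges L j hj).2]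
    exact ⟨Fin.is_lt _, Fin.is_lt _⟩
  adj_iff := natAdj_iff (inp := fun i => L.code.getD i 0) L.isEdgeList_edges (code_edges L)
  edge_inj j hj j' hj' he := by
    rw [(code_edges L j hj).1, (code_edges L j hj).2, (code_edges L j' hj').1,
      (code_edges L j' hj').2] at he
    exact edgeList_inj L.isEdgeList_edges hj hj' (Prod.ext (Fin.ext he.1) (Fin.ext he.2))
  tree_lt j hj := by
    rw [← length_edgeList_tree T.isTree L.isEdgeList_treeEdges] at hj
    rw [(code_treeEdges L j hj).1, (code_treeEdges L j hj).2]
    exact ⟨Fin.is_lt _, Fin.is_lt _⟩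
  tadj_iff x y := by
    rw [← length_edgeList_tree T.isTree L.isEdgeList_treeEdges]
    exact natAdj_iff (inp := fun i => L.code.getD i 0) L.isEdgeList_treeEdges (code_treeEdges L) x y
  conn x hx := natAdj_connected T.isTree.connected.preconnected (by omega) hx
  path v x y p hx hy hvx hvy hxp h hyx := by
    obtain ⟨_, hp, hadj⟩ := hxp
    obtain ⟨_, q, hq⟩ := exists_walk_avoiding hx hy hyx h
    obtain ⟨hv, hvx⟩ := (mem_natBag L hx).1 hvx
    obtain ⟨_, hvy⟩ := (mem_natBag L hy).1 hvy
    -- The walk from `p` avoids `x`, so its bypass preceded by `x` is a path, and `p` is its second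
    -- node.
    refine (mem_natBag L hp).2 ⟨hv, T.mem_bag_of_path _ _ _ hvx hvy (.cons hadj q.bypass) ?_ _ ?_⟩
    · rw [SimpleGraph.Walk.cons_isPath_iff]
      exact ⟨q.bypass_isPath, fun h => hq (q.support_bypass_subset_support h)⟩
    · simp
  bp_zero := by simp [blockPos]
  bp_succ x _ := by rw [blockPos, Finset.sum_range_succ, ← blockPos]; omega
  inp_len x hx := by
    have := code_bags L hx (i := 0) (by omega)
    simpa using this
  inp_bag x hx i hi := by
    have := code_bags L hx (i := i + 1) (by omega)
    rw [List.getD_cons_succ, List.getD_eq_getElem _ _ hi] at this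
    rw [← this]
    congr 1; omega
  bag_lt x hx v hv := ((mem_natBag L hx).1 hv).1
  bag_nodup x hx := by
    rw [natBag_of_lt L hx]
    exact (L.nodup_bagList _).map Fin.val_injective
  bag_len x hx := by
    rw [length_natBag L hx]
    exact Finset.le_sup (f := fun x => (T.bag x).card) (Finset.mem_univ _)
  exists_len := by
    have := T.isTree.connected.nonempty
    obtain ⟨x, -, hx⟩ := Finset.exists_mem_eq_sup Finset.univ Finset.univ_nonempty
      fun x => (T.bag x).card
    exact ⟨x, x.2, by rw [length_natBag L x.2, hx]⟩
  cover v hv := by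
    obtain ⟨x, hx⟩ := T.exists_mem_bag ⟨v, hv⟩
    exact ⟨x, x.2, (mem_natBag L x.2).2 ⟨hv, hx⟩⟩
  adj_bag u v h := by
    obtain ⟨hu, hv, h⟩ := h
    obtain ⟨x, hx, hx'⟩ := T.exists_edge_bag _ _ h
    exact ⟨x, x.2, (mem_natBag L x.2).2 ⟨hu, hx⟩, (mem_natBag L x.2).2 ⟨hv, hx'⟩⟩

/-! ## The theorem -/

/-- By Bernoulli's inequality `2 * K + 1 ≤ 3 ^ K`, so every quantity is at most `27 ^ K`, which is
less than `2 ^ (5 * K)`; with `K ≤ 2 * κ` this makes `10 * κ` bits. -/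
theorem wordSize {K κ : ℕ} (hK : 1 ≤ K) (hκ : K ≤ 2 * κ) : WordSize K (10 * κ) := by
  have hb : (2 * K + 1) ≤ 3 ^ K := by
    have := one_add_mul_le_pow (R := ℤ) (a := 2) (by norm_num) K
    have h : ((2 * K + 1 : ℕ) : ℤ) ≤ ((3 ^ K : ℕ) : ℤ) := by push_cast; norm_num at this; linarith
    exact_mod_cast h
  have h27 : 3 ^ K * (3 ^ K * 3 ^ K) = 27 ^ K := by rw [← mul_pow, ← mul_pow]; norm_num
  have hlt : 27 ^ K < 2 ^ (10 * κ) := by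
    calc 27 ^ K < 32 ^ K := Nat.pow_lt_pow_left (by norm_num) (by omega)
      _ = 2 ^ (5 * K) := by rw [pow_mul]; norm_num
      _ ≤ 2 ^ (10 * κ) := Nat.pow_le_pow_right (by norm_num) (by omega)
  have h3 : 27 ≤ 27 ^ K := Nat.le_self_pow (by omega) _
  refine ⟨hK, by omega, lt_of_le_of_lt ?_ hlt, lt_of_le_of_lt ?_ hlt⟩
  · rw [← h27]
    exact Nat.mul_le_mul hb (Nat.mul_le_mul_right _ hb)
  · rw [← h27]
    exact Nat.le_mul_of_pos_left _ (by positivity)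

theorem isMinDominatingSetSize_of_le_iff {r : ℕ} (h : ∀ m, r ≤ m ↔ ∃ S : Finset ℕ,
    (∀ v ∈ S, v < n) ∧ S.card ≤ m ∧ ∀ v < n, v ∈ S ∨ ∃ u, natAdj G v u ∧ u ∈ S) :
    IsMinDominatingSetSize G r := by
  have hlow : ∀ D : Finset (Fin n), IsDominatingSet G D → r ≤ D.card := by
    intro D hD
    refine (h _).2 ⟨D.map Fin.valEmbedding, ?_, (Finset.card_map _).le, fun v hv => ?_⟩
    · simp
    · by_cases hvD : (⟨v, hv⟩ : Fin n) ∈ D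
      · exact Or.inl (Finset.mem_map.2 ⟨_, hvD, rfl⟩)
      · obtain ⟨d, hd, hvd⟩ := hD _ hvD
        exact Or.inr ⟨d, ⟨hv, d.2, hvd⟩, Finset.mem_map.2 ⟨_, hd, rfl⟩⟩
  constructor
  · obtain ⟨S, hS, hc, hd⟩ := (h r).1 le_rfl
    have hD : IsDominatingSet G (S.attachFin hS) := by
      intro v hv
      rw [Finset.mem_attachFin] at hv
      obtain ⟨u, ⟨_, hu, huv⟩, huS⟩ := (hd v v.2).resolve_left hv
      exact ⟨⟨u, hu⟩, by rwa [Finset.mem_attachFin], huv⟩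
    refine ⟨_, hD, le_antisymm ?_ (hlow _ hD)⟩
    rwa [Finset.card_attachFin]
  · rintro m ⟨D, hD, rfl⟩
    exact hlow D hD

end

end DomSet

theorem mainTheorem2 :
    ∃ (P : RAM.Program) (c : ℕ), ∀ a : ℕ, ∃ C : ℕ,
      ∀ (n N k : ℕ) (G : SimpleGraph (Fin n)) (T : TreeDecomposition G (Fin N))
        (I : InputListing T),
        N ≤ a * n → T.width = k →
          ∃ t r : ℕ,
            RAM.Computes (c * max k 1) P I.code t r ∧
            IsMinDominatingSetSize G r ∧
            t ≤ C * (n * (max k 1) ^ 2 * 3 ^ k) := by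
  -- The factor 10 comes from `wordSize`. From `K = k + 1 ≤ 2 * κ` the square contributes 4 and the
  -- power a further 3, so the 2000 of `solveCost_le` becomes 24000; `a` bounds `N` by `a * n`.
  refine ⟨DomSet.solve, 10, fun a => ⟨24000 * a, fun n N k G T L hN hk => ?_⟩⟩
  have hN1 : 1 ≤ N := (DomSet.inst L).one_le_N
  -- A tree has at least one node, so `N ≤ a * n` rules out the empty graph.
  have hn : 0 < n := Nat.pos_of_ne_zero (by rintro rfl; omega)
  obtain ⟨x, hx⟩ := T.exists_mem_bag ⟨0, hn⟩
  -- Some bag is nonempty, so the subtraction in the width is not truncated and the largest bag has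
  -- exactly `k + 1` vertices.
  have hK1 : 1 ≤ Finset.univ.sup fun x => (T.bag x).card :=
    le_trans (Finset.card_pos.2 ⟨_, hx⟩)
      (Finset.le_sup (f := fun x => (T.bag x).card) (Finset.mem_univ x))
  have hK : (DomSet.inst L).K = k + 1 := by
    rw [TreeDecomposition.width] at hk
    show (Finset.univ.sup fun x => (T.bag x).card) = k + 1
    omega
  generalize hκ : max k 1 = κ
  have hKκ : k + 1 ≤ 2 * κ := by omega
  have hW : DomSet.WordSize (DomSet.inst L).K (10 * κ) := by
    rw [hK]; exact DomSet.wordSize (by omega) hKκ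
  obtain ⟨t, τ, hex, ht, hτ⟩ := DomSet.run_solve (I := DomSet.inst L) (σ := RAM.initState L.code) hW
    (fun _ => rfl) rfl (fun b hb i => if_neg hb)
  refine ⟨t, τ.reg 0, ⟨τ, hex, rfl⟩, DomSet.isMinDominatingSetSize_of_le_iff hτ, ht.trans ?_⟩
  refine (DomSet.solveCost_le hN1 (by omega) (DomSet.inst L).m_le).trans ?_
  rw [hK]
  calc 2000 * (N * ((k + 1) * (k + 1) * 3 ^ (k + 1)))
      ≤ 2000 * (a * n * (2 * κ * (2 * κ) * 3 ^ (k + 1))) := by gcongr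
    _ = 24000 * a * (n * κ ^ 2 * 3 ^ k) := by ring
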